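/- Let $\alpha \ge 1$ be a constant and let $\Sigma \subseteq \mathbb N$ be an alphabet. The edit distance $\mathrm{ED}(A,B)$ of two strings is the minimum number of insertions, deletions and substitutions of single symbols that convert $A$ into $B$; an estimate $E \in \mathbb N$ is a $\beta$-approximation if $\mathrm{ED}(A,B) \le E \le \beta\cdot \mathrm{ED}(A,B)$. Algorithms run on a word RAM with words of $O(\log(n+m))$ bits and unit-cost operations, where $n\ge 1$ is a size parameter that is known to the algorithm and $m$ bounds the symbols that occur (so words have $O(\log n)$ bits if $\Sigma$ is finite). Suppose that there are two preprocessing programs and a query program such that, for all $n \ge 1$ and all strings $A,B$ over $\Sigma$ of length at most $n$: the preprocessing programs act separately on $A$ and on $B$, each in time $O(n^{t})$ for some constant $t$; and the query program, with random access to the two results, runs in time $O(n^{2-\varepsilon})$ for some constant $\varepsilon>0$ and outputs an $\alpha$-approximation of $\mathrm{ED}(A,B)$. Then there are a function $\eta$ with $\eta(n)\to 0$ as $n \to \infty$ and a program without preprocessing that, for all $n\ge1$ and all strings $A,B$ over $\Sigma$ of length at most $n$, runs in time $O(n^{2-\varepsilon'})$ for some constant $\varepsilon'>0$ and outputs an $(\alpha+\eta(n))$-approximation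 of $\mathrm{ED}(A,B)$. This holds both for deterministic algorithms (in the hypothesis and in the conclusion) and for randomized algorithms (in the hypothesis and in the conclusion), where the time and word-size bounds hold for all outcomes of the coin flips, the two preprocessing programs and the query program share the coin flips, and the output is correct with probability at least $1-1/n$ for each pair $A,B$. -/

import Mathlib

/-! ### Edit distance -/

/-- `Edit u v`: the string `v` arises from `u` by inserting, deleting or substituting one symbol. -/
inductive Edit : List ℕ → List ℕ → Prop
  | insert (u v : List ℕ) (a : ℕ) : Edit (u ++ v) (u ++ a :: v)
  | delete (u v : List ℕ) (a : ℕ) : Edit (u ++ a :: v) (u ++ v)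
  | subst (u v : List ℕ) (a b : ℕ) : Edit (u ++ a :: v) (u ++ b :: v)

/-- `EditPath k u v`: the string `u` can be converted into `v` by exactly `k` edits. -/
inductive EditPath : ℕ → List ℕ → List ℕ → Prop
  | nil (u : List ℕ) : EditPath 0 u u
  | cons {k : ℕ} {u v w : List ℕ} : Edit u v → EditPath k v w → EditPath (k + 1) u w

/-- Edit distance: the minimum number of insertions, deletions and substitutions that convert
`u` into `v`. -/
noncomputable def editDist (u v : List ℕ) : ℕ := sInf {k | EditPath k u v}

/-- The set in the definition of `editDist` is nonempty: delete all of `u`, then insert `v`. -/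
theorem exists_editPath (u v : List ℕ) : ∃ k, EditPath k u v := by
  induction u with
  | nil =>
    suffices h : ∀ w : List ℕ, ∀ x : List ℕ, ∃ k, EditPath k x (x ++ w) from by
      simpa using h v []
    intro w
    induction w with
    | nil => intro x; exact ⟨0, by simpa using EditPath.nil x⟩
    | cons a w ih =>
      intro x
      obtain ⟨k, hk⟩ := ih (x ++ [a])
      exact ⟨k + 1, .cons (by simpa using Edit.insert x [] a) (by simpa using hk)⟩
  | cons a u ih =>
    obtain ⟨k, hk⟩ := ih
    exact ⟨k + 1, .cons (by simpa using Edit.delete [] u a) hk⟩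

/-! ### Word RAM programs

A program works with registers and a random-access memory, both initially `0`, with read-only input
arrays, and with a tape of coin flips. Control flow is structured (a program with jumps becomes such
a program, up to a constant factor in the running time, by keeping the program counter in a
register). Every basic operation costs one unit of time. The word size enters as a bound `W` on
every value that is written: a run in which a larger value would arise does not count as a run. -/

/-- The arithmetic and bitwise operations on words (subtraction is truncated, and `x / 0 = 0`). -/
inductive BinOp
  | add | sub | mul | div | land | lor | xor | shl | shr

def BinOp.eval : BinOp → ℕ → ℕ → ℕ
  | .add, x, y => x + y
  | .sub, x, y => x - y
  | .mul, x, y => x * y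
  | .div, x, y => x / y
  | .land, x, y => x &&& y
  | .lor, x, y => x ||| y
  | .xor, x, y => x ^^^ y
  | .shl, x, y => x <<< y
  | .shr, x, y => x >>> y

/-- Programs; the letters `x`, `y`, `z` are names of registers. -/
inductive Prog
  /-- do nothing -/
  | skip
  /-- `x := c` -/
  | const (x c : ℕ)
  /-- `x := y op z` -/
  | op (o : BinOp) (x y z : ℕ)
  /-- `x := mem[y]` -/
  | load (x y : ℕ)
  /-- `mem[x] := y` -/
  | store (x y : ℕ)
  /-- `x := i-th input array[y]` -/
  | input (i x y : ℕ)
  /-- `x := y`-th coin flip -/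
  | coin (x y : ℕ)
  /-- `p` and then `q` -/
  | seq (p q : Prog)
  /-- if `x ≠ 0` then `p` else `q` -/
  | cond (x : ℕ) (p q : Prog)
  /-- while `x ≠ 0` do `p` -/
  | loop (x : ℕ) (p : Prog)

/-- The program never flips a coin. -/
def Prog.CoinFree : Prog → Prop
  | .coin _ _ => False
  | .seq p q => p.CoinFree ∧ q.CoinFree
  | .cond _ p q => p.CoinFree ∧ q.CoinFree
  | .loop _ p => p.CoinFree
  | _ => True

structure MState where
  reg : ℕ → ℕ
  mem : ℕ → ℕ

def MState.setReg (s : MState) (x v : ℕ) : MState :=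
  { s with reg := Function.update s.reg x v }

def MState.setMem (s : MState) (a v : ℕ) : MState :=
  { s with mem := Function.update s.mem a v }

/-- The initial state: register `0` holds `n`, everything else is `0`. -/
def MState.init (n : ℕ) : MState where
  reg := Function.update (fun _ => 0) 0 n
  mem := fun _ => 0

/-- `Exec W inp ρ p s s' t`: with input arrays `inp` and coin flips `ρ`, the program `p` started in
state `s` halts in state `s'` after `t` steps, and no value above `W` is ever written. -/
inductive Exec (W : ℕ) (inp : ℕ → ℕ → ℕ) (ρ : ℕ → Bool) :
    Prog → MState → MState → ℕ → Prop
  | skip (s : MState) : Exec W inp ρ .skip s s 1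
  | const (s : MState) (x c : ℕ) : c ≤ W → Exec W inp ρ (.const x c) s (s.setReg x c) 1
  | op (s : MState) (o : BinOp) (x y z : ℕ) : o.eval (s.reg y) (s.reg z) ≤ W →
      Exec W inp ρ (.op o x y z) s (s.setReg x (o.eval (s.reg y) (s.reg z))) 1
  | load (s : MState) (x y : ℕ) : s.mem (s.reg y) ≤ W →
      Exec W inp ρ (.load x y) s (s.setReg x (s.mem (s.reg y))) 1
  | store (s : MState) (x y : ℕ) : s.reg y ≤ W →
      Exec W inp ρ (.store x y) s (s.setMem (s.reg x) (s.reg y)) 1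
  | input (s : MState) (i x y : ℕ) : inp i (s.reg y) ≤ W →
      Exec W inp ρ (.input i x y) s (s.setReg x (inp i (s.reg y))) 1
  | coin (s : MState) (x y : ℕ) : (ρ (s.reg y)).toNat ≤ W →
      Exec W inp ρ (.coin x y) s (s.setReg x (ρ (s.reg y)).toNat) 1
  | seq {p q : Prog} {s s' s'' : MState} {t t' : ℕ} :
      Exec W inp ρ p s s' t → Exec W inp ρ q s' s'' t' → Exec W inp ρ (.seq p q) s s'' (t + t')
  | cond_true {x : ℕ} {p q : Prog} {s s' : MState} {t : ℕ} : s.reg x ≠ 0 →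
      Exec W inp ρ p s s' t → Exec W inp ρ (.cond x p q) s s' (1 + t)
  | cond_false {x : ℕ} {p q : Prog} {s s' : MState} {t : ℕ} : s.reg x = 0 →
      Exec W inp ρ q s s' t → Exec W inp ρ (.cond x p q) s s' (1 + t)
  | loop_true {x : ℕ} {p : Prog} {s s' s'' : MState} {t t' : ℕ} : s.reg x ≠ 0 →
      Exec W inp ρ p s s' t → Exec W inp ρ (.loop x p) s' s'' t' →
      Exec W inp ρ (.loop x p) s s'' (1 + t + t')
  | loop_false {x : ℕ} {p : Prog} {s : MState} : s.reg x = 0 →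
      Exec W inp ρ (.loop x p) s s 1

/-- Started with `n` in register `0`, the program `p` halts in state `s` within time `T`. -/
def Halts (W : ℕ) (inp : ℕ → ℕ → ℕ) (ρ : ℕ → Bool) (p : Prog) (n : ℕ) (T : ℝ) (s : MState) :
    Prop :=
  ∃ t : ℕ, (t : ℝ) ≤ T ∧ Exec W inp ρ p (MState.init n) s t

/-- A string as an input array: the length in cell `0`, then the symbols. -/
def strArray (u : List ℕ) : ℕ → ℕ
  | 0 => u.length
  | i + 1 => u.getD i 0

/-- Two arrays as the input arrays number `0` and `1`. -/
def inputs (f g : ℕ → ℕ) : ℕ → ℕ → ℕ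
  | 0 => f
  | 1 => g
  | _ => fun _ => 0

/-- The largest word for size parameter `n` and symbols up to `m`: words have `O(log (n + m))`
bits. -/
def wordBound (C c n m : ℕ) : ℕ := C * (n + m + 1) ^ c

/-! ### Deterministic and randomized algorithms -/

inductive AlgKind
  | deterministic
  | randomized

/-- Deterministic algorithms must not flip coins. -/
def AlgKind.Allows : AlgKind → Prog → Prop
  | .deterministic, p => p.CoinFree
  | .randomized, _ => True

/-- Independent fair coin flips. -/
noncomputable def coinMeasure : MeasureTheory.Measure (ℕ → Bool) :=
  MeasureTheory.Measure.infinitePi fun _ => (PMF.uniformOfFintype Bool).toMeasure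

/-- The event `S` that the answer is correct must be certain for a deterministic algorithm, and have
probability at least `1 - 1 / n` for a randomized one. -/
def AlgKind.Reliable (n : ℕ) (S : Set (ℕ → Bool)) : AlgKind → Prop
  | .deterministic => S = Set.univ
  | .randomized => 1 - 1 / (n : ℝ) ≤ coinMeasure.real S

/-- `u` is a string over the alphabet `Alph` of length at most `n` and with symbols at most `m`. -/
def IsInput (Alph : Set ℕ) (n m : ℕ) (u : List ℕ) : Prop :=
  u.length ≤ n ∧ ∀ a ∈ u, a ∈ Alph ∧ a ≤ m

/-- `e` approximates the edit distance of `u` and `v` within the factor `β`. -/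
def IsApprox (β : ℝ) (u v : List ℕ) (e : ℕ) : Prop :=
  editDist u v ≤ e ∧ (e : ℝ) ≤ β * editDist u v

/-- There is an `α`-approximation algorithm for the edit distance of strings over `Alph` with
polynomial preprocessing time and truly subquadratic query time. The two strings are preprocessed
separately (the coin flips are shared); the final memories are the input arrays of the query
program, whose answer is found in register `0`. -/
def HasPreprocessedApprox (k : AlgKind) (Alph : Set ℕ) (α : ℝ) : Prop :=
  ∃ (pA pB q : Prog) (C c d : ℕ) (ε : ℝ), 0 < ε ∧
    k.Allows pA ∧ k.Allows pB ∧ k.Allows q ∧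
    ∀ n m : ℕ, 1 ≤ n → ∀ A B : List ℕ, IsInput Alph n m A → IsInput Alph n m B →
      ∃ e : (ℕ → Bool) → ℕ,
        (∀ ρ : ℕ → Bool, ∃ sA sB s : MState,
          Halts (wordBound C c n m) (inputs (strArray A) 0) ρ pA n (C * (n : ℝ) ^ d) sA ∧
          Halts (wordBound C c n m) (inputs (strArray B) 0) ρ pB n (C * (n : ℝ) ^ d) sB ∧
          Halts (wordBound C c n m) (inputs sA.mem sB.mem) ρ q n (C * (n : ℝ) ^ (2 - ε)) s ∧
          s.reg 0 = e ρ) ∧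
        k.Reliable n {ρ | IsApprox α A B (e ρ)}

/-- There is an algorithm without preprocessing that runs in truly subquadratic time and
approximates the edit distance of strings over `Alph` of length at most `n` within the factor
`β n`. -/
def HasSubquadraticApprox (k : AlgKind) (Alph : Set ℕ) (β : ℕ → ℝ) : Prop :=
  ∃ (p : Prog) (C c : ℕ) (ε : ℝ), 0 < ε ∧ k.Allows p ∧
    ∀ n m : ℕ, 1 ≤ n → ∀ A B : List ℕ, IsInput Alph n m A → IsInput Alph n m B →
      ∃ e : (ℕ → Bool) → ℕ,
        (∀ ρ : ℕ → Bool, ∃ s : MState,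
          Halts (wordBound C c n m) (inputs (strArray A) (strArray B)) ρ p n
            (C * (n : ℝ) ^ (2 - ε)) s ∧
          s.reg 0 = e ρ) ∧
        k.Reliable n {ρ | IsApprox (β n) A B (e ρ)}

/-! Let `b` be the integer `r`-th root of `n` for a large constant `r`. The program combines an
exact method for small distances with a method for large ones. With the threshold `k = 2 * n / b`, a
dynamic program in a diagonal band of width `2 * k + 1` takes time O(n²/b); it finds the distance if
that is at most `k` and otherwise notices that it is larger (`BandTable.bandValue_spec`). For
distances above `k`, an additive error of order n/b² is only a relative error of order 1/b, and this
is the origin of `η`.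

For large distances `A` is cut into blocks of length d = b^(v+2), and the windows of `B` start at
multiples of g = b^v and consist of at most lam = b^4 cells of length `g`. Each block and each
window is preprocessed only once, with size parameter L = b^(v+4), and then all pairs are queried.
There are about n²/b^(2v-2) pairs, and a query costs O(L^(2-ε)), which is O(b^(2v-3)) as soon as
(v+4)ε ≥ 11; so the queries take O(n²/b). The preprocessing takes O(n b^4 L^t), which is also
O(n²/b) for large `r` (`Params.Valid.time_le`).

A dynamic program over blocks and grid points combines the answers. An optimal conversion splits at
the block boundaries (`exists_editDist_split`). Rounding the split points of `B` to the grid costs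
at most 2αg per block, in total of order gn/d = n/b². A block whose partner has more than lam cells
is deleted and the partner is inserted; this loses at most (1+α)d plus a rounding term. Since the
partners are disjoint, at most about (n/g)/lam blocks are of this kind, so the loss is again of
order n/b² (`BlockTable.complete`).

Randomized queries may fail with probability 1/L each. Every query is repeated `2 * h + 1` times
with fresh coins and the median is taken; all blocks, windows and queries of one repetition share
their coins, as the hypothesis demands. Since `L` is at least a fixed power of `n` when b ≥ 2, a
constant `h` suffices for a union bound over all pairs (`coinMeasure_majority`).

On the machine, a bound `V` on the words of the given programs also bounds the addresses and coin
positions that they use. Copies of them can therefore run in disjoint memory areas and on disjoint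
blocks of coins (`Exec.reloc`, `runs_callLoop`), and `runs_mainProg` puts everything together. -/

/-! ### Edit paths, their splittings, and alignments -/

theorem Edit.append_left {u v : List ℕ} (h : Edit u v) (w : List ℕ) : Edit (w ++ u) (w ++ v) := by
  cases h with
  | insert x y a => simpa using Edit.insert (w ++ x) y a
  | delete x y a => simpa using Edit.delete (w ++ x) y a
  | subst x y a b => simpa using Edit.subst (w ++ x) y a b

theorem Edit.append_right {u v : List ℕ} (h : Edit u v) (w : List ℕ) : Edit (u ++ w) (v ++ w) := by
  cases h with
  | insert x y a => simpa using Edit.insert x (y ++ w) a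
  | delete x y a => simpa using Edit.delete x (y ++ w) a
  | subst x y a b => simpa using Edit.subst x (y ++ w) a b

theorem EditPath.trans {j k : ℕ} {u v w : List ℕ} (h : EditPath j u v) (h' : EditPath k v w) :
    EditPath (j + k) u w := by
  induction h with
  | nil u => simpa using h'
  | cons e _ ih => rw [Nat.add_right_comm]; exact .cons e (ih h')

theorem EditPath.append_left {k : ℕ} {u v : List ℕ} (h : EditPath k u v) (w : List ℕ) :
    EditPath k (w ++ u) (w ++ v) := by
  induction h with
  | nil u => exact .nil _
  | cons e _ ih => exact .cons (e.append_left w) ih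

theorem EditPath.append_right {k : ℕ} {u v : List ℕ} (h : EditPath k u v) (w : List ℕ) :
    EditPath k (u ++ w) (v ++ w) := by
  induction h with
  | nil u => exact .nil _
  | cons e _ ih => exact .cons (e.append_right w) ih

theorem editPath_editDist (u v : List ℕ) : EditPath (editDist u v) u v :=
  Nat.sInf_mem (s := {k | EditPath k u v}) (exists_editPath u v)

theorem EditPath.editDist_le {k : ℕ} {u v : List ℕ} (h : EditPath k u v) : editDist u v ≤ k :=
  Nat.sInf_le (s := {k | EditPath k u v}) h

theorem editDist_self (u : List ℕ) : editDist u u = 0 :=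
  Nat.le_zero.1 (EditPath.nil u).editDist_le

theorem editDist_triangle (u v w : List ℕ) : editDist u w ≤ editDist u v + editDist v w :=
  ((editPath_editDist u v).trans (editPath_editDist v w)).editDist_le

theorem editDist_append_le (a a' b b' : List ℕ) :
    editDist (a ++ a') (b ++ b') ≤ editDist a b + editDist a' b' :=
  (((editPath_editDist a b).append_right a').trans
    ((editPath_editDist a' b').append_left b)).editDist_le

theorem editDist_nil_right_le (u : List ℕ) : editDist u [] ≤ u.length := by
  refine EditPath.editDist_le ?_
  induction u with
  | nil => exact .nil _
  | cons a u ih => exact .cons (by simpa using Edit.delete [] u a) ih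

theorem editDist_nil_left_le (u : List ℕ) : editDist [] u ≤ u.length := by
  refine EditPath.editDist_le ?_
  induction u with
  | nil => exact .nil _
  | cons a u ih =>
    have h : EditPath 1 u (a :: u) := .cons (by simpa using Edit.insert [] u a) (.nil _)
    exact ih.trans h

theorem editDist_le_length_add (u v : List ℕ) : editDist u v ≤ u.length + v.length := by
  have := editDist_triangle u [] v
  have := editDist_nil_right_le u
  have := editDist_nil_left_le v
  omega

theorem EditPath.length_le {k : ℕ} {u v : List ℕ} (h : EditPath k u v) :
    u.length ≤ v.length + k ∧ v.length ≤ u.length + k := by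
  induction h with
  | nil u => simp
  | cons e _ ih =>
    cases e <;> simp only [List.length_append, List.length_cons] at ih ⊢ <;> omega

theorem length_le_add_editDist (u v : List ℕ) :
    u.length ≤ v.length + editDist u v ∧ v.length ≤ u.length + editDist u v :=
  (editPath_editDist u v).length_le

/-- An edit acts at a single position, so it takes place inside one of the two parts; the other part
is untouched. -/
theorem Edit.split {a a' x : List ℕ} (h : Edit (a ++ a') x) :
    ∃ c c', x = c ++ c' ∧ ((Edit a c ∧ c' = a') ∨ (c = a ∧ Edit a' c')) := by
  generalize hy : a ++ a' = y at h
  cases h with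
  | insert u v s =>
    rcases List.append_eq_append_iff.1 hy with ⟨t, rfl, rfl⟩ | ⟨t, rfl, rfl⟩
    · exact ⟨a, t ++ s :: v, by simp, .inr ⟨rfl, .insert _ _ _⟩⟩
    · exact ⟨u ++ s :: t, a', by simp, .inl ⟨.insert _ _ _, rfl⟩⟩
  | delete u v s =>
    rcases List.append_eq_append_iff.1 hy with ⟨t, rfl, rfl⟩ | ⟨t, rfl, h⟩
    · exact ⟨a, t ++ v, by simp, .inr ⟨rfl, .delete _ _ _⟩⟩
    · cases t with
      -- The deleted symbol is the first one of the right part.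
      | nil =>
        simp only [List.nil_append] at h; subst h
        exact ⟨u, v, rfl, .inr ⟨by simp, by simpa using Edit.delete [] v s⟩⟩
      | cons s' t =>
        simp only [List.cons_append, List.cons.injEq] at h
        obtain ⟨rfl, rfl⟩ := h
        exact ⟨u ++ t, a', by simp, .inl ⟨.delete _ _ _, rfl⟩⟩
  | subst u v s r =>
    rcases List.append_eq_append_iff.1 hy with ⟨t, rfl, rfl⟩ | ⟨t, rfl, h⟩
    · exact ⟨a, t ++ r :: v, by simp, .inr ⟨rfl, .subst _ _ _ _⟩⟩
    · cases t with
      | nil =>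
        simp only [List.nil_append] at h; subst h
        exact ⟨u, r :: v, rfl, .inr ⟨by simp, by simpa using Edit.subst [] v s r⟩⟩
      | cons s' t =>
        simp only [List.cons_append, List.cons.injEq] at h
        obtain ⟨rfl, rfl⟩ := h
        exact ⟨u ++ r :: t, a', by simp, .inl ⟨.subst _ _ _ _, rfl⟩⟩

theorem EditPath.split {k : ℕ} {y x : List ℕ} (h : EditPath k y x) :
    ∀ a a' : List ℕ, y = a ++ a' →
      ∃ c c' j j', x = c ++ c' ∧ EditPath j a c ∧ EditPath j' a' c' ∧ j + j' = k := by
  induction h with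
  | nil u => rintro a a' rfl; exact ⟨a, a', 0, 0, rfl, .nil _, .nil _, rfl⟩
  | cons e _ ih =>
    rintro a a' rfl
    obtain ⟨c, c', rfl, ⟨e', rfl⟩ | ⟨rfl, e'⟩⟩ := e.split
    · obtain ⟨z, z', j, j', rfl, h, h', rfl⟩ := ih _ _ rfl
      exact ⟨z, z', j + 1, j', rfl, .cons e' h, h', by omega⟩
    · obtain ⟨z, z', j, j', rfl, h, h', rfl⟩ := ih _ _ rfl
      exact ⟨z, z', j, j' + 1, rfl, h, .cons e' h', by omega⟩

/-- The converse of `editDist_append_le` for a suitable cut of the target: the cut is carried along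
a shortest path, and each edit is charged to the side on which it occurs. -/
theorem exists_editDist_split (a a' x : List ℕ) :
    ∃ c c', x = c ++ c' ∧ editDist a c + editDist a' c' ≤ editDist (a ++ a') x := by
  obtain ⟨c, c', j, j', rfl, h, h', hk⟩ := (editPath_editDist (a ++ a') x).split a a' rfl
  exact ⟨c, c', rfl, hk ▸ Nat.add_le_add h.editDist_le h'.editDist_le⟩

/-- Alignments of two strings with their costs, built from left to right. -/
inductive EditAlignment : ℕ → List ℕ → List ℕ → Prop
  | nil : EditAlignment 0 [] []
  | ins {k : ℕ} {u v : List ℕ} (b : ℕ) : EditAlignment k u v → EditAlignment (k + 1) u (v ++ [b])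
  | del {k : ℕ} {u v : List ℕ} (a : ℕ) : EditAlignment k u v → EditAlignment (k + 1) (u ++ [a]) v
  | sub {k : ℕ} {u v : List ℕ} (a b : ℕ) : EditAlignment k u v →
      EditAlignment (k + if a = b then 0 else 1) (u ++ [a]) (v ++ [b])

theorem EditAlignment.refl (u : List ℕ) : EditAlignment 0 u u := by
  induction u using List.reverseRecOn with
  | nil => exact .nil
  | append_singleton u a ih => simpa using ih.sub a a

/-- Composition of one edit with an alignment. If the edit does not touch the last symbol of `w`,
the last column of the alignment is peeled off and the induction applies; otherwise only the last
column changes, at a cost of at most one. -/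
theorem EditAlignment.edit {k : ℕ} {u v : List ℕ} (h : EditAlignment k u v) :
    ∀ w : List ℕ, Edit w u → ∃ j, j ≤ k + 1 ∧ EditAlignment j w v := by
  induction h with
  | nil =>
    intro w hw
    generalize hy : ([] : List ℕ) = y at hw
    cases hw with
    | insert x z a => simp at hy
    | delete x z a =>
      obtain ⟨rfl, rfl⟩ := List.append_eq_nil_iff.1 hy.symm
      exact ⟨1, le_rfl, EditAlignment.nil.del a⟩
    | subst x z a b => simp at hy
  | ins b _ ih =>
    intro w hw
    obtain ⟨j, hj, h⟩ := ih w hw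
    exact ⟨j + 1, by omega, h.ins b⟩
  | @del k u v a h ih =>
    intro w hw
    generalize hy : u ++ [a] = y at hw
    cases hw with
    | insert x z c =>
      rcases List.eq_nil_or_concat z with rfl | ⟨z, d, rfl⟩
      · obtain ⟨rfl, rfl⟩ := by simpa using hy
        exact ⟨k, by omega, by simpa using h⟩
      · rw [List.concat_eq_append, ← List.cons_append, ← List.append_assoc] at hy
        obtain ⟨rfl, h2⟩ := List.append_inj' hy rfl
        obtain ⟨j, hj, h'⟩ := ih _ (.insert x z c)
        obtain rfl : a = d := by simpa using h2
        exact ⟨j + 1, by omega, by simpa using h'.del a⟩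
    | delete x z c =>
      rcases List.eq_nil_or_concat z with rfl | ⟨z, d, rfl⟩
      · simp only [List.append_nil] at hy; subst hy
        exact ⟨k + 1 + 1, by omega, by simpa using (h.del a).del c⟩
      · rw [List.concat_eq_append, ← List.append_assoc] at hy
        obtain ⟨rfl, h2⟩ := List.append_inj' hy rfl
        obtain rfl : a = d := by simpa using h2
        obtain ⟨j, hj, h'⟩ := ih _ (.delete x z c)
        exact ⟨j + 1, by omega, by simpa using h'.del a⟩
    | subst x z c e =>
      rcases List.eq_nil_or_concat z with rfl | ⟨z, d, rfl⟩
      · obtain ⟨rfl, h2⟩ := List.append_inj' hy rfl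
        exact ⟨k + 1, by omega, by simpa using h.del c⟩
      · rw [List.concat_eq_append, ← List.cons_append, ← List.append_assoc] at hy
        obtain ⟨rfl, h2⟩ := List.append_inj' hy rfl
        obtain rfl : a = d := by simpa using h2
        obtain ⟨j, hj, h'⟩ := ih _ (.subst x z c e)
        exact ⟨j + 1, by omega, by simpa using h'.del a⟩
  | @sub k u v a b h ih =>
    intro w hw
    generalize hy : u ++ [a] = y at hw
    cases hw with
    | insert x z c =>
      rcases List.eq_nil_or_concat z with rfl | ⟨z, d, rfl⟩
      · obtain ⟨rfl, rfl⟩ := by simpa using hy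
        exact ⟨k + 1, by omega, by simpa using h.ins b⟩
      · rw [List.concat_eq_append, ← List.cons_append, ← List.append_assoc] at hy
        obtain ⟨rfl, h2⟩ := List.append_inj' hy rfl
        obtain ⟨j, hj, h'⟩ := ih _ (.insert x z c)
        obtain rfl : a = d := by simpa using h2
        exact ⟨j + if a = b then 0 else 1, by omega, by simpa using h'.sub a b⟩
    | delete x z c =>
      rcases List.eq_nil_or_concat z with rfl | ⟨z, d, rfl⟩
      · simp only [List.append_nil] at hy; subst hy
        exact ⟨_, le_rfl, by simpa using (h.sub a b).del c⟩
      · rw [List.concat_eq_append, ← List.append_assoc] at hy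
        obtain ⟨rfl, h2⟩ := List.append_inj' hy rfl
        obtain rfl : a = d := by simpa using h2
        obtain ⟨j, hj, h'⟩ := ih _ (.delete x z c)
        exact ⟨j + if a = b then 0 else 1, by omega, by simpa using h'.sub a b⟩
    | subst x z c e =>
      rcases List.eq_nil_or_concat z with rfl | ⟨z, d, rfl⟩
      · obtain ⟨rfl, h2⟩ := List.append_inj' hy rfl
        exact ⟨k + if c = b then 0 else 1, by split <;> split <;> omega, by simpa using h.sub c b⟩
      · rw [List.concat_eq_append, ← List.cons_append, ← List.append_assoc] at hy
        obtain ⟨rfl, h2⟩ := List.append_inj' hy rfl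
        obtain rfl : a = d := by simpa using h2
        obtain ⟨j, hj, h'⟩ := ih _ (.subst x z c e)
        exact ⟨j + if a = b then 0 else 1, by omega, by simpa using h'.sub a b⟩

/-- A path may edit anywhere in any order, while a dynamic program needs conversions that proceed
from left to right. Starting from the trivial alignment of the target with itself, the edits are
absorbed from the last to the first. -/
theorem EditPath.exists_alignment {k : ℕ} {u v : List ℕ} (h : EditPath k u v) :
    ∃ j, j ≤ k ∧ EditAlignment j u v := by
  induction h with
  | nil u => exact ⟨0, le_rfl, .refl u⟩
  | cons e _ ih =>
    obtain ⟨j, hj, h⟩ := ih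
    obtain ⟨i, hi, h⟩ := h.edit _ e
    exact ⟨i, by omega, h⟩

theorem editDist_singleton_le (a b : ℕ) : editDist [a] [b] ≤ if a = b then 0 else 1 := by
  split
  · subst b; exact (editDist_self _).le
  · exact EditPath.editDist_le (.cons (by simpa using Edit.subst [] [] a b) (.nil _))

theorem EditAlignment.editDist_le {k : ℕ} {u v : List ℕ} (h : EditAlignment k u v) : editDist u v ≤ k := by
  induction h with
  | nil => exact (editDist_self _).le
  | @ins k u v b _ ih =>
    have := editDist_append_le u [] v [b]
    have := editDist_nil_left_le [b]
    simp_all; omega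
  | @del k u v a _ ih =>
    have := editDist_append_le u [a] v []
    have := editDist_nil_right_le [a]
    simp_all; omega
  | @sub k u v a b _ ih =>
    exact (editDist_append_le u [a] v [b]).trans (Nat.add_le_add ih (editDist_singleton_le a b))


/-! ### Properties of executions -/

/-- Determinism makes the result a function of the input and the coins, so that the results of the
given programs can be named independently of a particular run. -/
theorem Exec.det {W inp ρ p s s₁ t₁} (h₁ : Exec W inp ρ p s s₁ t₁) :
    ∀ {s₂ t₂}, Exec W inp ρ p s s₂ t₂ → s₁ = s₂ ∧ t₁ = t₂ := by
  induction h₁ with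
  | skip | const | op | load | store | input | coin =>
    intro s₂ t₂ h₂; cases h₂; exact ⟨rfl, rfl⟩
  | seq _ _ ih ih' =>
    intro s₂ t₂ h₂
    cases h₂ with
    | seq a b => obtain ⟨rfl, rfl⟩ := ih a; obtain ⟨rfl, rfl⟩ := ih' b; exact ⟨rfl, rfl⟩
  | cond_true hx _ ih =>
    intro s₂ t₂ h₂
    cases h₂ with
    | cond_true _ a => obtain ⟨rfl, rfl⟩ := ih a; exact ⟨rfl, rfl⟩
    | cond_false hx' _ => exact absurd hx' hx
  | cond_false hx _ ih =>
    intro s₂ t₂ h₂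
    cases h₂ with
    | cond_true hx' _ => exact absurd hx hx'
    | cond_false _ a => obtain ⟨rfl, rfl⟩ := ih a; exact ⟨rfl, rfl⟩
  | loop_true hx _ _ ih ih' =>
    intro s₂ t₂ h₂
    cases h₂ with
    | loop_true _ a b => obtain ⟨rfl, rfl⟩ := ih a; obtain ⟨rfl, rfl⟩ := ih' b; exact ⟨rfl, rfl⟩
    | loop_false hx' => exact absurd hx' hx
  | loop_false hx =>
    intro s₂ t₂ h₂
    cases h₂ with
    | loop_true hx' _ _ => exact absurd hx hx'
    | loop_false _ => exact ⟨rfl, rfl⟩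

/-- All registers and memory cells are at most `V`, and cells beyond `V` are untouched. -/
structure MState.Within (V : ℕ) (s : MState) : Prop where
  reg : ∀ x, s.reg x ≤ V
  mem : ∀ a, s.mem a ≤ V
  far : ∀ a, V < a → s.mem a = 0

theorem MState.Within.setReg {V : ℕ} {s : MState} (h : s.Within V) {v : ℕ} (hv : v ≤ V) (x : ℕ) :
    (s.setReg x v).Within V := by
  refine ⟨fun y => ?_, h.mem, h.far⟩
  by_cases hy : y = x
  · subst hy; simpa [MState.setReg] using hv
  · simpa [MState.setReg, hy] using h.reg y

theorem MState.Within.setMem {V : ℕ} {s : MState} (h : s.Within V) {v a : ℕ} (hv : v ≤ V)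
    (ha : a ≤ V) : (s.setMem a v).Within V := by
  refine ⟨h.reg, fun y => ?_, fun y hy => ?_⟩
  · by_cases hy : y = a
    · subst hy; simpa [MState.setMem] using hv
    · simpa [MState.setMem, hy] using h.mem y
  · have : y ≠ a := by omega
    simpa [MState.setMem, this] using h.far y hy

theorem MState.Within.init {V n : ℕ} (h : n ≤ V) : (MState.init n).Within V := by
  refine ⟨fun x => ?_, fun _ => Nat.zero_le _, fun _ _ => rfl⟩
  by_cases hx : x = 0
  · subst hx; simpa [MState.init] using h
  · simp [MState.init, hx]

/-- Written values are at most `W` by the word bound, and addresses of writes are register contents,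
hence bounded as well. So a program with small words also uses little memory. -/
theorem Exec.within {W V inp ρ p s s' t} (h : Exec W inp ρ p s s' t) (hWV : W ≤ V) :
    s.Within V → s'.Within V := by
  induction h with
  | skip => exact id
  | const s x c hc => exact fun h => h.setReg (hc.trans hWV) x
  | op s o x y z hc => exact fun h => h.setReg (hc.trans hWV) x
  | load s x y hc => exact fun h => h.setReg (hc.trans hWV) x
  | store s x y hc => exact fun h => h.setMem (hc.trans hWV) (h.reg x)
  | input s i x y hc => exact fun h => h.setReg (hc.trans hWV) x
  | coin s x y hc => exact fun h => h.setReg (hc.trans hWV) x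
  | seq _ _ ih ih' => exact fun h => ih' (ih h)
  | cond_true _ _ ih => exact ih
  | cond_false _ _ ih => exact ih
  | loop_true _ _ _ ih ih' => exact fun h => ih' (ih h)
  | loop_false => exact id

/-- The position of a coin flip is the content of a register, so coins beyond `V` are never seen.
This locality makes separate blocks of coins independent repetitions. -/
theorem Exec.congr_coins {W V inp ρ ρ' p s s' t} (h : Exec W inp ρ p s s' t) (hWV : W ≤ V)
    (hρ : ∀ y ≤ V, ρ y = ρ' y) : s.Within V → Exec W inp ρ' p s s' t := by
  induction h with
  | skip => exact fun _ => .skip _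
  | const s x c hc => exact fun _ => .const _ _ _ hc
  | op s o x y z hc => exact fun _ => .op _ _ _ _ _ hc
  | load s x y hc => exact fun _ => .load _ _ _ hc
  | store s x y hc => exact fun _ => .store _ _ _ hc
  | input s i x y hc => exact fun _ => .input _ _ _ _ hc
  | coin s x y hc =>
    intro h
    rw [hρ _ (h.reg y)] at hc ⊢
    exact .coin _ _ _ hc
  | seq h₁ _ ih ih' => exact fun h => .seq (ih h) (ih' (h₁.within hWV h))
  | cond_true hx _ ih => exact fun h => .cond_true hx (ih h)
  | cond_false hx _ ih => exact fun h => .cond_false hx (ih h)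
  | loop_true hx h₁ _ ih ih' => exact fun h => .loop_true hx (ih h) (ih' (h₁.within hWV h))
  | loop_false hx => exact fun _ => .loop_false hx

theorem Exec.pos {W inp ρ p s s' t} (h : Exec W inp ρ p s s' t) : 0 < t := by
  induction h <;> omega

/-! ### Expressions -/

/-- Arithmetic expressions over the registers below `100`, the memory and the input arrays. -/
inductive RExpr
  | const (c : ℕ)
  | var (x : ℕ)
  | add (a b : RExpr)
  | sub (a b : RExpr)
  | mul (a b : RExpr)
  | div (a b : RExpr)
  | rd (a : RExpr)
  | inp (i : ℕ) (a : RExpr)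

namespace RExpr

instance : Add RExpr := ⟨add⟩
instance : Sub RExpr := ⟨sub⟩
instance : Mul RExpr := ⟨mul⟩
instance : Div RExpr := ⟨div⟩
instance (n : ℕ) : OfNat RExpr n := ⟨const n⟩

def eval (I : ℕ → ℕ → ℕ) (s : MState) : RExpr → ℕ
  | const c => c
  | var x => if x < 100 then s.reg x else 0
  | add a b => a.eval I s + b.eval I s
  | sub a b => a.eval I s - b.eval I s
  | mul a b => a.eval I s * b.eval I s
  | div a b => a.eval I s / b.eval I s
  | rd a => s.mem (a.eval I s)
  | inp i a => I i (a.eval I s)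

/-- The values of the subexpressions are at most `Q ^ deg` if the state and the input are at most
`Q`. -/
def deg : RExpr → ℕ
  | const c => c
  | var _ => 1
  | add a b => a.deg + b.deg + 1
  | sub a b => a.deg + b.deg + 1
  | mul a b => a.deg + b.deg + 1
  | div a b => a.deg + b.deg + 1
  | rd a => a.deg + 1
  | inp _ a => a.deg + 1

def cost : RExpr → ℕ
  | const _ => 1
  | var _ => 1
  | add a b => a.cost + b.cost + 1
  | sub a b => a.cost + b.cost + 1
  | mul a b => a.cost + b.cost + 1
  | div a b => a.cost + b.cost + 1
  | rd a => a.cost + 1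
  | inp _ a => a.cost + 1

/-- The number of the `t`-th temporary register. -/
def temp (t : ℕ) : ℕ := 100 + 2 * t

/-- The program that puts the value of the expression into the `t`-th temporary register. -/
def comp : RExpr → ℕ → Prog
  | const c, t => .const (temp t) c
  | var x, t => if x < 100 then .op .lor (temp t) x x else .const (temp t) 0
  | add a b, t => .seq (a.comp t) (.seq (b.comp (t + 1)) (.op .add (temp t) (temp t) (temp (t + 1))))
  | sub a b, t => .seq (a.comp t) (.seq (b.comp (t + 1)) (.op .sub (temp t) (temp t) (temp (t + 1))))
  | mul a b, t => .seq (a.comp t) (.seq (b.comp (t + 1)) (.op .mul (temp t) (temp t) (temp (t + 1))))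
  | div a b, t => .seq (a.comp t) (.seq (b.comp (t + 1)) (.op .div (temp t) (temp t) (temp (t + 1))))
  | rd a, t => .seq (a.comp t) (.load (temp t) (temp t))
  | inp i a, t => .seq (a.comp t) (.input i (temp t) (temp t))

variable (I : ℕ → ℕ → ℕ) (s : MState) (a b : RExpr)

@[simp] theorem eval_const (c : ℕ) : (const c).eval I s = c := rfl
@[simp] theorem eval_ofNat (n : ℕ) : (no_index (OfNat.ofNat n : RExpr)).eval I s = OfNat.ofNat n := rfl
@[simp] theorem eval_var (x : ℕ) : (var x).eval I s = if x < 100 then s.reg x else 0 := rfl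
@[simp] theorem eval_add : (a + b).eval I s = a.eval I s + b.eval I s := rfl
@[simp] theorem eval_sub : (a - b).eval I s = a.eval I s - b.eval I s := rfl
@[simp] theorem eval_mul : (a * b).eval I s = a.eval I s * b.eval I s := rfl
@[simp] theorem eval_div : (a / b).eval I s = a.eval I s / b.eval I s := rfl
@[simp] theorem eval_rd : (rd a).eval I s = s.mem (a.eval I s) := rfl
@[simp] theorem eval_inp (i : ℕ) : (inp i a).eval I s = I i (a.eval I s) := rfl

/-- Minimum. -/
def emin (a b : RExpr) : RExpr := a - (a - b)

/-- Remainder. -/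
def emod (a b : RExpr) : RExpr := a - a / b * b

/-- Power. -/
def epow (a : RExpr) : ℕ → RExpr
  | 0 => 1
  | k + 1 => epow a k * a

@[simp] theorem eval_emin : (emin a b).eval I s = min (a.eval I s) (b.eval I s) := by
  simp only [emin, eval_sub]; omega

@[simp] theorem eval_emod : (emod a b).eval I s = a.eval I s % b.eval I s := by
  simp only [emod, eval_sub, eval_mul, eval_div]
  have := Nat.div_add_mod' (a.eval I s) (b.eval I s)
  omega

@[simp] theorem eval_epow (k : ℕ) : (epow a k).eval I s = a.eval I s ^ k := by
  induction k with
  | zero => simp [epow]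
  | succ k ih => simp [epow, ih, pow_succ]

variable {a b} {s} {I}

theorem eval_congr {s' : MState} (hm : s'.mem = s.mem) (hr : ∀ x < 100, s'.reg x = s.reg x)
    (e : RExpr) : e.eval I s' = e.eval I s := by
  induction e with
  | const c => rfl
  | var x => simp only [eval]; split <;> simp_all
  | add a b iha ihb | sub a b iha ihb | mul a b iha ihb | div a b iha ihb =>
    simp only [eval, iha, ihb]
  | rd a ih => simp only [eval, ih, hm]
  | inp i a ih => simp only [eval, ih]

end RExpr

/-- The words that the expressions read are at most `Q`. -/
structure MState.Bdd (Q : ℕ) (s : MState) : Prop where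
  reg : ∀ x < 100, s.reg x ≤ Q
  mem : ∀ a, s.mem a ≤ Q

theorem MState.Bdd.setReg {Q : ℕ} {s : MState} (h : s.Bdd Q) {v : ℕ} (hv : v ≤ Q) (x : ℕ) :
    (s.setReg x v).Bdd Q := by
  refine ⟨fun y hy => ?_, h.mem⟩
  by_cases hyx : y = x
  · subst hyx; simpa [MState.setReg] using hv
  · simpa [MState.setReg, hyx] using h.reg y hy

theorem MState.Bdd.withMem {Q : ℕ} {s : MState} (h : s.Bdd Q) {m : ℕ → ℕ} (hm : ∀ a, m a ≤ Q) :
    MState.Bdd Q { s with mem := m } := ⟨h.reg, hm⟩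

/-- Words up to `W` suffice for the expressions of degree at most `D` over values up to `Q`. -/
structure WordOK (W Q D : ℕ) (I : ℕ → ℕ → ℕ) : Prop where
  two_le : 2 ≤ Q
  pow_le : Q ^ D ≤ W
  inp_le : ∀ i y, I i y ≤ Q

/-- Both terms are at most `Q ^ (a + b)`, and the additional factor `Q ≥ 2` pays for having two of
them. -/
theorem add_pow_le_pow {Q x y a b : ℕ} (hQ : 2 ≤ Q) (hx : x ≤ Q ^ a) (hy : y ≤ Q ^ b) :
    x + y ≤ Q ^ (a + b + 1) := by
  have h1 : Q ^ a ≤ Q ^ (a + b) := Nat.pow_le_pow_right (by omega) (by omega)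
  have h2 : Q ^ b ≤ Q ^ (a + b) := Nat.pow_le_pow_right (by omega) (by omega)
  rw [pow_succ]
  nlinarith

section
variable {W Q D : ℕ} {I : ℕ → ℕ → ℕ} {ρ : ℕ → Bool}

theorem WordOK.le (h : WordOK W Q D I) {v k : ℕ} (hv : v ≤ Q ^ k) (hk : k ≤ D) : v ≤ W :=
  hv.trans ((Nat.pow_le_pow_right (by have := h.two_le; omega) hk).trans h.pow_le)

theorem RExpr.eval_le (h : WordOK W Q D I) {s : MState} (hs : s.Bdd Q) (e : RExpr) :
    e.eval I s ≤ Q ^ e.deg := by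
  have hQ := h.two_le
  have mono : ∀ {v i j : ℕ}, v ≤ Q ^ i → i ≤ j → v ≤ Q ^ j := fun hv hij =>
    hv.trans (Nat.pow_le_pow_right (by omega) hij)
  induction e with
  | const c =>
    -- A constant `c` has degree `c` because c ≤ 2^c ≤ Q^c.
    exact (Nat.lt_two_pow_self (n := c)).le.trans (Nat.pow_le_pow_left hQ c)
  | var x =>
    simp only [eval, deg, pow_one]
    split
    · exact hs.reg x ‹_›
    · exact Nat.zero_le _
  | add a b iha ihb => exact add_pow_le_pow hQ iha ihb
  | sub a b iha ihb => exact (Nat.sub_le _ _).trans (mono iha (by simp only [deg]; omega))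
  | mul a b iha ihb =>
    refine mono (i := a.deg + b.deg) ?_ (by simp only [deg]; omega)
    rw [pow_add]; exact Nat.mul_le_mul iha ihb
  | div a b iha ihb => exact (Nat.div_le_self _ _).trans (mono iha (by simp only [deg]; omega))
  | rd a ih => exact mono (i := 1) (by simpa using hs.mem _) (by simp [deg])
  | inp i a ih => exact mono (i := 1) (by simpa using h.inp_le _ _) (by simp [deg])

/-- The value of the expression is put into a temporary register; only that one, the later
temporary registers change. -/
theorem RExpr.comp_exec (h : WordOK W Q D I) (e : RExpr) :
    ∀ (t : ℕ) (s : MState), s.Bdd Q → e.deg ≤ D →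
      ∃ s', Exec W I ρ (e.comp t) s s' e.cost ∧ s'.mem = s.mem ∧ s'.reg (temp t) = e.eval I s ∧
        ∀ x, (x < temp t ∨ x % 2 = 1) → s'.reg x = s.reg x := by
  -- Temporary registers have even numbers from 100 on. Odd numbers are reserved for the registers
  -- of relocated programs, so that evaluating expressions never disturbs a simulation.
  have key : ∀ (s : MState) (t v x : ℕ), (x < temp t ∨ x % 2 = 1) →
      (s.setReg (temp t) v).reg x = s.reg x := by
    intro s t v x hx
    have : x ≠ temp t := by simp only [temp] at *; omega
    simp [MState.setReg, this]
  -- The second operand is evaluated with the next temporary register, which preserves the value of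
  -- the first operand.
  have binop : ∀ (o : BinOp) (a b : RExpr) (v : ℕ → ℕ → ℕ), (∀ x y, o.eval x y = v x y) →
      (∀ (t : ℕ) (s : MState), s.Bdd Q → a.deg ≤ D →
        ∃ s', Exec W I ρ (a.comp t) s s' a.cost ∧ s'.mem = s.mem ∧ s'.reg (temp t) = a.eval I s ∧
          ∀ x, (x < temp t ∨ x % 2 = 1) → s'.reg x = s.reg x) →
      (∀ (t : ℕ) (s : MState), s.Bdd Q → b.deg ≤ D →
        ∃ s', Exec W I ρ (b.comp t) s s' b.cost ∧ s'.mem = s.mem ∧ s'.reg (temp t) = b.eval I s ∧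
          ∀ x, (x < temp t ∨ x % 2 = 1) → s'.reg x = s.reg x) →
      ∀ (t : ℕ) (s : MState), s.Bdd Q → a.deg + b.deg + 1 ≤ D →
        v (a.eval I s) (b.eval I s) ≤ W →
        ∃ s', Exec W I ρ (.seq (a.comp t) (.seq (b.comp (t + 1))
            (.op o (temp t) (temp t) (temp (t + 1))))) s s' (a.cost + b.cost + 1) ∧
          s'.mem = s.mem ∧ s'.reg (temp t) = v (a.eval I s) (b.eval I s) ∧
          ∀ x, (x < temp t ∨ x % 2 = 1) → s'.reg x = s.reg x := by
    intro o a b v hv iha ihb t s hs hd hW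
    obtain ⟨s₁, e₁, m₁, v₁, f₁⟩ := iha t s hs (by omega)
    have hr : ∀ x < 100, s₁.reg x = s.reg x := fun x hx => f₁ x (.inl (by simp only [temp]; omega))
    obtain ⟨s₂, e₂, m₂, v₂, f₂⟩ := ihb (t + 1) s₁
      ⟨fun x hx => by rw [hr x hx]; exact hs.reg x hx, fun x => by rw [m₁]; exact hs.mem x⟩
      (by omega)
    have hval : o.eval (s₂.reg (temp t)) (s₂.reg (temp (t + 1))) = v (a.eval I s) (b.eval I s) := by
      rw [hv, f₂ _ (.inl (by simp only [temp]; omega)), v₁, v₂, RExpr.eval_congr m₁ hr]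
    refine ⟨s₂.setReg (temp t) (v (a.eval I s) (b.eval I s)), ?_, m₂.trans m₁,
      by simp [MState.setReg], fun x hx => ?_⟩
    · rw [add_assoc]
      refine .seq e₁ (.seq e₂ ?_)
      have := Exec.op (inp := I) (ρ := ρ) (W := W) s₂ o (temp t) (temp t) (temp (t + 1))
        (by rw [hval]; exact hW)
      rwa [hval] at this
    · rw [key _ _ _ _ hx, f₂ _ (by simp only [temp] at *; omega), f₁ _ hx]
  induction e with
  | const c =>
    intro t s hs hd
    exact ⟨_, .const _ _ _ (h.le (RExpr.eval_le h hs (.const c)) hd), rfl,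
      by simp [MState.setReg], fun x hx => key _ _ _ _ hx⟩
  | var x =>
    intro t s hs hd
    have hv := h.le (RExpr.eval_le h hs (.var x)) hd
    simp only [RExpr.eval] at hv
    by_cases hx : x < 100
    · simp only [comp, hx, if_true, cost, eval] at hv ⊢
      have := Exec.op (inp := I) (ρ := ρ) (W := W) s .lor (temp t) x x (by simpa [BinOp.eval])
      exact ⟨_, this, rfl, by simp [MState.setReg, BinOp.eval], fun _ => key _ _ _ _⟩
    · simp only [comp, hx, if_false, cost, eval] at hv ⊢
      exact ⟨_, .const _ _ _ hv, rfl, by simp [MState.setReg], fun _ => key _ _ _ _⟩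
  | add a b iha ihb =>
    intro t s hs hd
    exact binop .add a b (· + ·) (fun _ _ => rfl) iha ihb t s hs hd
      (h.le (RExpr.eval_le h hs (.add a b)) hd)
  | sub a b iha ihb =>
    intro t s hs hd
    exact binop .sub a b (· - ·) (fun _ _ => rfl) iha ihb t s hs hd
      (h.le (RExpr.eval_le h hs (.sub a b)) hd)
  | mul a b iha ihb =>
    intro t s hs hd
    exact binop .mul a b (· * ·) (fun _ _ => rfl) iha ihb t s hs hd
      (h.le (RExpr.eval_le h hs (.mul a b)) hd)
  | div a b iha ihb =>
    intro t s hs hd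
    exact binop .div a b (· / ·) (fun _ _ => rfl) iha ihb t s hs hd
      (h.le (RExpr.eval_le h hs (.div a b)) hd)
  | rd a ih =>
    intro t s hs hd
    obtain ⟨s₁, e₁, m₁, v₁, f₁⟩ := ih t s hs (by simp only [deg] at hd; omega)
    have hv : s₁.mem (s₁.reg (temp t)) = (rd a).eval I s := by rw [m₁, v₁]; rfl
    have := Exec.load (inp := I) (ρ := ρ) (W := W) s₁ (temp t) (temp t)
      (by rw [hv]; exact h.le (RExpr.eval_le h hs (.rd a)) hd)
    rw [hv] at this
    exact ⟨_, .seq e₁ this, m₁, by simp [MState.setReg],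
      fun x hx => (key _ _ _ _ hx).trans (f₁ x hx)⟩
  | inp i a ih =>
    intro t s hs hd
    obtain ⟨s₁, e₁, m₁, v₁, f₁⟩ := ih t s hs (by simp only [deg] at hd; omega)
    have hv : I i (s₁.reg (temp t)) = (inp i a).eval I s := by rw [v₁]; rfl
    have := Exec.input (inp := I) (ρ := ρ) (W := W) s₁ i (temp t) (temp t)
      (by rw [hv]; exact h.le (RExpr.eval_le h hs (.inp i a)) hd)
    rw [hv] at this
    exact ⟨_, .seq e₁ this, m₁, by simp [MState.setReg],
      fun x hx => (key _ _ _ _ hx).trans (f₁ x hx)⟩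

/-! ### Assignments, writes and loops -/

/-- `x := e` -/
def assign (x : ℕ) (e : RExpr) : Prog := .seq (e.comp 0) (.op .lor x (RExpr.temp 0) (RExpr.temp 0))

/-- `mem[a] := e` -/
def write (a e : RExpr) : Prog :=
  .seq (a.comp 0) (.seq (e.comp 1) (.store (RExpr.temp 0) (RExpr.temp 1)))

theorem assign_exec (h : WordOK W Q D I) {e : RExpr} {s : MState} (hs : s.Bdd Q) (hd : e.deg ≤ D)
    (x : ℕ) :
    ∃ s', Exec W I ρ (assign x e) s s' (e.cost + 1) ∧ s'.mem = s.mem ∧ s'.reg x = e.eval I s ∧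
      ∀ y, (y < 100 ∨ y % 2 = 1) → y ≠ x → s'.reg y = s.reg y := by
  obtain ⟨s₁, e₁, m₁, v₁, f₁⟩ := e.comp_exec (ρ := ρ) h 0 s hs hd
  have hval : BinOp.lor.eval (s₁.reg (RExpr.temp 0)) (s₁.reg (RExpr.temp 0)) = e.eval I s := by
    simp [BinOp.eval, v₁]
  have := Exec.op (inp := I) (ρ := ρ) (W := W) s₁ .lor x (RExpr.temp 0) (RExpr.temp 0)
    (by rw [hval]; exact h.le (RExpr.eval_le h hs e) hd)
  rw [hval] at this
  exact ⟨_, .seq e₁ this, m₁, by simp [MState.setReg],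
    fun y hy hyx => by simpa [MState.setReg, hyx] using f₁ y (by simpa [RExpr.temp] using hy)⟩

theorem write_exec (h : WordOK W Q D I) {a e : RExpr} {s : MState} (hs : s.Bdd Q)
    (ha : a.deg ≤ D) (hd : e.deg ≤ D) :
    ∃ s', Exec W I ρ (write a e) s s' (a.cost + e.cost + 1) ∧
      s'.mem = (s.setMem (a.eval I s) (e.eval I s)).mem ∧
      ∀ y, (y < 100 ∨ y % 2 = 1) → s'.reg y = s.reg y := by
  obtain ⟨s₁, e₁, m₁, v₁, f₁⟩ := a.comp_exec (ρ := ρ) h 0 s hs ha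
  have hr : ∀ x < 100, s₁.reg x = s.reg x := fun x hx => f₁ x (.inl (by simp only [RExpr.temp]; omega))
  obtain ⟨s₂, e₂, m₂, v₂, f₂⟩ := e.comp_exec (ρ := ρ) h 1 s₁
      ⟨fun x hx => by rw [hr x hx]; exact hs.reg x hx, fun x => by rw [m₁]; exact hs.mem x⟩ hd
  have hv : s₂.reg (RExpr.temp 1) = e.eval I s := by rw [v₂, RExpr.eval_congr m₁ hr]
  have ha' : s₂.reg (RExpr.temp 0) = a.eval I s := by
    rw [f₂ _ (.inl (by simp [RExpr.temp])), v₁]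
  have := Exec.store (inp := I) (ρ := ρ) (W := W) s₂ (RExpr.temp 0) (RExpr.temp 1)
    (by rw [hv]; exact h.le (RExpr.eval_le h hs e) hd)
  rw [hv, ha'] at this
  refine ⟨_, by rw [add_assoc]; exact .seq e₁ (.seq e₂ this), ?_, fun y hy => ?_⟩
  · simp [MState.setMem, m₂, m₁]
  · change s₂.reg y = s.reg y
    rw [f₂ _ (by simp only [RExpr.temp] at *; omega), f₁ _ (by simpa [RExpr.temp] using hy)]

/-- Equality of states up to the registers from `100` on. -/
structure MState.VEq (S s : MState) : Prop where
  mem : S.mem = s.mem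
  reg : ∀ x < 100, S.reg x = s.reg x

theorem MState.VEq.bdd {S s : MState} (h : S.VEq s) (hs : s.Bdd Q) : S.Bdd Q :=
  ⟨fun x hx => by rw [h.reg x hx]; exact hs.reg x hx, fun a => by rw [h.mem]; exact hs.mem a⟩

/-- Up to the registers from `100` on, the program leads from `s` to `s'` within time `T`. -/
def Runs (W : ℕ) (I : ℕ → ℕ → ℕ) (ρ : ℕ → Bool) (p : Prog) (s s' : MState) (T : ℕ) : Prop :=
  ∀ S : MState, S.VEq s → ∃ S' t, S'.VEq s' ∧ t ≤ T ∧ Exec W I ρ p S S' t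

theorem Runs.mono {p s s' T T'} (h : Runs W I ρ p s s' T) (hT : T ≤ T') : Runs W I ρ p s s' T' :=
  fun S hS => by
    obtain ⟨S', t, h1, h2, h3⟩ := h S hS
    exact ⟨S', t, h1, h2.trans hT, h3⟩

theorem Runs.seq {p q s s' s'' T T'} (h : Runs W I ρ p s s' T) (h' : Runs W I ρ q s' s'' T') :
    Runs W I ρ (.seq p q) s s'' (T + T') := fun S hS => by
  obtain ⟨S', t, h1, h2, h3⟩ := h S hS
  obtain ⟨S'', t', h4, h5, h6⟩ := h' S' h1
  exact ⟨S'', t + t', h4, by omega, .seq h3 h6⟩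

theorem runs_assign (h : WordOK W Q D I) {s : MState} (hs : s.Bdd Q) {x : ℕ} {e : RExpr}
    (hd : e.deg ≤ D) :
    Runs W I ρ (assign x e) s (s.setReg x (e.eval I s)) (e.cost + 1) := fun S hS => by
  obtain ⟨S', h1, h2, h3, h4⟩ := assign_exec (ρ := ρ) h (hS.bdd hs) hd x
  refine ⟨S', _, ⟨h2.trans hS.mem, fun y hy => ?_⟩, le_rfl, h1⟩
  by_cases hyx : y = x
  · subst hyx; rw [h3, RExpr.eval_congr hS.mem hS.reg]; simp [MState.setReg]
  · rw [h4 y (.inl hy) hyx, hS.reg y hy]; simp [MState.setReg, hyx]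

theorem runs_write (h : WordOK W Q D I) {s : MState} (hs : s.Bdd Q) {a e : RExpr}
    (ha : a.deg ≤ D) (hd : e.deg ≤ D) :
    Runs W I ρ (write a e) s (s.setMem (a.eval I s) (e.eval I s)) (a.cost + e.cost + 1) :=
  fun S hS => by
  obtain ⟨S', h1, h2, h3⟩ := write_exec (ρ := ρ) h (hS.bdd hs) ha hd
  refine ⟨S', _, ⟨?_, fun y hy => ?_⟩, le_rfl, h1⟩
  · rw [h2, RExpr.eval_congr hS.mem hS.reg, RExpr.eval_congr hS.mem hS.reg]
    simp [MState.setMem, hS.mem]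
  · rw [h3 y (.inl hy), hS.reg y hy]; rfl

theorem MState.setReg_setReg (s : MState) (x v w : ℕ) : (s.setReg x v).setReg x w = s.setReg x w := by
  simp [MState.setReg]

theorem MState.setReg_comm (s : MState) {x y : ℕ} (h : x ≠ y) (v w : ℕ) :
    (s.setReg x v).setReg y w = (s.setReg y w).setReg x v := by
  simp [MState.setReg, Function.update_comm h]

@[simp] theorem MState.setReg_mem (s : MState) (x v : ℕ) : (s.setReg x v).mem = s.mem := rfl

@[simp] theorem MState.setReg_reg (s : MState) (x v y : ℕ) :
    (s.setReg x v).reg y = if y = x then v else s.reg y := by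
  simp [MState.setReg, Function.update_apply]

/-- The state inside a loop: the loop registers `1` and `2` hold `k` and `c`. -/
def MState.counters (s : MState) (k c : ℕ) : MState := (s.setReg 1 k).setReg 2 c

@[simp] theorem MState.counters_mem (s : MState) (k c : ℕ) : (s.counters k c).mem = s.mem := rfl

@[simp] theorem MState.counters_reg (s : MState) (k c y : ℕ) :
    (s.counters k c).reg y = if y = 2 then c else if y = 1 then k else s.reg y := by
  simp [MState.counters]

theorem MState.Bdd.counters {s : MState} (hs : s.Bdd Q) {k c : ℕ} (hk : k ≤ Q) (hc : c ≤ Q) :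
    (s.counters k c).Bdd Q := (hs.setReg hk 1).setReg hc 2

/-- `for i < lim do body`, with `i` in register `1` and register `2` as an auxiliary register -/
def forLoop (lim : RExpr) (body : Prog) : Prog :=
  .seq (assign 1 0) (.seq (assign 2 (lim - .var 1))
    (.loop 2 (.seq body (.seq (assign 1 (.var 1 + 1)) (assign 2 (lim - .var 1))))))

/-- The family `f` is the loop invariant without the two counters. Register 2 holds the number of
remaining rounds; the limit is evaluated anew in each round, so it must be `K` in all the states
that occur. -/
theorem runs_forLoop (h : WordOK W Q D I) {lim : RExpr} {body : Prog} (f : ℕ → MState) {K T : ℕ}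
    (hK : K ≤ Q) (hf : ∀ k ≤ K, (f k).Bdd Q) (hD : lim.deg + 3 ≤ D)
    (hlim : ∀ k ≤ K, ∀ x y, lim.eval I ((f k).counters x y) = K)
    (hbody : ∀ k < K, Runs W I ρ body ((f k).counters k (K - k)) ((f (k + 1)).counters k (K - k)) T) :
    Runs W I ρ (forLoop lim body) (f 0) ((f K).counters K 0)
      (lim.cost + 6 + K * (T + lim.cost + 8)) := by
  have step : ∀ k ≤ K, ∀ x ≤ K, ∀ y ≤ K,
      Runs W I ρ (assign 2 (lim - .var 1)) ((f k).counters x y) ((f k).counters x (K - x))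
        (lim.cost + 3) := by
    intro k hk x hx y hy
    have := runs_assign (ρ := ρ) h ((hf k hk).counters (hx.trans hK) (hy.trans hK)) (x := 2)
      (e := lim - .var 1) (by change lim.deg + 1 + 1 ≤ D; omega)
    rw [RExpr.eval_sub, hlim k hk] at this
    simp only [RExpr.eval_var, MState.counters_reg] at this
    norm_num at this
    rw [show ((f k).counters x y).setReg 2 (K - x) = (f k).counters x (K - x) from
      MState.setReg_setReg _ _ _ _] at this
    exact this.mono (by change lim.cost + 1 + 1 + 1 ≤ _; omega)
  have incr : ∀ k < K, Runs W I ρ (assign 1 (.var 1 + 1)) ((f (k + 1)).counters k (K - k))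
      ((f (k + 1)).counters (k + 1) (K - k)) 4 := by
    intro k hk
    have := runs_assign (ρ := ρ) h ((hf (k + 1) hk).counters (k := k) (c := K - k) (by omega)
      (by omega)) (x := 1) (e := .var 1 + 1) (by change 1 + 1 + 1 ≤ D; omega)
    simp only [RExpr.eval_add, RExpr.eval_var, MState.counters_reg, RExpr.eval_ofNat] at this
    norm_num at this
    rwa [show ((f (k + 1)).counters k (K - k)).setReg 1 (k + 1)
      = (f (k + 1)).counters (k + 1) (K - k) by
        rw [MState.counters, MState.setReg_comm _ (by norm_num), MState.setReg_setReg]; rfl] at this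
  -- Induction on the number `j` of remaining rounds.
  have main : ∀ j k, k + j = K → Runs W I ρ (.loop 2 (.seq body (.seq (assign 1 (.var 1 + 1))
      (assign 2 (lim - .var 1))))) ((f k).counters k (K - k)) ((f K).counters K 0)
      (1 + j * (T + lim.cost + 8)) := by
    intro j
    induction j with
    | zero =>
      rintro k rfl S hS
      refine ⟨S, 1, by simpa using hS, by omega, .loop_false ?_⟩
      rw [hS.reg 2 (by norm_num)]; simp
    | succ j ih =>
      intro k hk S hS
      have hk' : k < K := by omega
      obtain ⟨S', t, h1, h2, h3⟩ := ((hbody k hk').seq ((incr k hk').seq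
        (step (k + 1) hk' (k + 1) hk' (K - k) (by omega)))) S hS
      obtain ⟨S'', t', h4, h5, h6⟩ := ih (k + 1) (by omega) S' h1
      refine ⟨S'', 1 + t + t', h4, ?_, .loop_true ?_ h3 h6⟩
      · rw [add_mul]; omega
      · rw [hS.reg 2 (by norm_num)]; simp; omega
  have first : Runs W I ρ (assign 1 0) (f 0) ((f 0).setReg 1 0) 2 := by
    have := runs_assign (ρ := ρ) h (hf 0 (Nat.zero_le _)) (x := 1) (e := 0)
      (by change 0 ≤ D; omega)
    exact this
  have second : Runs W I ρ (assign 2 (lim - .var 1)) ((f 0).setReg 1 0)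
      ((f 0).counters 0 (K - 0)) (lim.cost + 3) := by
    have hl : lim.eval I ((f 0).setReg 1 0) = K := by
      rw [← hlim 0 (Nat.zero_le _) 0 (((f 0).setReg 1 0).reg 2)]
      refine RExpr.eval_congr (s' := (f 0).setReg 1 0)
        (s := (f 0).counters 0 (((f 0).setReg 1 0).reg 2)) rfl (fun x hx => ?_) _
      simp only [MState.counters_reg, MState.setReg_reg]
      split_ifs <;> simp_all
    have := runs_assign (ρ := ρ) h ((hf 0 (Nat.zero_le _)).setReg (Nat.zero_le _) 1) (x := 2)
      (e := lim - .var 1) (by change lim.deg + 1 + 1 ≤ D; omega)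
    rw [RExpr.eval_sub, hl] at this
    simp only [RExpr.eval_var, MState.setReg_reg] at this
    norm_num at this
    exact this.mono (by change lim.cost + 1 + 1 + 1 ≤ _; omega)
  exact (first.seq (second.seq (main K 0 (by omega)))).mono (by omega)

/-! ### Filling tables -/

/-- The memory `m` with the values `G 0, …, G (k - 1)` written from address `b` on. -/
def memFill (m : ℕ → ℕ) (b : ℕ) (G : ℕ → ℕ) (k : ℕ) : ℕ → ℕ :=
  fun a => if b ≤ a ∧ a < b + k then G (a - b) else m a

theorem memFill_zero (m : ℕ → ℕ) (b : ℕ) (G : ℕ → ℕ) : memFill m b G 0 = m := by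
  funext a
  rw [memFill, if_neg (by omega)]

theorem memFill_succ (m : ℕ → ℕ) (b : ℕ) (G : ℕ → ℕ) (k : ℕ) :
    memFill m b G (k + 1) = Function.update (memFill m b G k) (b + k) (G k) := by
  funext a
  by_cases h : a = b + k
  · subst h; simp [memFill]
  · simp only [memFill, Function.update_apply, if_neg h]
    congr 1
    apply propext; omega

theorem memFill_lt {m : ℕ → ℕ} {b : ℕ} {G : ℕ → ℕ} {k i : ℕ} (h : i < k) :
    memFill m b G k (b + i) = G i := by
  rw [memFill, if_pos (by omega), Nat.add_sub_cancel_left]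

theorem memFill_of_lt {m : ℕ → ℕ} {b : ℕ} {G : ℕ → ℕ} {k a : ℕ} (h : a < b) :
    memFill m b G k a = m a := by
  rw [memFill, if_neg (by omega)]

theorem memFill_of_ge {m : ℕ → ℕ} {b : ℕ} {G : ℕ → ℕ} {k a : ℕ} (h : b + k ≤ a) :
    memFill m b G k a = m a := by
  rw [memFill, if_neg (by omega)]

theorem memFill_le {m : ℕ → ℕ} {b : ℕ} {G : ℕ → ℕ} {k B : ℕ} (hm : ∀ a, m a ≤ B)
    (hG : ∀ i < k, G i ≤ B) (a : ℕ) : memFill m b G k a ≤ B := by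
  rw [memFill]
  split
  · exact hG _ (by omega)
  · exact hm a

/-- Tables may be defined by course-of-values recursion on the memory that holds them. -/
theorem exists_memFill (m : ℕ → ℕ) (b : ℕ) (Φ : ℕ → (ℕ → ℕ) → ℕ) :
    ∃ G : ℕ → ℕ, ∀ k, Φ k (memFill m b G k) = G k := by
  let M : ℕ → (ℕ → ℕ) := fun k =>
    k.rec m fun k mk => Function.update mk (b + k) (Φ k mk)
  refine ⟨fun k => Φ k (M k), fun k => ?_⟩
  have : memFill m b (fun k => Φ k (M k)) k = M k := by
    induction k with
    | zero => exact memFill_zero _ _ _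
    | succ k ih => rw [memFill_succ, ih]
  rw [this]

/-- The state `s` with memory `m`. -/
def MState.withMem (s : MState) (m : ℕ → ℕ) : MState := { s with mem := m }

@[simp] theorem MState.withMem_mem (s : MState) (m : ℕ → ℕ) : (s.withMem m).mem = m := rfl
@[simp] theorem MState.withMem_reg (s : MState) (m : ℕ → ℕ) : (s.withMem m).reg = s.reg := rfl

/-- `for i < lim do mem[base + i] := e` -/
def fill (lim base e : RExpr) : Prog := forLoop lim (write (base + .var 1) e)

/-- The expression may read cells that the same loop has already written: `hG` evaluates it in a
memory that holds the first `k` values. This is what makes dynamic programs instances of `fill`. -/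
theorem runs_fill (h : WordOK W Q D I) {lim base e : RExpr} {s : MState} {K b : ℕ} (G : ℕ → ℕ)
    (hs : s.Bdd Q) (hK : K ≤ Q) (hD : lim.deg + 3 ≤ D) (hbD : base.deg + 2 ≤ D) (heD : e.deg ≤ D)
    (hlim : ∀ m x y, lim.eval I ((s.withMem m).counters x y) = K)
    (hbase : ∀ m x y, base.eval I ((s.withMem m).counters x y) = b)
    (hG : ∀ k < K, e.eval I ((s.withMem (memFill s.mem b G k)).counters k (K - k)) = G k)
    (hGQ : ∀ k < K, G k ≤ Q) :
    Runs W I ρ (fill lim base e) s ((s.withMem (memFill s.mem b G K)).counters K 0)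
      (lim.cost + 6 + K * (base.cost + e.cost + lim.cost + 11)) := by
  have hb : ∀ k ≤ K, (s.withMem (memFill s.mem b G k)).Bdd Q := fun k hk =>
    hs.withMem (memFill_le hs.mem fun i hi => hGQ i (by omega))
  have := runs_forLoop (ρ := ρ) (lim := lim) (body := write (base + .var 1) e) h
    (fun k => s.withMem (memFill s.mem b G k)) (T := base.cost + e.cost + 3) hK hb hD
    (fun k _ => hlim _) ?_
  · simp only [memFill_zero] at this
    refine Runs.mono this ?_
    rw [show base.cost + e.cost + 3 + lim.cost + 8 = base.cost + e.cost + lim.cost + 11 by omega]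
  · intro k hk
    have := runs_write (ρ := ρ) h ((hb k hk.le).counters (k := k) (c := K - k) (by omega) (by omega))
      (a := base + RExpr.var 1) (e := e) (show base.deg + 1 + 1 ≤ D from hbD) heD
    rw [RExpr.eval_add, hbase, hG k hk] at this
    simp only [RExpr.eval_var, MState.counters_reg] at this
    norm_num at this
    rw [show ((s.withMem (memFill s.mem b G k)).counters k (K - k)).setMem (b + k) (G k)
      = (s.withMem (memFill s.mem b G (k + 1))).counters k (K - k) by
        rw [memFill_succ]; rfl] at this
    exact this.mono (by change base.cost + 1 + 1 + e.cost + 1 ≤ _; omega)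

end


/-! ### Relocated programs -/

/-- The registers that occur are below `B`. -/
def Prog.RegsBelow (B : ℕ) : Prog → Prop
  | .skip => True
  | .const x _ => x < B
  | .op _ x y z => x < B ∧ y < B ∧ z < B
  | .load x y => x < B ∧ y < B
  | .store x y => x < B ∧ y < B
  | .input _ x y => x < B ∧ y < B
  | .coin x y => x < B ∧ y < B
  | .seq p q => p.RegsBelow B ∧ q.RegsBelow B
  | .cond x p q => x < B ∧ p.RegsBelow B ∧ q.RegsBelow B
  | .loop x p => x < B ∧ p.RegsBelow B

theorem Prog.RegsBelow.mono {p : Prog} {B B' : ℕ} (h : p.RegsBelow B) (hB : B ≤ B') :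
    p.RegsBelow B' := by
  induction p with
  | skip => trivial
  | const x c => exact Nat.lt_of_lt_of_le h hB
  | op o x y z => exact ⟨h.1.trans_le hB, h.2.1.trans_le hB, h.2.2.trans_le hB⟩
  | load x y | store x y | input i x y | coin x y => exact ⟨h.1.trans_le hB, h.2.trans_le hB⟩
  | seq p q ihp ihq => exact ⟨ihp h.1, ihq h.2⟩
  | cond x p q ihp ihq => exact ⟨h.1.trans_le hB, ihp h.2.1, ihq h.2.2⟩
  | loop x p ih => exact ⟨h.1.trans_le hB, ih h.2⟩

theorem Prog.exists_regsBelow (p : Prog) : ∃ B, p.RegsBelow B := by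
  induction p with
  | skip => exact ⟨0, trivial⟩
  | const x c => exact ⟨x + 1, Nat.lt_succ_self x⟩
  | op o x y z => exact ⟨x + y + z + 1, by simp only [RegsBelow]; omega⟩
  | load x y | store x y | input i x y | coin x y =>
    exact ⟨x + y + 1, by simp only [RegsBelow]; omega⟩
  | seq p q ihp ihq =>
    obtain ⟨⟨B, hp⟩, ⟨B', hq⟩⟩ := ihp, ihq
    exact ⟨B + B', hp.mono (by omega), hq.mono (by omega)⟩
  | cond x p q ihp ihq =>
    obtain ⟨⟨B, hp⟩, ⟨B', hq⟩⟩ := ihp, ihq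
    exact ⟨B + B' + x + 1, by omega, hp.mono (by omega), hq.mono (by omega)⟩
  | loop x p ih =>
    obtain ⟨B, hp⟩ := ih
    exact ⟨B + x + 1, by omega, hp.mono (by omega)⟩

/-- The register that holds the register `x` of a relocated program. -/
def simReg (x : ℕ) : ℕ := 101 + 2 * x

/-- `x := y` -/
def copyReg (x y : ℕ) : Prog := .op .lor x y y

open RExpr in
/-- The program `p` with its registers renamed by `simReg`, its memory moved to the address `mb`,
its coins moved to the position `cb`, and with the `i`-th input array given by the expression `inE i`
of the address, which is found in register `98`. -/
def Prog.reloc (mb cb : RExpr) (inE : ℕ → RExpr) : Prog → Prog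
  | .skip => .skip
  | .const x c => .const (simReg x) c
  | .op o x y z => .op o (simReg x) (simReg y) (simReg z)
  | .load x y => .seq (copyReg 98 (simReg y)) (assign (simReg x) (rd (mb + RExpr.var 98)))
  | .store x y => .seq (copyReg 98 (simReg x)) (.seq (copyReg 99 (simReg y))
      (write (mb + RExpr.var 98) (.var 99)))
  | .input i x y => .seq (copyReg 98 (simReg y)) (assign (simReg x) (inE i))
  | .coin x y => .seq (copyReg 98 (simReg y)) (.seq (assign 98 (cb + RExpr.var 98))
      (.coin (simReg x) 98))
  | .seq p q => .seq (p.reloc mb cb inE) (q.reloc mb cb inE)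
  | .cond x p q => .cond (simReg x) (p.reloc mb cb inE) (q.reloc mb cb inE)
  | .loop x p => .loop (simReg x) (p.reloc mb cb inE)

/-- `S` simulates `s` with memory at address `mb`, and otherwise looks like `s₀`. -/
structure Simulates (B V Q mb : ℕ) (s₀ S s : MState) : Prop where
  simReg : ∀ x < B, S.reg (simReg x) = s.reg x
  simMem : ∀ a ≤ V, S.mem (mb + a) = s.mem a
  mem : ∀ a, a < mb ∨ mb + V < a → S.mem a = s₀.mem a
  reg : ∀ x < 98, S.reg x = s₀.reg x
  addr : S.reg 98 ≤ Q
  val : S.reg 99 ≤ Q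

theorem Simulates.setReg {B V Q mb : ℕ} {s₀ S s S' : MState} (h : Simulates B V Q mb s₀ S s)
    {x v : ℕ} (hm : S'.mem = S.mem) (hx : S'.reg (_root_.simReg x) = v)
    (h98 : S'.reg 98 ≤ Q) (h99 : S'.reg 99 ≤ Q)
    (hr : ∀ y, (y < 98 ∨ (y % 2 = 1 ∧ 100 < y)) → y ≠ _root_.simReg x → S'.reg y = S.reg y) :
    Simulates B V Q mb s₀ S' (s.setReg x v) where
  simReg y hy := by
    by_cases hyx : y = x
    · subst hyx; simpa using hx
    · rw [hr _ (.inr (by simp only [_root_.simReg]; omega)) (by simp only [_root_.simReg]; omega),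
        h.simReg y hy, MState.setReg_reg, if_neg hyx]
  simMem a ha := by rw [hm]; exact h.simMem a ha
  mem a ha := by rw [hm]; exact h.mem a ha
  reg y hy := by rw [hr y (.inl hy) (by simp only [_root_.simReg]; omega)]; exact h.reg y hy
  addr := h98
  val := h99

section
variable {W Q D W₀ V B mb cb κ : ℕ} {I inp : ℕ → ℕ → ℕ} {ρ : ℕ → Bool} {mbE cbE : RExpr}
  {inE : ℕ → RExpr} {s₀ : MState}

/-- What the expressions in a relocated program have to satisfy. -/
structure RelocOK (W Q D V mb cb κ : ℕ) (I inp : ℕ → ℕ → ℕ) (mbE cbE : RExpr) (inE : ℕ → RExpr)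
    (s₀ : MState) : Prop where
  word : WordOK W Q D I
  V_le : V ≤ Q
  cb_le : cb + V ≤ Q
  mb_deg : mbE.deg + 5 ≤ D
  cb_deg : cbE.deg + 5 ≤ D
  in_deg : ∀ i, (inE i).deg ≤ D
  mb_cost : mbE.cost ≤ κ
  cb_cost : cbE.cost ≤ κ
  in_cost : ∀ i, (inE i).cost ≤ κ
  mb_eval : ∀ S : MState, (∀ x < 98, S.reg x = s₀.reg x) → mbE.eval I S = mb
  cb_eval : ∀ S : MState, (∀ x < 98, S.reg x = s₀.reg x) → cbE.eval I S = cb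
  in_eval : ∀ S : MState, (∀ x < 98, S.reg x = s₀.reg x) → (∀ a < mb, S.mem a = s₀.mem a) →
    S.reg 98 ≤ V → ∀ i, (inE i).eval I S = inp i (S.reg 98)

theorem Simulates.bdd {S s : MState} (h : Simulates B V Q mb s₀ S s) (hs₀ : s₀.Bdd Q)
    (hV : V ≤ Q) (hs : s.Within V) : S.Bdd Q where
  reg x hx := by
    by_cases h1 : x < 98
    · rw [h.reg x h1]; exact hs₀.reg x hx
    · obtain rfl | rfl : x = 98 ∨ x = 99 := by omega
      · exact h.addr
      · exact h.val
  mem a := by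
    by_cases ha : a < mb ∨ mb + V < a
    · rw [h.mem a ha]; exact hs₀.mem a
    · obtain ⟨c, rfl⟩ : ∃ c, a = mb + c := ⟨a - mb, by omega⟩
      rw [h.simMem c (by omega)]
      exact (hs.mem c).trans hV

theorem copyReg_exec {S : MState} {x y : ℕ} (h : S.reg y ≤ W) :
    Exec W I ρ (copyReg x y) S (S.setReg x (S.reg y)) 1 := by
  have := Exec.op (inp := I) (ρ := ρ) (W := W) S .lor x y y (by simpa [BinOp.eval])
  simpa [BinOp.eval, copyReg] using this

theorem Simulates.setAddr {S s : MState} (h : Simulates B V Q mb s₀ S s) {v : ℕ} (hv : v ≤ Q) :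
    Simulates B V Q mb s₀ (S.setReg 98 v) s where
  simReg x hx := by
    rw [MState.setReg_reg, if_neg (by simp only [_root_.simReg]; omega)]; exact h.simReg x hx
  simMem := h.simMem
  mem := h.mem
  reg x hx := by rw [MState.setReg_reg, if_neg (by omega)]; exact h.reg x hx
  addr := by simpa using hv
  val := by simpa using h.val

theorem Simulates.setVal {S s : MState} (h : Simulates B V Q mb s₀ S s) {v : ℕ} (hv : v ≤ Q) :
    Simulates B V Q mb s₀ (S.setReg 99 v) s where
  simReg x hx := by
    rw [MState.setReg_reg, if_neg (by simp only [_root_.simReg]; omega)]; exact h.simReg x hx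
  simMem := h.simMem
  mem := h.mem
  reg x hx := by rw [MState.setReg_reg, if_neg (by omega)]; exact h.reg x hx
  addr := by simpa using h.addr
  val := by simpa using hv

/-- Simulation step by step, by induction on the run. Each instruction becomes at most three pieces
of code with one expression of cost at most `κ` plus constant overhead, whence the factor `κ + 10`.
The bound `V` confines the simulated memory to the cells from `mb` to `mb + V`. -/
theorem Exec.reloc (h : RelocOK W Q D V mb cb κ I inp mbE cbE inE s₀) (hW₀ : W₀ ≤ V)
    (hs₀ : s₀.Bdd Q) {p : Prog} {s s' : MState} {t : ℕ}
    (he : Exec W₀ inp (fun y => ρ (cb + y)) p s s' t) :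
    p.RegsBelow B → s.Within V → ∀ S, Simulates B V Q mb s₀ S s →
      ∃ S' t', t' ≤ (κ + 10) * t ∧ Exec W I ρ (p.reloc mbE cbE inE) S S' t' ∧
        Simulates B V Q mb s₀ S' s' := by
  have hQ := h.word.two_le
  have hD : 5 ≤ D := by have := h.mb_deg; omega
  have hQW : Q ≤ W := h.word.le (k := 1) (by simp) (by omega)
  have hVQ := h.V_le
  have hmbD := h.mb_deg
  have hcbD := h.cb_deg
  have hmbc := h.mb_cost
  have hcbc := h.cb_cost
  have simSet : ∀ {S s : MState} (x v : ℕ), Simulates B V Q mb s₀ S s →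
      Simulates B V Q mb s₀ (S.setReg (simReg x) v) (s.setReg x v) := by
    intro S s x v hS
    refine hS.setReg rfl (by simp) ?_ ?_ fun y hy hyx => by rw [MState.setReg_reg, if_neg hyx]
    · rw [MState.setReg_reg, if_neg (by simp only [simReg]; omega)]; exact hS.addr
    · rw [MState.setReg_reg, if_neg (by simp only [simReg]; omega)]; exact hS.val
  have simAssign : ∀ {S s : MState} {e : RExpr} (x v : ℕ), Simulates B V Q mb s₀ S s →
      s.Within V → e.deg ≤ D → e.eval I S = v → ∃ S', Exec W I ρ (assign (simReg x) e) S S' (e.cost + 1)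
        ∧ Simulates B V Q mb s₀ S' (s.setReg x v) := by
    intro S s e x v hS hs he hv
    obtain ⟨S', h1, h2, h3, h4⟩ := assign_exec (ρ := ρ) h.word (hS.bdd hs₀ hVQ hs) he
      (simReg x)
    refine ⟨S', h1, hS.setReg h2 (h3.trans hv) ?_ ?_ fun y hy hyx => h4 y (by omega) hyx⟩
    · rw [h4 98 (by norm_num) (by simp only [simReg]; omega)]; exact hS.addr
    · rw [h4 99 (by norm_num) (by simp only [simReg]; omega)]; exact hS.val
  induction he with
  | skip s => exact fun _ _ S hS => ⟨S, 1, by omega, .skip _, hS⟩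
  | const s x c hc =>
    intro hB hs S hS
    exact ⟨_, 1, by omega, .const _ _ _ (by omega), simSet x c hS⟩
  | op s o x y z hc =>
    intro hB hs S hS
    rw [← hS.simReg y hB.2.1, ← hS.simReg z hB.2.2] at hc ⊢
    exact ⟨_, 1, by omega, .op _ _ _ _ _ (by omega), simSet x _ hS⟩
  | load s x y hc =>
    intro hB hs S hS
    have hy := hS.simReg y hB.2
    have hyV := hs.reg y
    have hS1 := hS.setAddr (v := S.reg (simReg y)) (by omega)
    obtain ⟨S', e', h'⟩ := simAssign (e := RExpr.rd (mbE + RExpr.var 98)) x (s.mem (s.reg y)) hS1 hs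
      (by change mbE.deg + 1 + 1 + 1 ≤ D; omega) (by
        rw [RExpr.eval_rd, RExpr.eval_add, h.mb_eval _ hS1.reg]
        simp only [RExpr.eval_var, MState.setReg_reg]
        norm_num
        rw [hy]; exact hS.simMem _ hyV)
    refine ⟨S', _, ?_, .seq (copyReg_exec (by omega)) e', h'⟩
    change 1 + (mbE.cost + 1 + 1 + 1 + 1) ≤ _; omega
  | store s x y hc =>
    intro hB hs S hS
    have hx := hS.simReg x hB.1
    have hy := hS.simReg y hB.2
    have hxV := hs.reg x
    have hyV := hs.reg y
    have hS1 := hS.setAddr (v := S.reg (simReg x)) (by omega)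
    have hS2 := hS1.setVal (v := S.reg (simReg y)) (by omega)
    obtain ⟨S', e', m', f'⟩ := write_exec (ρ := ρ) (a := mbE + RExpr.var 98) (e := .var 99) h.word
      (hS2.bdd hs₀ hVQ hs) (by change mbE.deg + 1 + 1 ≤ D; omega) (by change 1 ≤ D; omega)
    rw [RExpr.eval_add, h.mb_eval _ hS2.reg] at m'
    simp only [RExpr.eval_var, MState.setReg_reg] at m'
    norm_num at m'
    rw [hx, hy] at m'
    have e2 : Exec W I ρ (copyReg 99 (simReg y)) (S.setReg 98 (S.reg (simReg x)))
        ((S.setReg 98 (S.reg (simReg x))).setReg 99 (S.reg (simReg y))) 1 := by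
      have h2 : (S.setReg 98 (S.reg (simReg x))).reg (simReg y) = S.reg (simReg y) := by
        rw [MState.setReg_reg, if_neg (by simp only [simReg]; omega)]
      have := copyReg_exec (I := I) (ρ := ρ) (W := W) (S := S.setReg 98 (S.reg (simReg x)))
        (x := 99) (y := simReg y) (by omega)
      rwa [h2] at this
    refine ⟨S', _, ?_, .seq (copyReg_exec (by omega)) (.seq e2 e'), ?_⟩
    · change 1 + (1 + (mbE.cost + 1 + 1 + 1 + 1)) ≤ _; omega
    · refine ⟨fun z hz => ?_, fun a ha => ?_, fun a ha => ?_, fun z hz => ?_, ?_, ?_⟩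
      · rw [f' _ (by simp only [simReg]; omega)]; exact hS2.simReg z hz
      · rw [m']
        simp only [MState.setMem, Function.update_apply, Nat.add_left_cancel_iff, MState.setReg_mem]
        split
        · rfl
        · exact hS.simMem a ha
      · rw [m']
        simp only [MState.setMem, Function.update_apply, MState.setReg_mem]
        rw [if_neg (by omega)]
        exact hS.mem a ha
      · rw [f' z (.inl (by omega))]; exact hS2.reg z hz
      · rw [f' 98 (by norm_num)]; exact hS2.addr
      · rw [f' 99 (by norm_num)]; exact hS2.val
  | input s i x y hc =>
    intro hB hs S hS
    have hy := hS.simReg y hB.2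
    have hyV := hs.reg y
    have hS1 := hS.setAddr (v := S.reg (simReg y)) (by omega)
    obtain ⟨S', e', h'⟩ := simAssign (e := inE i) x (inp i (s.reg y)) hS1 hs (h.in_deg i) (by
        rw [h.in_eval _ hS1.reg (fun a ha => hS1.mem a (.inl ha)) (by simp; omega), MState.setReg_reg,
          if_pos rfl, hy])
    refine ⟨S', _, ?_, .seq (copyReg_exec (by omega)) e', h'⟩
    have := h.in_cost i
    omega
  | coin s x y hc =>
    intro hB hs S hS
    have hy := hS.simReg y hB.2
    have hyV := hs.reg y
    have hcb := h.cb_le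
    have hS1 := hS.setAddr (v := S.reg (simReg y)) (by omega)
    obtain ⟨S', e', m', v', f'⟩ := assign_exec (ρ := ρ) (e := cbE + RExpr.var 98) h.word
      (hS1.bdd hs₀ hVQ hs) (by change cbE.deg + 1 + 1 ≤ D; omega) 98
    rw [RExpr.eval_add, h.cb_eval _ hS1.reg] at v'
    simp only [RExpr.eval_var, MState.setReg_reg] at v'
    norm_num at v'
    rw [hy] at v'
    -- Register 98 now holds the shifted position of the coin; the simulated state is not affected.
    have hS' : Simulates B V Q mb s₀ S' s := by
      refine ⟨fun z hz => ?_, fun a ha => ?_, fun a ha => ?_, fun z hz => ?_, ?_, ?_⟩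
      · rw [f' _ (by simp only [simReg]; omega) (by simp only [simReg]; omega)]
        exact hS1.simReg z hz
      · rw [m']; exact hS1.simMem a ha
      · rw [m']; exact hS1.mem a ha
      · rw [f' z (by omega) (by omega)]; exact hS1.reg z hz
      · omega
      · rw [f' 99 (by norm_num) (by norm_num)]; exact hS1.val
    have e2 := Exec.coin (inp := I) (ρ := ρ) (W := W) S' (simReg x) 98 (by rw [v']; omega)
    rw [v'] at e2
    refine ⟨_, _, ?_, .seq (copyReg_exec (by omega)) (.seq e' e2), simSet x _ hS'⟩
    change 1 + (cbE.cost + 1 + 1 + 1 + 1) ≤ _; omega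
  | seq h1 _ ih ih' =>
    intro hB hs S hS
    obtain ⟨S₁, t₁, ht₁, e₁, hS₁⟩ := ih hB.1 hs S hS
    obtain ⟨S₂, t₂, ht₂, e₂, hS₂⟩ := ih' hB.2 (h1.within hW₀ hs) S₁ hS₁
    exact ⟨S₂, t₁ + t₂, by rw [mul_add]; omega, .seq e₁ e₂, hS₂⟩
  | cond_true hx _ ih =>
    intro hB hs S hS
    obtain ⟨S₁, t₁, ht₁, e₁, hS₁⟩ := ih hB.2.1 hs S hS
    exact ⟨S₁, 1 + t₁, by rw [mul_add]; omega,
      .cond_true (by rw [hS.simReg _ hB.1]; exact hx) e₁, hS₁⟩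
  | cond_false hx _ ih =>
    intro hB hs S hS
    obtain ⟨S₁, t₁, ht₁, e₁, hS₁⟩ := ih hB.2.2 hs S hS
    exact ⟨S₁, 1 + t₁, by rw [mul_add]; omega,
      .cond_false (by rw [hS.simReg _ hB.1]; exact hx) e₁, hS₁⟩
  | loop_true hx h1 _ ih ih' =>
    intro hB hs S hS
    obtain ⟨S₁, t₁, ht₁, e₁, hS₁⟩ := ih hB.2 hs S hS
    obtain ⟨S₂, t₂, ht₂, e₂, hS₂⟩ := ih' hB (h1.within hW₀ hs) S₁ hS₁
    exact ⟨S₂, 1 + t₁ + t₂, by rw [mul_add, mul_add]; omega,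
      .loop_true (by rw [hS.simReg _ hB.1]; exact hx) e₁ e₂, hS₂⟩
  | loop_false hx =>
    intro hB hs S hS
    exact ⟨S, 1, by omega, .loop_false (by rw [hS.simReg _ hB.1]; exact hx), hS⟩

/-- Set the first `B` registers of the relocated program to `0`. -/
def clearRegs : ℕ → Prog
  | 0 => .skip
  | B + 1 => .seq (clearRegs B) (.const (simReg B) 0)

theorem clearRegs_exec (B : ℕ) (S : MState) : ∃ S', Exec W I ρ (clearRegs B) S S' (B + 1) ∧
    S'.mem = S.mem ∧ (∀ x < B, S'.reg (simReg x) = 0) ∧ ∀ x < 100, S'.reg x = S.reg x := by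
  induction B with
  | zero => exact ⟨S, .skip S, rfl, by simp, fun _ _ => rfl⟩
  | succ B ih =>
    obtain ⟨S', h1, h2, h3, h4⟩ := ih
    refine ⟨_, .seq h1 (.const S' (simReg B) 0 (Nat.zero_le _)), h2, fun x hx => ?_, fun x hx => ?_⟩
    · rw [MState.setReg_reg]
      split
      · rfl
      · exact h3 x (by simp only [simReg] at *; omega)
    · rw [MState.setReg_reg, if_neg (by simp only [simReg]; omega), h4 x hx]

/-- Run the program `p` on fresh memory at address `mb`, with `size` in register `0`, and write the
result after the memory of `p`, which is followed by one cell: it has `Z` cells with it. -/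
def call (p : Prog) (B : ℕ) (mb cb Z size : RExpr) (inE : ℕ → RExpr) : Prog :=
  .seq (clearRegs B) (.seq (assign (simReg 0) size) (.seq (p.reloc mb cb inE)
    (.seq (copyReg 98 (simReg 0)) (.seq (write (mb + Z - 1) (.var 98))
      (.seq (assign 98 0) (assign 99 0))))))

/-- The memory up to address `V`, and then the result. -/
def MState.record (s : MState) (V : ℕ) : ℕ → ℕ := fun a => if a ≤ V then s.mem a else s.reg 0

/-- The initial state of the program is recreated by clearing its registers and by using memory that
is still zero. Registers 98 and 99 are reset at the end, so that apart from auxiliary registers the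
call changes only its own memory area. -/
theorem runs_call {n : ℕ} {ZE nE : RExpr} {p : Prog} {sf : MState} {t : ℕ}
    (h : RelocOK W Q D V mb cb κ I inp mbE cbE inE s₀) (hW₀ : W₀ ≤ V) (hn : n ≤ V)
    (hs₀ : s₀.Bdd Q) (hB : 0 < B) (hp : p.RegsBelow B)
    (h98 : s₀.reg 98 = 0) (h99 : s₀.reg 99 = 0) (hfresh : ∀ a ≤ V, s₀.mem (mb + a) = 0)
    (hZD : mbE.deg + ZE.deg + 5 ≤ D) (hZκ : ZE.cost ≤ κ)
    (hZ : ∀ S : MState, (∀ x < 98, S.reg x = s₀.reg x) → ZE.eval I S = V + 2)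
    (hnD : nE.deg ≤ D) (hnκ : nE.cost ≤ κ)
    (hnE : ∀ S : MState, (∀ x < 98, S.reg x = s₀.reg x) → nE.eval I S = n)
    (he : Exec W₀ inp (fun y => ρ (cb + y)) p (MState.init n) sf t) :
    Runs W I ρ (call p B mbE cbE ZE nE inE) s₀
      (s₀.withMem (memFill s₀.mem mb (sf.record V) (V + 2))) ((κ + 10) * t + B + 3 * κ + 20) := by
  intro S hS
  have hQ := h.word.two_le
  have hD : 5 ≤ D := by have := h.mb_deg; omega
  have hQW : Q ≤ W := h.word.le (k := 1) (by simp) (by omega)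
  have hVQ := h.V_le
  have hsf := he.within hW₀ (.init hn)
  obtain ⟨S₁, e₁, m₁, z₁, f₁⟩ := clearRegs_exec (W := W) (I := I) (ρ := ρ) B S
  have hS₁ : S₁.VEq s₀ := ⟨m₁.trans hS.mem, fun x hx => (f₁ x hx).trans (hS.reg x hx)⟩
  obtain ⟨S₂, e₂, m₂, v₂, f₂⟩ := assign_exec (ρ := ρ) h.word (hS₁.bdd hs₀) hnD (simReg 0)
  rw [hnE _ fun x hx => hS₁.reg x (by omega)] at v₂
  have hS₂ : S₂.VEq s₀ := ⟨m₂.trans hS₁.mem, fun x hx => by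
    rw [f₂ x (.inl hx) (by simp only [simReg]; omega)]; exact hS₁.reg x hx⟩
  have sim₂ : Simulates B V Q mb s₀ S₂ (MState.init n) := by
    refine ⟨fun x hx => ?_, fun a ha => ?_, fun a _ => by rw [hS₂.mem],
      fun x hx => hS₂.reg x (by omega), ?_, ?_⟩
    · by_cases hx0 : x = 0
      · subst hx0; rw [v₂]; simp [MState.init]
      · rw [f₂ _ (by simp only [simReg]; omega) (by simp only [simReg]; omega), z₁ x hx]
        simp [MState.init, hx0]
    · rw [hS₂.mem, hfresh a ha]; rfl
    · rw [hS₂.reg 98 (by norm_num), h98]; omega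
    · rw [hS₂.reg 99 (by norm_num), h99]; omega
  obtain ⟨S₃, t₃, ht₃, e₃, sim₃⟩ := he.reloc h hW₀ hs₀ hp (.init hn) S₂ sim₂
  have hres : S₃.reg (simReg 0) = sf.reg 0 := sim₃.simReg 0 hB
  have hresV := hsf.reg 0
  have e₄ := copyReg_exec (I := I) (ρ := ρ) (W := W) (S := S₃) (x := 98) (y := simReg 0) (by omega)
  have sim₄ := sim₃.setAddr (v := S₃.reg (simReg 0)) (by omega)
  obtain ⟨S₅, e₅, m₅, f₅⟩ := write_exec (ρ := ρ) (a := mbE + ZE - 1) (e := .var 98) h.word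
    (sim₄.bdd hs₀ hVQ hsf) (by change mbE.deg + ZE.deg + 1 + 1 + 1 ≤ D; omega)
    (by change 1 ≤ D; omega)
  rw [RExpr.eval_sub, RExpr.eval_add, h.mb_eval _ sim₄.reg, hZ _ sim₄.reg] at m₅
  simp only [RExpr.eval_var, MState.setReg_reg, RExpr.eval_ofNat] at m₅
  norm_num at m₅
  rw [hres] at m₅
  -- The answer goes to the cell `mb + (V + 1)`, right after the simulated memory; this is why an
  -- area has `V + 2` cells.
  have hm : S₅.mem = memFill s₀.mem mb (sf.record V) (V + 2) := by
    rw [m₅]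
    funext a
    simp only [MState.setMem, Function.update_apply, MState.setReg_mem, memFill, MState.record]
    by_cases ha : a = mb + (V + 1)
    · rw [if_pos (by omega), if_pos (by omega), if_neg (by omega)]
    · rw [if_neg (by omega)]
      by_cases ha' : mb ≤ a ∧ a < mb + (V + 2)
      · obtain ⟨c, rfl⟩ : ∃ c, a = mb + c := ⟨a - mb, by omega⟩
        rw [if_pos ha', Nat.add_sub_cancel_left, if_pos (by omega), sim₃.simMem c (by omega)]
      · rw [if_neg ha', sim₃.mem a (by omega)]
  have hb₅ : S₅.Bdd Q := by
    refine ⟨fun x hx => ?_, fun a => ?_⟩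
    · rw [f₅ x (.inl hx)]; exact (sim₄.bdd hs₀ hVQ hsf).reg x hx
    · rw [hm]
      refine memFill_le hs₀.mem (fun i _ => ?_) a
      rw [MState.record]
      split
      · exact (hsf.mem i).trans hVQ
      · omega
  obtain ⟨S₆, e₆, m₆, v₆, f₆⟩ := assign_exec (ρ := ρ) (e := 0) h.word hb₅
    (by change 0 ≤ D; omega) 98
  have hb₆ : S₆.Bdd Q := by
    refine ⟨fun x hx => ?_, fun a => by rw [m₆]; exact hb₅.mem a⟩
    by_cases hx' : x = 98
    · subst hx'; rw [v₆]; exact Nat.zero_le _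
    · rw [f₆ x (.inl hx) hx']; exact hb₅.reg x hx
  obtain ⟨S₇, e₇, m₇, v₇, f₇⟩ := assign_exec (ρ := ρ) (e := 0) h.word hb₆
    (by change 0 ≤ D; omega) 99
  refine ⟨S₇, _, ⟨by rw [m₇, m₆, hm]; rfl, fun x hx => ?_⟩, ?_,
    .seq e₁ (.seq e₂ (.seq e₃ (.seq e₄ (.seq e₅ (.seq e₆ e₇)))))⟩
  · rw [MState.withMem_reg]
    by_cases h9 : x = 99
    · subst h9; rw [v₇, h99]; rfl
    · rw [f₇ x (.inl hx) h9]
      by_cases h8 : x = 98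
      · subst h8; rw [v₆, h98]; rfl
      · rw [f₆ x (.inl hx) h8, f₅ x (.inl hx), MState.setReg_reg, if_neg h8,
          sim₃.reg x (by omega)]
  · have := h.mb_cost
    change B + 1 + (nE.cost + 1 + (t₃ + (1 + (mbE.cost + ZE.cost + 1 + 1 + 1 + 1 + 1 + (1 + 1 + (1 + 1))))))
      ≤ _
    omega

/-- Consecutive areas of `Z` cells form one table, whose index encodes the area as quotient and the
cell as remainder. -/
theorem memFill_block (m : ℕ → ℕ) (b Z k : ℕ) (R : ℕ → ℕ → ℕ) :
    memFill (memFill m b (fun x => R (x / Z) (x % Z)) (k * Z)) (b + k * Z) (R k) Z =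
      memFill m b (fun x => R (x / Z) (x % Z)) ((k + 1) * Z) := by
  funext a
  rw [add_mul, one_mul]
  by_cases h : b + k * Z ≤ a ∧ a < b + k * Z + Z
  · obtain ⟨c, rfl⟩ : ∃ c, a = b + k * Z + c := ⟨a - (b + k * Z), by omega⟩
    have hc : c < Z := by omega
    rw [memFill_lt hc, add_assoc, memFill_lt (by omega), Nat.add_comm, Nat.add_mul_div_right _ _
      (by omega), Nat.div_eq_of_lt hc, Nat.add_mul_mod_self_right, Nat.mod_eq_of_lt hc, zero_add]
  · rw [memFill, if_neg h, memFill, memFill]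
    congr 1
    apply propext; omega

/-- A loop of calls; the `k`-th one has its memory at `base + k * Z`. -/
def callLoop (p : Prog) (B : ℕ) (lim base cb Z size : RExpr) (inE : ℕ → RExpr) : Prog :=
  forLoop lim (call p B (base + .var 1 * Z) cb Z size inE)

/-- The calls write to successive fresh areas and leave the earlier ones intact. Inputs are read
below `b` only, so they are the same for all calls, and all final memories and answers are available
afterwards as one table. -/
theorem runs_callLoop {n K T b : ℕ} {lim base ZE nE : RExpr} {p : Prog} {s : MState}
    {sf : ℕ → MState} {inp : ℕ → ℕ → ℕ → ℕ} {cb : ℕ → ℕ}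
    (h : WordOK W Q D I) (hs : s.Bdd Q) (hW₀ : W₀ ≤ V) (hn : n ≤ V) (hVQ : V ≤ Q)
    (hB : 0 < B) (hp : p.RegsBelow B) (h98 : s.reg 98 = 0) (h99 : s.reg 99 = 0)
    (hfresh : ∀ a, b ≤ a → s.mem a = 0) (hK : K ≤ Q) (hcb : ∀ k < K, cb k + V ≤ Q)
    (hlim : ∀ S : MState, (∀ x < 98, x ≠ 1 → x ≠ 2 → S.reg x = s.reg x) → lim.eval I S = K)
    (hbase : ∀ S : MState, (∀ x < 98, x ≠ 1 → x ≠ 2 → S.reg x = s.reg x) → base.eval I S = b)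
    (hZ : ∀ S : MState, (∀ x < 98, x ≠ 1 → x ≠ 2 → S.reg x = s.reg x) → ZE.eval I S = V + 2)
    (hnE : ∀ S : MState, (∀ x < 98, x ≠ 1 → x ≠ 2 → S.reg x = s.reg x) → nE.eval I S = n)
    (hcbE : ∀ k < K, ∀ S : MState, (∀ x < 98, x ≠ 1 → x ≠ 2 → S.reg x = s.reg x) → S.reg 1 = k →
      cbE.eval I S = cb k)
    (hinE : ∀ k < K, ∀ S : MState, (∀ x < 98, x ≠ 1 → x ≠ 2 → S.reg x = s.reg x) → S.reg 1 = k →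
      (∀ a < b, S.mem a = s.mem a) → S.reg 98 ≤ V → ∀ i, (inE i).eval I S = inp k i (S.reg 98))
    (hlD : lim.deg + 3 ≤ D) (hbD : base.deg + 2 * ZE.deg + 10 ≤ D) (hcD : cbE.deg + 5 ≤ D)
    (hiD : ∀ i, (inE i).deg ≤ D) (hnD : nE.deg ≤ D)
    (hbκ : base.cost + ZE.cost + 3 ≤ κ) (hcκ : cbE.cost ≤ κ) (hiκ : ∀ i, (inE i).cost ≤ κ)
    (hnκ : nE.cost ≤ κ) (hlκ : lim.cost ≤ κ)
    (hrun : ∀ k < K, ∃ t ≤ T, Exec W₀ (inp k) (fun y => ρ (cb k + y)) p (MState.init n) (sf k) t) :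
    Runs W I ρ (callLoop p B lim base cbE ZE nE inE) s
      ((s.withMem (memFill s.mem b (fun x => (sf (x / (V + 2))).record V (x % (V + 2)))
        (K * (V + 2)))).counters K 0)
      (κ + 6 + K * ((κ + 10) * T + B + 4 * κ + 28)) := by
  have hrec : ∀ k < K, ∀ a, (sf k).record V a ≤ V := by
    intro k hk a
    obtain ⟨t, _, he⟩ := hrun k hk
    have := he.within hW₀ (.init hn)
    rw [MState.record]
    split
    · exact this.mem _
    · exact this.reg _
  have hm : ∀ k ≤ K, ∀ a, memFill s.mem b (fun x => (sf (x / (V + 2))).record V (x % (V + 2)))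
      (k * (V + 2)) a ≤ Q := fun k hk a => memFill_le hs.mem (fun i hi =>
        (hrec _ ((Nat.div_lt_of_lt_mul (by rwa [mul_comm] at hi)).trans_le hk) _).trans hVQ) a
  have := runs_forLoop (ρ := ρ) (lim := lim) (body := call p B (base + .var 1 * ZE) cbE ZE nE inE) h
    (fun k => s.withMem (memFill s.mem b (fun x => (sf (x / (V + 2))).record V (x % (V + 2)))
      (k * (V + 2)))) (K := K) (T := (κ + 10) * T + B + 3 * κ + 20) hK
    (fun k hk => hs.withMem (hm k hk)) hlD (fun k _ x y => hlim _ fun z hz h1 h2 => by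
      simp [h1, h2]) ?_
  · simp only [zero_mul, memFill_zero] at this
    refine Runs.mono this ?_
    have : K * ((κ + 10) * T + B + 3 * κ + 20 + lim.cost + 8) ≤ K * ((κ + 10) * T + B + 4 * κ + 28) :=
      Nat.mul_le_mul le_rfl (by omega)
    omega
  · intro k hk
    obtain ⟨t, ht, he⟩ := hrun k hk
    set s₀ := (s.withMem (memFill s.mem b (fun x => (sf (x / (V + 2))).record V (x % (V + 2)))
      (k * (V + 2)))).counters k (K - k) with hs₀
    have hb₀ : s₀.Bdd Q := MState.Bdd.counters (hs.withMem (hm k hk.le)) (by omega) (by omega)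
    have hreg : ∀ S : MState, (∀ x < 98, S.reg x = s₀.reg x) →
        ∀ x < 98, x ≠ 1 → x ≠ 2 → S.reg x = s.reg x := by
      intro S hS x hx h1 h2
      rw [hS x hx, hs₀]
      simp [h1, h2]
    have h1 : ∀ S : MState, (∀ x < 98, S.reg x = s₀.reg x) → S.reg 1 = k := by
      intro S hS
      rw [hS 1 (by norm_num), hs₀]
      simp
    have hmb : ∀ S : MState, (∀ x < 98, S.reg x = s₀.reg x) →
        (base + RExpr.var 1 * ZE).eval I S = b + k * (V + 2) := by
      intro S hS
      rw [RExpr.eval_add, RExpr.eval_mul, hbase S (hreg S hS), hZ S (hreg S hS), RExpr.eval_var,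
        if_pos (by norm_num), h1 S hS]
    have hOK : RelocOK W Q D V (b + k * (V + 2)) (cb k) κ I (inp k) (base + .var 1 * ZE) cbE inE s₀ := by
      refine ⟨h, hVQ, hcb k hk, ?_, hcD, hiD, ?_, hcκ, hiκ, hmb,
        fun S hS => hcbE k hk S (hreg S hS) (h1 S hS), fun S hS hm h98 => hinE k hk S (hreg S hS)
        (h1 S hS) (fun a ha => ?_) h98⟩
      · change base.deg + (1 + ZE.deg + 1) + 1 + 5 ≤ D; omega
      · change base.cost + (1 + ZE.cost + 1) + 1 ≤ κ; omega
      · rw [hm a (by omega), hs₀, MState.counters_mem, MState.withMem_mem]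
        exact memFill_of_lt ha
    have := runs_call hOK hW₀ hn hb₀ hB hp (by rw [hs₀]; simpa using h98) (by rw [hs₀]; simpa using h99)
      (fun a _ => by
        rw [hs₀, MState.counters_mem, MState.withMem_mem, memFill_of_ge (by omega)]
        exact hfresh _ (by omega))
      (by change base.deg + (1 + ZE.deg + 1) + 1 + ZE.deg + 5 ≤ D; omega) (by omega)
      (fun S hS => hZ S (hreg S hS)) hnD hnκ (fun S hS => hnE S (hreg S hS)) he
    rw [show s₀.withMem (memFill s₀.mem (b + k * (V + 2)) ((sf k).record V) (V + 2))
      = (s.withMem (memFill s.mem b (fun x => (sf (x / (V + 2))).record V (x % (V + 2)))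
          ((k + 1) * (V + 2)))).counters k (K - k) by
        rw [← memFill_block (R := fun k a => (sf k).record V a)]; rfl] at this
    refine this.mono ?_
    have := Nat.mul_le_mul (le_refl (κ + 10)) ht
    omega

end


/-! ### Independent blocks of coin flips and probability amplification -/

open MeasureTheory in
instance : IsProbabilityMeasure coinMeasure := by
  unfold coinMeasure; infer_instance

/-- The law of `Z` fair coin flips. -/
noncomputable def coinBlock (Z : ℕ) : MeasureTheory.Measure (Fin Z → Bool) :=
  MeasureTheory.Measure.infinitePi fun _ => (PMF.uniformOfFintype Bool).toMeasure

instance (Z : ℕ) : MeasureTheory.IsProbabilityMeasure (coinBlock Z) := by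
  unfold coinBlock; infer_instance

/-- The `r`-th block of `Z` coin flips. -/
def takeBlock (Z r : ℕ) (ρ : ℕ → Bool) : Fin Z → Bool := fun y => ρ (r * Z + y)

/-- Division by `Z` with remainder identifies the positions with pairs of a block and a place in it;
under this reindexing and currying a product measure stays a product measure. Hence the blocks are
independent. -/
theorem map_takeBlock {Z : ℕ} (hZ : 0 < Z) :
    coinMeasure.map (fun ρ r => takeBlock Z r ρ) =
      MeasureTheory.Measure.infinitePi fun _ : ℕ => coinBlock Z := by
  have : NeZero Z := ⟨hZ.ne'⟩
  have h1 := MeasureTheory.Measure.infinitePi_map_piCongrLeft (X := fun _ => Bool)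
    (fun _ : ℕ × Fin Z => (PMF.uniformOfFintype Bool).toMeasure) (Nat.divModEquiv Z)
  have h2 := MeasureTheory.Measure.infinitePi_map_curry
    (fun (_ : ℕ) (_ : Fin Z) => (PMF.uniformOfFintype Bool).toMeasure)
  rw [← h1, MeasureTheory.Measure.map_map (by fun_prop) (by fun_prop)] at h2
  unfold coinBlock
  rw [← h2]
  unfold coinMeasure
  congr 1
  funext ρ r y
  simp only [Function.comp_apply, MeasurableEquiv.coe_curry, Function.curry_apply,
    MeasurableEquiv.coe_piCongrLeft, takeBlock]
  have := Equiv.piCongrLeft_apply_apply (P := fun _ : ℕ × Fin Z => Bool) (Nat.divModEquiv Z) ρ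
    ((Nat.divModEquiv Z).symm (r, y))
  rw [Equiv.apply_symm_apply] at this
  rw [this]
  rfl

theorem measurable_takeBlock (Z r : ℕ) : Measurable (takeBlock Z r) := by
  unfold takeBlock; fun_prop

theorem coinMeasure_forall_takeBlock {Z : ℕ} (hZ : 0 < Z) (F : Set (Fin Z → Bool))
    (T : Finset ℕ) :
    coinMeasure {ρ | ∀ r ∈ T, takeBlock Z r ρ ∈ F} = coinBlock Z F ^ T.card := by
  have hF : MeasurableSet F := (Set.toFinite F).measurableSet
  have h := MeasureTheory.Measure.infinitePi_pi (fun _ : ℕ => coinBlock Z) (s := T)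
    (t := fun _ => F) (fun _ _ => hF)
  rw [← map_takeBlock hZ, MeasureTheory.Measure.map_apply
    (measurable_pi_lambda _ fun r => measurable_takeBlock Z r)
    (.pi T.countable_toSet fun _ _ => hF)] at h
  rw [Finset.prod_const] at h
  exact h

/-- Union bound over the sets of `k` failing repetitions, whose number is a binomial coefficient and
hence at most `2 ^ R`. -/
theorem coinMeasure_many_takeBlock_le {Z : ℕ} (hZ : 0 < Z) (F : Set (Fin Z → Bool)) (R k : ℕ) :
    coinMeasure {ρ | ∃ T ∈ (Finset.range R).powersetCard k, ∀ r ∈ T, takeBlock Z r ρ ∈ F} ≤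
      2 ^ R * coinBlock Z F ^ k := by
  have : {ρ | ∃ T ∈ (Finset.range R).powersetCard k, ∀ r ∈ T, takeBlock Z r ρ ∈ F} =
      ⋃ T ∈ (Finset.range R).powersetCard k, {ρ | ∀ r ∈ T, takeBlock Z r ρ ∈ F} := by
    ext; simp
  rw [this]
  refine (MeasureTheory.measure_biUnion_finset_le _ _).trans ?_
  rw [Finset.sum_congr rfl fun T hT => by
    rw [coinMeasure_forall_takeBlock hZ F T, (Finset.mem_powersetCard.1 hT).2]]
  rw [Finset.sum_const, Finset.card_powersetCard, Finset.card_range, nsmul_eq_mul]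
  gcongr
  exact_mod_cast Nat.choose_le_two_pow R k

/-- Probability amplification by independent repetition: if each event `S j` depends on the first
`Z` coins only and has probability at least `1 - δ`, then in most of `2 * h + 1` independent
repetitions all the events occur, with an exponentially small error. -/
theorem coinMeasure_majority {α : Type*} (J : Finset α) (S : α → Set (ℕ → Bool)) {Z : ℕ}
    (hZ : 0 < Z)
    (hS : ∀ j ∈ J, ∀ ρ ρ' : ℕ → Bool, (∀ y < Z, ρ y = ρ' y) → ρ ∈ S j → ρ' ∈ S j) {δ : ℝ}
    (hδ : ∀ j ∈ J, 1 - δ ≤ coinMeasure.real (S j)) (h : ℕ) (G : Set (ℕ → Bool))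
    (hG : ∀ ρ, (∀ j ∈ J, ∃ T ⊆ Finset.range (2 * h + 1), h + 1 ≤ T.card ∧
      ∀ r ∈ T, (fun y => ρ (r * Z + y)) ∈ S j) → ρ ∈ G) :
    1 - J.card * (2 ^ (2 * h + 1) * δ ^ (h + 1)) ≤ coinMeasure.real G := by
  classical
  -- The event that a block of coins makes `S j` fail. The value `false` beyond the block is
  -- arbitrary, since `S j` depends on the first `Z` coins only.
  let F : α → Set (Fin Z → Bool) := fun j =>
    {z | (fun y => if hy : y < Z then z ⟨y, hy⟩ else false) ∉ S j}
  have hmem : ∀ j ∈ J, ∀ (r : ℕ) (ρ : ℕ → Bool),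
      takeBlock Z r ρ ∉ F j → (fun y => ρ (r * Z + y)) ∈ S j := by
    intro j hj r ρ hr
    simp only [F, Set.mem_ofPred_eq, not_not] at hr
    refine hS j hj _ _ (fun y hy => ?_) hr
    simp [hy, takeBlock]
  have hP : ∀ j ∈ J, (coinBlock Z).real (F j) ≤ δ := by
    intro j hj
    have h1 := coinMeasure_forall_takeBlock hZ (F j) {0}
    simp only [Finset.mem_singleton, forall_eq, Finset.card_singleton, pow_one] at h1
    have h2 : {ρ | takeBlock Z 0 ρ ∈ F j} = (S j)ᶜ := by
      ext ρ
      constructor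
      · intro h3 h4
        refine h3 (hS j hj _ _ (fun y hy => ?_) h4)
        simp [hy, takeBlock]
      · intro h3
        by_contra h4
        exact h3 (by simpa using hmem j hj 0 ρ h4)
    -- Measurability of `S j` is not assumed: it follows from the dependence on finitely many coins.
    have hm : MeasurableSet (S j) := by
      rw [← MeasurableSet.compl_iff, ← h2]
      exact measurable_takeBlock Z 0 (Set.toFinite (F j)).measurableSet
    have h3 : (coinBlock Z).real (F j) = coinMeasure.real (S j)ᶜ := by
      rw [MeasureTheory.measureReal_def, MeasureTheory.measureReal_def, ← h1, h2]
    rw [h3, MeasureTheory.probReal_compl_eq_one_sub hm]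
    linarith [hδ j hj]
  -- If no `h + 1` of the `2 * h + 1` repetitions fail, then at least `h + 1` of them succeed.
  let bad : α → Set (ℕ → Bool) := fun j =>
    {ρ | ∃ T ∈ (Finset.range (2 * h + 1)).powersetCard (h + 1), ∀ r ∈ T, takeBlock Z r ρ ∈ F j}
  have hbadm : ∀ j, MeasurableSet (bad j) := by
    intro j
    have : bad j = ⋃ T ∈ (Finset.range (2 * h + 1)).powersetCard (h + 1),
        ⋂ r ∈ T, takeBlock Z r ⁻¹' F j := by
      ext; simp [bad]
    rw [this]
    exact Finset.measurableSet_biUnion _ fun T _ => Finset.measurableSet_biInter _ fun r _ =>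
      measurable_takeBlock Z r (Set.toFinite (F j)).measurableSet
  have hbad : ∀ j ∈ J, coinMeasure.real (bad j) ≤ 2 ^ (2 * h + 1) * δ ^ (h + 1) := by
    intro j hj
    have h1 := coinMeasure_many_takeBlock_le hZ (F j) (2 * h + 1) (h + 1)
    have h2 : coinMeasure.real (bad j) ≤ 2 ^ (2 * h + 1) * (coinBlock Z).real (F j) ^ (h + 1) := by
      have := ENNReal.toReal_mono (by finiteness) h1
      simpa only [MeasureTheory.measureReal_def, ENNReal.toReal_mul, ENNReal.toReal_pow,
        ENNReal.toReal_ofNat] using this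
    refine h2.trans ?_
    gcongr
    exact hP j hj
  have hsub : (⋃ j ∈ J, bad j)ᶜ ⊆ G := by
    intro ρ hρ
    refine hG ρ fun j hj => ?_
    refine ⟨(Finset.range (2 * h + 1)).filter fun r => takeBlock Z r ρ ∉ F j,
      Finset.filter_subset _ _, ?_, fun r hr => hmem j hj r ρ (Finset.mem_filter.1 hr).2⟩
    by_contra hc
    have h1 := Finset.card_filter_add_card_filter_not (s := Finset.range (2 * h + 1))
      (fun r => takeBlock Z r ρ ∈ F j)
    rw [Finset.card_range] at h1
    obtain ⟨T, hT, hTc⟩ := Finset.exists_subset_card_eq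
      (s := (Finset.range (2 * h + 1)).filter fun r => takeBlock Z r ρ ∈ F j) (n := h + 1)
      (by omega)
    refine hρ (Set.mem_iUnion₂.2 ⟨j, hj, T, Finset.mem_powersetCard.2
      ⟨hT.trans (Finset.filter_subset _ _), hTc⟩, fun r hr => (Finset.mem_filter.1 (hT hr)).2⟩)
  have hU : coinMeasure.real (⋃ j ∈ J, bad j) ≤ J.card * (2 ^ (2 * h + 1) * δ ^ (h + 1)) := by
    refine (MeasureTheory.measureReal_biUnion_finset_le _ _).trans ?_
    refine (Finset.sum_le_sum hbad).trans ?_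
    rw [Finset.sum_const, nsmul_eq_mul]
  calc 1 - J.card * (2 ^ (2 * h + 1) * δ ^ (h + 1)) ≤ 1 - coinMeasure.real (⋃ j ∈ J, bad j) := by
        linarith
    _ = coinMeasure.real (⋃ j ∈ J, bad j)ᶜ := by
        rw [MeasureTheory.probReal_compl_eq_one_sub
          (Finset.measurableSet_biUnion _ fun j _ => hbadm j)]
    _ ≤ coinMeasure.real G := MeasureTheory.measureReal_mono hsub


/-! ### The banded dynamic program -/

theorem EditAlignment.length_le {k : ℕ} {u v : List ℕ} (h : EditAlignment k u v) :
    u.length ≤ v.length + k ∧ v.length ≤ u.length + k := by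
  have := h.editDist_le
  have := length_le_add_editDist u v
  omega

theorem append_singleton_eq_take {A u : List ℕ} {a i : ℕ} (hi : i ≤ A.length)
    (h : u ++ [a] = A.take i) : ∃ i', i = i' + 1 ∧ u = A.take i' ∧ A.getD i' 0 = a := by
  cases i with
  | zero => simp at h
  | succ i =>
    rw [List.take_add_one, List.getElem?_eq_getElem (by omega)] at h
    obtain ⟨h1, h2⟩ := List.append_inj' h (by simp)
    refine ⟨i, rfl, h1, ?_⟩
    rw [List.getD_eq_getElem _ _ (by omega)]
    simpa using h2.symm

theorem take_succ_eq_append_getD {A : List ℕ} {i : ℕ} (hi : i < A.length) :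
    A.take (i + 1) = A.take i ++ [A.getD i 0] := by
  rw [List.take_add_one, List.getElem?_eq_getElem hi, List.getD_eq_getElem _ _ hi]
  rfl

section
variable {A B : List ℕ} {k inf : ℕ} {G : ℕ → ℕ}

/-- The recurrences of the table of edit distances of prefixes in a band of width `2 * k + 1`, with
one more column of large values; the cell `(i, o)` belongs to the prefixes of lengths `i` and
`i + o - k`. -/
structure BandTable (A B : List ℕ) (k inf : ℕ) (G : ℕ → ℕ) : Prop where
  init : ∀ o < 2 * k + 2, G o = min inf ((k - o) * inf + (o - k) + inf * (o / (2 * k + 1)))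
  step : ∀ i < A.length, ∀ o < 2 * k + 2, G ((i + 1) * (2 * k + 2) + o) = min inf (max
    (inf * (o / (2 * k + 1))) (min
      (G (i * (2 * k + 2) + o) +
        if strArray A (i + 1) = strArray B (i + 1 + o - k) then 0 else 1)
      (min (G (i * (2 * k + 2) + o + 1) + 1) (G ((i + 1) * (2 * k + 2) + o - 1) + 1))))

/-- Every candidate in the recurrence extends a conversion of shorter prefixes by one operation, so
no entry is too small. The cells that stand for no prefix, including the additional column, hold at
least `inf` and cannot contribute; the cap explains the minimum with `inf`. -/
theorem BandTable.sound (hG : BandTable A B k inf G) : ∀ i ≤ A.length, ∀ o < 2 * k + 2,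
    (o = 2 * k + 1 ∨ i + o < k → inf ≤ G (i * (2 * k + 2) + o)) ∧
    (∀ j ≤ B.length, i + o = j + k →
      min inf (editDist (A.take i) (B.take j)) ≤ G (i * (2 * k + 2) + o)) := by
  intro i
  induction i with
  | zero =>
    intro _ o ho
    rw [zero_mul, zero_add, hG.init o ho]
    refine ⟨fun h => ?_, fun j hj hjo => ?_⟩
    · refine le_min le_rfl ?_
      rcases h with h | h
      · rw [h, Nat.div_self (by omega)]; omega
      · have : inf * 1 ≤ (k - o) * inf := by rw [mul_comm]; exact Nat.mul_le_mul (by omega) le_rfl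
        omega
    · refine min_le_min le_rfl ?_
      have h1 : editDist (A.take 0) (B.take j) ≤ j := by
        have := editDist_nil_left_le (B.take j)
        simp only [List.take_zero, List.length_take] at *
        omega
      omega
  | succ i ih =>
    intro hi o
    have hiA : i < A.length := hi
    have hrow := ih (by omega)
    have hlast : inf ≤ G (i * (2 * k + 2) + (2 * k + 1)) :=
      (hrow (2 * k + 1) (by omega)).1 (.inl rfl)
    induction o with
    | zero =>
      intro ho
      rw [hG.step i hiA 0 ho]
      -- In memory, the cell before the start of a row is the last cell of the previous row; the
      -- additional column shields the recurrence from it.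
      have hz : G ((i + 1) * (2 * k + 2) + 0 - 1) = G (i * (2 * k + 2) + (2 * k + 1)) := by
        congr 1; rw [add_mul]; omega
      rw [hz]
      refine ⟨fun h => ?_, fun j hj hjo => ?_⟩
      · have h0 := (hrow 0 (by omega)).1 (.inr (by omega))
        have h1 := (hrow 1 (by omega)).1 (by omega)
        rw [add_zero] at *
        omega
      · refine le_min (min_le_left _ _) (le_max_of_le_right (le_min ?_ (le_min ?_ ?_)))
        · cases j with
          | zero =>
            have h0 := (hrow 0 (by omega)).1 (.inr (by omega))
            rw [add_zero] at *
            omega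
          | succ j =>
            have h0 := (hrow 0 (by omega)).2 j (by omega) (by omega)
            have h1 := editDist_append_le (A.take i) [A.getD i 0] (B.take j) [B.getD j 0]
            rw [← take_succ_eq_append_getD hiA, ← take_succ_eq_append_getD (by omega)] at h1
            have h2 : editDist [A.getD i 0] [B.getD j 0] ≤
                if strArray A (i + 1) = strArray B (j + 1) then 0 else 1 :=
              editDist_singleton_le _ _
            rw [show i + 1 + 0 - k = j + 1 by omega]
            omega
        · have h0 := (hrow 1 (by omega)).2 j (by omega) (by omega)
          have h1 := editDist_append_le (A.take i) [A.getD i 0] (B.take j) []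
          rw [← take_succ_eq_append_getD hiA, List.append_nil] at h1
          have h2 := editDist_nil_right_le [A.getD i 0]
          simp only [List.length_singleton] at h2
          rw [add_zero]
          omega
        · omega
    | succ o iho =>
      intro ho
      have iho := iho (by omega)
      rw [hG.step i hiA (o + 1) ho]
      have hz : G ((i + 1) * (2 * k + 2) + (o + 1) - 1) = G ((i + 1) * (2 * k + 2) + o) := rfl
      rw [hz]
      by_cases hs : o + 1 = 2 * k + 1
      · rw [hs, Nat.div_self (by omega)]
        exact ⟨fun _ => by omega, fun j _ _ => by omega⟩
      refine ⟨fun h => ?_, fun j hj hjo => ?_⟩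
      · have h0 := (hrow (o + 1) (by omega)).1 (.inr (by omega))
        have h1 := (hrow (o + 1 + 1) (by omega)).1 (by omega)
        have h2 := iho.1 (by omega)
        rw [← add_assoc] at h1
        omega
      · refine le_min (min_le_left _ _) (le_max_of_le_right (le_min ?_ (le_min ?_ ?_)))
        · cases j with
          | zero =>
            have h0 := (hrow (o + 1) (by omega)).1 (.inr (by omega))
            omega
          | succ j =>
            have h0 := (hrow (o + 1) (by omega)).2 j (by omega) (by omega)
            have h1 := editDist_append_le (A.take i) [A.getD i 0] (B.take j) [B.getD j 0]
            rw [← take_succ_eq_append_getD hiA, ← take_succ_eq_append_getD (by omega)] at h1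
            have h2 : editDist [A.getD i 0] [B.getD j 0] ≤
                if strArray A (i + 1) = strArray B (j + 1) then 0 else 1 :=
              editDist_singleton_le _ _
            rw [show i + 1 + (o + 1) - k = j + 1 by omega]
            omega
        · have h0 := (hrow (o + 1 + 1) (by omega)).2 j (by omega) (by omega)
          have h1 := editDist_append_le (A.take i) [A.getD i 0] (B.take j) []
          rw [← take_succ_eq_append_getD hiA, List.append_nil] at h1
          have h2 := editDist_nil_right_le [A.getD i 0]
          simp only [List.length_singleton] at h2
          rw [← add_assoc] at h0
          omega
        · cases j with
          | zero =>
            have h0 := iho.1 (.inr (by omega))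
            omega
          | succ j =>
            have h0 := iho.2 j (by omega) (by omega)
            have h1 := editDist_append_le (A.take (i + 1)) [] (B.take j) [B.getD j 0]
            rw [← take_succ_eq_append_getD (by omega), List.append_nil] at h1
            have h2 := editDist_nil_left_le [B.getD j 0]
            simp only [List.length_singleton] at h2
            omega

/-- All prefixes of an alignment of cost at most `k` have lengths that differ by at most `k`. So the
alignment never leaves the band, and its last column matches one of the candidates in the
recurrence. -/
theorem BandTable.complete (hG : BandTable A B k inf G) {c : ℕ} {u v : List ℕ}
    (h : EditAlignment c u v) : ∀ i j o, i ≤ A.length → j ≤ B.length → u = A.take i →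
      v = B.take j → c ≤ k → i + o = j + k → G (i * (2 * k + 2) + o) ≤ c := by
  have row0 : ∀ {c : ℕ} {u v : List ℕ}, EditAlignment c u v → ∀ j o, j ≤ B.length → u = A.take 0 →
      v = B.take j → c ≤ k → 0 + o = j + k → G (0 * (2 * k + 2) + o) ≤ c := by
    intro c u v h j o hj hu hv hc ho
    have hl := h.length_le
    subst hu hv
    simp only [List.take_zero, List.length_nil, List.length_take] at hl
    rw [zero_mul, zero_add, hG.init o (by omega), Nat.div_eq_of_lt (by omega),
      Nat.sub_eq_zero_of_le (by omega : k ≤ o)]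
    omega
  have step : ∀ i o, i < A.length → o < 2 * k + 1 → G ((i + 1) * (2 * k + 2) + o) ≤ (min
      (G (i * (2 * k + 2) + o) +
        if strArray A (i + 1) = strArray B (i + 1 + o - k) then 0 else 1)
      (min (G (i * (2 * k + 2) + o + 1) + 1) (G ((i + 1) * (2 * k + 2) + o - 1) + 1))) := by
    intro i o hi ho
    rw [hG.step i hi o (by omega), Nat.div_eq_of_lt (by omega), mul_zero, Nat.zero_max]
    exact min_le_right _ _
  induction h with
  | nil =>
    intro i j o hi hj hu hv hc ho
    have hi0 : i = 0 := by
      have := congrArg List.length hu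
      simp only [List.length_nil, List.length_take] at this
      omega
    subst hi0
    exact row0 .nil j o hj hu hv hc ho
  | @ins c u v b h ih =>
    intro i j o hi hj hu hv hc ho
    obtain ⟨j', rfl, hv', _⟩ := append_singleton_eq_take hj hv
    cases i with
    | zero => exact row0 (h.ins b) _ _ hj hu hv hc ho
    | succ i =>
      have hl := h.length_le
      -- The bound on the difference of lengths shows that the predecessor lies inside the band.
      rw [hu, hv'] at hl
      simp only [List.length_take] at hl
      have := ih (i + 1) j' (o - 1) hi (by omega) hu hv' (by omega) (by omega)
      refine (step i o hi (by omega)).trans ?_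
      rw [show (i + 1) * (2 * k + 2) + o - 1 = (i + 1) * (2 * k + 2) + (o - 1) by omega]
      omega
  | @del c u v a h ih =>
    intro i j o hi hj hu hv hc ho
    obtain ⟨i', rfl, hu', _⟩ := append_singleton_eq_take hi hu
    have hl := h.length_le
    rw [hu', hv] at hl
    simp only [List.length_take] at hl
    have := ih i' j (o + 1) (by omega) (by omega) hu' hv (by omega) (by omega)
    refine (step i' o hi (by omega)).trans ?_
    rw [add_assoc (i' * (2 * k + 2)) o 1]
    omega
  | @sub c u v a b h ih =>
    intro i j o hi hj hu hv hc ho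
    obtain ⟨i', rfl, hu', ha⟩ := append_singleton_eq_take hi hu
    obtain ⟨j', rfl, hv', hb⟩ := append_singleton_eq_take hj hv
    have hl := h.length_le
    rw [hu', hv'] at hl
    simp only [List.length_take] at hl
    have := ih i' j' o (by omega) (by omega) hu' hv' (by omega) (by omega)
    refine (step i' o hi (by omega)).trans ?_
    rw [show i' + 1 + o - k = j' + 1 by omega]
    simp only [strArray, ha, hb]
    omega

/-- The value of the band table at the end of both strings, or a large value if the end is outside
of the band. -/
def bandValue (A B : List ℕ) (k inf : ℕ) (G : ℕ → ℕ) : ℕ :=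
  G (A.length * (2 * k + 2) + min (2 * k + 1) (B.length + k - A.length)) +
    inf * (A.length - (B.length + k))

/-- If the distance is at most `k`, completeness bounds the value from above. Conversely, since `k <
inf`, a value up to `k` cannot stem from the cap or from a penalty, so soundness applies without the
cap. -/
theorem BandTable.bandValue_spec (hG : BandTable A B k inf G) (hinf : k < inf) :
    (bandValue A B k inf G ≤ k → bandValue A B k inf G = editDist A B) ∧
    (k < bandValue A B k inf G → k < editDist A B) := by
  have hlen := length_le_add_editDist A B
  have upper : editDist A B ≤ k → bandValue A B k inf G ≤ editDist A B := by
    intro h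
    obtain ⟨j, hj, hal⟩ := (editPath_editDist A B).exists_alignment
    have := hG.complete hal A.length B.length (B.length + k - A.length) le_rfl le_rfl (by simp)
      (by simp) (by omega) (by omega)
    rw [bandValue, Nat.min_eq_right (by omega), show A.length - (B.length + k) = 0 by omega]
    omega
  refine ⟨fun h => ?_, fun h => by_contra fun hc => by have := upper (by omega); omega⟩
  have h1 : A.length ≤ B.length + k := by
    by_contra hc
    have : inf * 1 ≤ inf * (A.length - (B.length + k)) := Nat.mul_le_mul le_rfl (by omega)
    rw [bandValue] at h
    omega
  have hs := hG.sound A.length le_rfl (min (2 * k + 1) (B.length + k - A.length)) (by omega)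
  have hval : bandValue A B k inf G =
      G (A.length * (2 * k + 2) + min (2 * k + 1) (B.length + k - A.length)) := by
    rw [bandValue, show A.length - (B.length + k) = 0 by omega]
    omega
  rw [hval] at h upper ⊢
  -- Otherwise `B` is too long for the band and the value read is the sentinel in the additional
  -- column.
  have h2 : ¬ 2 * k + 1 ≤ B.length + k - A.length := by
    intro hc
    have := hs.1 (.inl (by omega))
    omega
  have h3 := hs.2 B.length le_rfl (by omega)
  rw [List.take_length, List.take_length] at h3
  have h4 : editDist A B ≤ k := by omega
  have := upper h4
  omega

end

/-! ### The dynamic program over blocks and windows -/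

/-- The `i`-th block of length `d`. -/
def block (A : List ℕ) (d i : ℕ) : List ℕ := (A.drop (i * d)).take d

/-- The window of `l` cells of the grid of width `g` from the `j`-th grid point on. -/
def window (B : List ℕ) (g j l : ℕ) : List ℕ := (B.drop (j * g)).take (l * g)

/-- The recurrences of the dynamic program: `D i j lam` bounds the edit distance of the first `i`
blocks and the first `j` cells of the grid; the last argument runs over the lengths of the last
window. -/
structure BlockTable (med : ℕ → ℕ → ℕ → ℕ) (g inf N M lam : ℕ) (D : ℕ → ℕ → ℕ → ℕ) : Prop where
  init : ∀ j ≤ M, ∀ l ≤ lam, D 0 j l = j * g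
  step : ∀ i < N, ∀ j ≤ M, ∀ l < lam, D (i + 1) j (l + 1) = min inf (min (D (i + 1) j l)
    (D i (j - (l + 1)) lam + med i (j - (l + 1)) (l + 1) + inf * (l + 1 - j)))
  gap : ∀ i < N, ∀ j < M, D (i + 1) (j + 1) 0 = min inf (min (D (i + 1) j lam + g)
    (D i (j + 1) lam + med i (j + 1) 0))
  zero : ∀ i < N, D (i + 1) 0 0 = min inf (D i 0 lam + med i 0 0)

section
variable {A B : List ℕ} {med : ℕ → ℕ → ℕ → ℕ} {d g inf N M lam : ℕ} {D : ℕ → ℕ → ℕ → ℕ}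

theorem take_add_block (A : List ℕ) (d i : ℕ) :
    A.take ((i + 1) * d) = A.take (i * d) ++ block A d i := by
  rw [add_mul, one_mul, List.take_add, block]

theorem take_add_window (B : List ℕ) (g j l : ℕ) :
    B.take ((j + l) * g) = B.take (j * g) ++ window B g j l := by
  rw [add_mul, List.take_add, window]

/-- Each candidate either contains the penalty `inf`, which replaces windows that would start before
the string, or extends a conversion of prefixes by a block with a window or by the insertion of one
grid cell. -/
theorem BlockTable.sound (hD : BlockTable med g inf N M lam D)
    (hmed : ∀ i < N, ∀ j ≤ M, ∀ l ≤ lam, editDist (block A d i) (window B g j l) ≤ med i j l) :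
    ∀ i ≤ N, ∀ j ≤ M, ∀ l ≤ lam,
      min inf (editDist (A.take (i * d)) (B.take (j * g))) ≤ D i j l := by
  intro i
  induction i with
  | zero =>
    intro _ j hj l hl
    rw [hD.init j hj l hl, zero_mul, List.take_zero]
    have := editDist_nil_left_le (B.take (j * g))
    rw [List.length_take] at this
    omega
  | succ i ih =>
    intro hi
    have ih := ih (by omega)
    have win : ∀ j l, j + l ≤ M → l ≤ lam →
        min inf (editDist (A.take ((i + 1) * d)) (B.take ((j + l) * g))) ≤ D i j lam + med i j l := by
      intro j l hj hl
      have h1 := ih j (by omega) lam le_rfl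
      have h2 := hmed i hi j (by omega) l hl
      rw [take_add_block, take_add_window]
      have h3 := editDist_append_le (A.take (i * d)) (block A d i) (B.take (j * g)) (window B g j l)
      omega
    intro j
    induction j with
    | zero =>
      intro hj l
      induction l with
      | zero =>
        intro hl
        rw [hD.zero i hi]
        exact le_min (min_le_left _ _) (win 0 0 hj hl)
      | succ l ihl =>
        intro hl
        rw [hD.step i hi 0 hj l hl]
        refine le_min (min_le_left _ _) (le_min (ihl (by omega)) ?_)
        have : inf * 1 ≤ inf * (l + 1 - 0) := Nat.mul_le_mul le_rfl (by omega)
        omega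
    | succ j ihj =>
      intro hj l
      induction l with
      | zero =>
        intro hl
        rw [hD.gap i hi j hj]
        refine le_min (min_le_left _ _) (le_min ?_ (win (j + 1) 0 hj hl))
        have h1 := ihj (by omega) lam le_rfl
        rw [take_add_window B g j 1]
        have h2 := editDist_append_le (A.take ((i + 1) * d)) [] (B.take (j * g)) (window B g j 1)
        have h3 := editDist_nil_left_le (window B g j 1)
        have h4 : (window B g j 1).length ≤ g := by
          rw [window, List.length_take]; omega
        rw [List.append_nil] at h2
        omega
      | succ l ihl =>
        intro hl
        rw [hD.step i hi (j + 1) hj l hl]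
        refine le_min (min_le_left _ _) (le_min (ihl (by omega)) ?_)
        by_cases hlj : l + 1 ≤ j + 1
        · have := win (j + 1 - (l + 1)) (l + 1) (by omega) hl
          rw [show j + 1 - (l + 1) + (l + 1) = j + 1 by omega] at this
          omega
        · have : inf * 1 ≤ inf * (l + 1 - (j + 1)) := Nat.mul_le_mul le_rfl (by omega)
          omega

/-- The last index runs through a minimum over window lengths one by one, so the entry at `lam` is
the full minimum. -/
theorem BlockTable.anti (hD : BlockTable med g inf N M lam D) {i j l l' : ℕ} (hi : i < N)
    (hj : j ≤ M) (hl : l ≤ l') (hl' : l' ≤ lam) : D (i + 1) j l' ≤ D (i + 1) j l := by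
  induction l', hl using Nat.le_induction with
  | base => exact le_rfl
  | succ l' hl ih =>
    refine le_trans ?_ (ih (by omega))
    rw [hD.step i hi j hj l' hl']
    omega

theorem BlockTable.le_window (hD : BlockTable med g inf N M lam D) {i j l : ℕ} (hi : i < N)
    (hj : j + l ≤ M) (hl : l ≤ lam) : D (i + 1) (j + l) lam ≤ D i j lam + med i j l := by
  refine (hD.anti hi hj hl le_rfl).trans ?_
  cases l with
  | zero =>
    cases j with
    | zero => rw [hD.zero i hi]; exact min_le_right _ _
    | succ j => rw [add_zero, hD.gap i hi j hj]; omega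
  | succ l =>
    rw [hD.step i hi _ hj l hl, show j + (l + 1) - (l + 1) = j by omega,
      show l + 1 - (j + (l + 1)) = 0 by omega]
    omega

theorem BlockTable.le_gaps (hD : BlockTable med g inf N M lam D) {i j l : ℕ} (hi : i < N)
    (hj : j + l ≤ M) : D (i + 1) (j + l) lam ≤ D (i + 1) j lam + l * g := by
  induction l with
  | zero => simp
  | succ l ih =>
    have h1 := ih (by omega)
    have h2 := hD.anti hi hj (Nat.zero_le lam) le_rfl
    rw [← add_assoc] at h2 ⊢
    rw [hD.gap i hi (j + l) hj] at h2
    rw [add_mul]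
    omega

/-- Both ends are rounded up to the grid. Passing through the substring from `p₁` to `q * g`, at
most `g` symbols are appended on the right and at most `g` are removed on the left. -/
theorem editDist_window_le (B : List ℕ) {g p₁ p q₁ q : ℕ} (hp : p₁ ≤ p) (h₁ : p₁ ≤ q₁ * g)
    (h₁' : q₁ * g ≤ p₁ + g) (h : p ≤ q * g) (h' : q * g ≤ p + g) (hq : q₁ ≤ q) :
    editDist ((B.drop p₁).take (p - p₁)) (window B g q₁ (q - q₁)) ≤ 2 * g := by
  have hqg : q₁ * g ≤ q * g := Nat.mul_le_mul hq le_rfl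
  have e₁ : (B.drop p₁).take (q * g - p₁) =
      (B.drop p₁).take (p - p₁) ++ (B.drop p).take (q * g - p) := by
    rw [show q * g - p₁ = (p - p₁) + (q * g - p) by omega, List.take_add, List.drop_drop,
      show p₁ + (p - p₁) = p by omega]
  have e₂ : (B.drop p₁).take (q * g - p₁) =
      (B.drop p₁).take (q₁ * g - p₁) ++ window B g q₁ (q - q₁) := by
    rw [show q * g - p₁ = (q₁ * g - p₁) + (q * g - q₁ * g) by omega, List.take_add, List.drop_drop,
      show p₁ + (q₁ * g - p₁) = q₁ * g by omega, window, Nat.sub_mul]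
  have h1 := editDist_triangle ((B.drop p₁).take (p - p₁)) ((B.drop p₁).take (q * g - p₁))
    (window B g q₁ (q - q₁))
  have h2 : editDist ((B.drop p₁).take (p - p₁)) ((B.drop p₁).take (q * g - p₁)) ≤ g := by
    rw [e₁]
    have := editDist_append_le ((B.drop p₁).take (p - p₁)) [] ((B.drop p₁).take (p - p₁))
      ((B.drop p).take (q * g - p))
    have h3 := editDist_nil_left_le ((B.drop p).take (q * g - p))
    rw [List.append_nil, editDist_self] at this
    rw [List.length_take] at h3
    omega
  have h3 : editDist ((B.drop p₁).take (q * g - p₁)) (window B g q₁ (q - q₁)) ≤ g := by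
    rw [e₂]
    have := editDist_append_le ((B.drop p₁).take (q₁ * g - p₁)) (window B g q₁ (q - q₁)) []
      (window B g q₁ (q - q₁))
    have h4 := editDist_nil_right_le ((B.drop p₁).take (q₁ * g - p₁))
    rw [List.nil_append, editDist_self] at this
    rw [List.length_take] at h4
    omega
  omega

theorem ceil_mul_bounds {g p : ℕ} (hg : 0 < g) :
    p ≤ (p + g - 1) / g * g ∧ (p + g - 1) / g * g ≤ p + g := by
  have h1 := Nat.div_add_mod' (p + g - 1) g
  have h2 := Nat.mod_lt (p + g - 1) hg
  omega

/-- Induction over the blocks along an optimal conversion that is cut at the block boundaries, with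
the cuts of `B` rounded up to the grid. The term with `i + 1` pays for the rounding. The last term
is a potential that grows by `(1 + α) * (d / lam)` with every grid cell, so a piece of more than
`lam` cells has earned the `(1 + α) * d` for deleting and inserting. -/
theorem BlockTable.complete (hD : BlockTable med g inf N M lam D) {α : ℝ} (hα : 1 ≤ α)
    (hg : 0 < g) (hlam : 0 < lam) (hM : (B.length + g - 1) / g = M)
    (hmed : ∀ i < N, ∀ j ≤ M, ∀ l ≤ lam,
      (med i j l : ℝ) ≤ α * editDist (block A d i) (window B g j l)) :
    ∀ i ≤ N, ∀ p ≤ B.length, (D i ((p + g - 1) / g) lam : ℝ) ≤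
      α * editDist (A.take (i * d)) (B.take p) + (i + 1) * (2 * α * g) +
        (1 + α) * (d / lam) * ((p + g - 1) / g : ℕ) := by
  intro i
  induction i with
  | zero =>
    intro _ p hp
    have hq := ceil_mul_bounds (p := p) hg
    set q := (p + g - 1) / g with hqd
    have hqM : q ≤ M := hM ▸ Nat.div_le_div_right (by omega)
    rw [hD.init q hqM lam le_rfl, zero_mul, List.take_zero]
    have h1 := (length_le_add_editDist [] (B.take p)).2
    rw [List.length_take, List.length_nil, Nat.min_eq_left hp] at h1
    have h2 : q * g ≤ editDist [] (B.take p) + g := by omega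
    have h3 : ((q * g : ℕ) : ℝ) ≤ editDist [] (B.take p) + g := by exact_mod_cast h2
    have h4 : (0 : ℝ) ≤ (1 + α) * (d / lam) * q := by positivity
    have h5 : (editDist [] (B.take p) : ℝ) ≤ α * editDist [] (B.take p) :=
      le_mul_of_one_le_left (by positivity) hα
    have h6 : (g : ℝ) ≤ α * g := le_mul_of_one_le_left (by positivity) hα
    push_cast at *
    nlinarith
  | succ i ih =>
    intro hi p hp
    have ih := ih (by omega)
    -- The optimal partner of block `i` is the part of `B` between `p₁` and `p`.
    obtain ⟨c, c', hcc, hle⟩ := exists_editDist_split (A.take (i * d)) (block A d i) (B.take p)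
    rw [← take_add_block] at hle
    obtain ⟨p₁, hp₁, rfl, rfl⟩ : ∃ p₁ ≤ p, c = B.take p₁ ∧ c' = (B.drop p₁).take (p - p₁) := by
      have hlen := congrArg List.length hcc
      rw [List.length_take, List.length_append] at hlen
      refine ⟨c.length, by omega, ?_, ?_⟩
      · have := congrArg (List.take c.length) hcc
        rw [List.take_take, List.take_left' rfl, Nat.min_eq_left (by omega)] at this
        exact this.symm
      · have := congrArg (List.drop c.length) hcc
        rw [List.drop_take, List.drop_left' rfl] at this
        exact this.symm
    have ih := ih p₁ (by omega)
    have hq := ceil_mul_bounds (p := p) hg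
    have hq₁ := ceil_mul_bounds (p := p₁) hg
    have hqq : (p₁ + g - 1) / g ≤ (p + g - 1) / g := Nat.div_le_div_right (by omega)
    have hqM : (p + g - 1) / g ≤ M := hM ▸ Nat.div_le_div_right (by omega)
    set q := (p + g - 1) / g with hqd
    set q₁ := (p₁ + g - 1) / g with hq₁d
    have hle' : (editDist (A.take (i * d)) (B.take p₁) : ℝ) +
        editDist (block A d i) ((B.drop p₁).take (p - p₁)) ≤
        editDist (A.take ((i + 1) * d)) (B.take p) := by exact_mod_cast hle
    have hlamR : (0 : ℝ) < lam := by exact_mod_cast hlam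
    have hqqR : (q₁ : ℝ) ≤ q := by exact_mod_cast hqq
    have hfac : (0 : ℝ) ≤ (1 + α) * (d / lam) := by positivity
    have hmulle := mul_le_mul_of_nonneg_left hle' (by linarith : (0 : ℝ) ≤ α)
    have hgα : (g : ℝ) ≤ α * g := le_mul_of_one_le_left (by positivity) hα
    -- A short partner is replaced by the window between the rounded ends, which changes the
    -- distance by at most `2 * g`.
    by_cases hl : q - q₁ ≤ lam
    · have h1 := hD.le_window (j := q₁) (l := q - q₁) hi (by omega) hl
      rw [show q₁ + (q - q₁) = q by omega] at h1
      have h2 := hmed i hi q₁ (by omega) (q - q₁) hl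
      have h3 := editDist_triangle (block A d i) ((B.drop p₁).take (p - p₁)) (window B g q₁ (q - q₁))
      have h4 := editDist_window_le B hp₁ hq₁.1 hq₁.2 hq.1 hq.2 hqq
      have h5 : (editDist (block A d i) (window B g q₁ (q - q₁)) : ℝ) ≤
          editDist (block A d i) ((B.drop p₁).take (p - p₁)) + 2 * g := by
        exact_mod_cast h3.trans (by omega)
      have h6 := mul_le_mul_of_nonneg_left h5 (by linarith : (0 : ℝ) ≤ α)
      have h7 : (D (i + 1) q lam : ℝ) ≤ D i q₁ lam + med i q₁ (q - q₁) := by exact_mod_cast h1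
      have h8 := mul_le_mul_of_nonneg_left hqqR hfac
      push_cast
      nlinarith
    -- A long partner: the block is matched with the empty window and the cells in between are
    -- inserted as gaps.
    · have h1 := hD.le_window (j := q₁) (l := 0) hi (by omega) (Nat.zero_le _)
      have h2 := hD.le_gaps (i := i) (j := q₁) (l := q - q₁) hi (by omega)
      rw [show q₁ + (q - q₁) = q by omega] at h2
      rw [add_zero] at h1
      have h3 := hmed i hi q₁ (by omega) 0 (Nat.zero_le _)
      have h4 : editDist (block A d i) (window B g q₁ 0) ≤ d := by
        have := editDist_nil_right_le (block A d i)
        rw [window, zero_mul, List.take_zero]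
        rw [block, List.length_take] at *
        omega
      have h5 := (length_le_add_editDist (block A d i) ((B.drop p₁).take (p - p₁))).2
      have h6 : (block A d i).length ≤ d := by rw [block, List.length_take]; omega
      rw [List.length_take, List.length_drop] at h5
      -- The partner is longer than the block by at most their distance; rounding adds at most `g`.
      have h7 : (q - q₁) * g ≤ editDist (block A d i) ((B.drop p₁).take (p - p₁)) + d + g := by
        rw [Nat.sub_mul]; omega
      have h8 : (D (i + 1) q lam : ℝ) ≤ D i q₁ lam + med i q₁ 0 +
          (editDist (block A d i) ((B.drop p₁).take (p - p₁)) + d + g) := by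
        exact_mod_cast h2.trans (Nat.add_le_add h1 h7)
      have h9 : (med i q₁ 0 : ℝ) ≤ α * d := h3.trans
        (mul_le_mul_of_nonneg_left (by exact_mod_cast h4) (by linarith))
      have h10 : (lam : ℝ) ≤ q - q₁ := by
        rw [← Nat.cast_sub hqq]; exact_mod_cast (by omega : lam ≤ q - q₁)
      have h11 : (1 + α) * d ≤ (1 + α) * (d / lam) * (q - q₁) := by
        calc (1 + α) * d = (1 + α) * (d / lam) * lam := by field_simp
          _ ≤ _ := mul_le_mul_of_nonneg_left h10 hfac
      have h12 : (editDist (block A d i) ((B.drop p₁).take (p - p₁)) : ℝ) ≤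
          α * editDist (block A d i) ((B.drop p₁).take (p - p₁)) :=
        le_mul_of_one_le_left (by positivity) hα
      push_cast
      nlinarith

theorem BlockTable.final (hD : BlockTable med g inf N M lam D) {α : ℝ} (hα : 1 ≤ α)
    (hg : 0 < g) (hlam : 0 < lam) (hM : (B.length + g - 1) / g = M) (hN : A.length ≤ N * d)
    (hinf : A.length + B.length ≤ inf)
    (hmed : ∀ i < N, ∀ j ≤ M, ∀ l ≤ lam, IsApprox α (block A d i) (window B g j l) (med i j l)) :
    editDist A B ≤ D N M lam ∧ (D N M lam : ℝ) ≤
      α * editDist A B + (N + 1) * (2 * α * g) + (1 + α) * (d / lam) * M := by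
  have hMg : B.length ≤ M * g := hM ▸ (ceil_mul_bounds hg).1
  constructor
  · have := hD.sound (A := A) (B := B) (d := d) (fun i hi j hj l hl => (hmed i hi j hj l hl).1)
      N le_rfl M le_rfl lam le_rfl
    rw [List.take_of_length_le hN, List.take_of_length_le hMg] at this
    have := editDist_le_length_add A B
    omega
  · have := hD.complete (A := A) (B := B) (d := d) hα hg hlam hM
      (fun i hi j hj l hl => (hmed i hi j hj l hl).2) N le_rfl B.length le_rfl
    rwa [List.take_of_length_le hN, List.take_length, hM] at this

end

/-! ### Medians -/

/-- The smallest of the first `R` values that has at least `h + 1` of these values below or equal,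
with penalties of `pen` for the other ones. -/
def medianUpTo (h R pen : ℕ) (v : ℕ → ℕ) : ℕ → ℕ
  | 0 => pen
  | k + 1 => min (v k + pen * (h + 1 - ∑ j ∈ Finset.range R, (1 - (v j - v k))))
      (medianUpTo h R pen v k)

theorem medianUpTo_le_pen (h R pen : ℕ) (v : ℕ → ℕ) (k : ℕ) : medianUpTo h R pen v k ≤ pen := by
  induction k with
  | zero => exact le_rfl
  | succ k ih => exact (min_le_right _ _).trans ih

/-- With truncated subtraction, `1 - (v j - v k)` is the indicator of `v j ≤ v k`. The arithmetic
expressions have no comparisons, so ranks are computed in this way. -/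
theorem sum_one_sub_sub (R : ℕ) (v : ℕ → ℕ) (k : ℕ) :
    ∑ j ∈ Finset.range R, (1 - (v j - v k)) =
      ((Finset.range R).filter fun j => v j ≤ v k).card := by
  rw [Finset.card_filter]
  refine Finset.sum_congr rfl fun j _ => ?_
  split <;> omega

theorem medianUpTo_le {h R pen : ℕ} {v : ℕ → ℕ} {i k : ℕ} (hi : i < k)
    (hc : h + 1 ≤ ((Finset.range R).filter fun j => v j ≤ v i).card) :
    medianUpTo h R pen v k ≤ v i := by
  induction k with
  | zero => omega
  | succ k ih =>
    rw [medianUpTo]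
    by_cases hk : i = k
    · subst hk
      rw [sum_one_sub_sub, Nat.sub_eq_zero_of_le hc, mul_zero, add_zero]
      exact min_le_left _ _
    · exact (min_le_right _ _).trans (ih (by omega))

/-- A value of too small rank carries at least one penalty `pen`, which is itself at least `lo`, so
only values of rank at least `h + 1` matter. -/
theorem le_medianUpTo {h R pen lo : ℕ} {v : ℕ → ℕ} {k : ℕ} (hlo : lo ≤ pen)
    (hc : ∀ i, h + 1 ≤ ((Finset.range R).filter fun j => v j ≤ v i).card → lo ≤ v i) :
    lo ≤ medianUpTo h R pen v k := by
  induction k with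
  | zero => exact hlo
  | succ k ih =>
    rw [medianUpTo]
    refine le_min ?_ ih
    rw [sum_one_sub_sub]
    by_cases hk : h + 1 ≤ ((Finset.range R).filter fun j => v j ≤ v k).card
    · exact (hc k hk).trans (Nat.le_add_right _ _)
    · have : pen * 1 ≤ pen * (h + 1 - ((Finset.range R).filter fun j => v j ≤ v k).card) :=
        Nat.mul_le_mul le_rfl (by omega)
      omega

/-- If most of the values are good approximations, then so is the median. -/
theorem isApprox_median {h pen : ℕ} {v : ℕ → ℕ} {β : ℝ} {x y : List ℕ}
    (hpen : editDist x y ≤ pen) {T : Finset ℕ} (hT : T ⊆ Finset.range (2 * h + 1))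
    (hc : h + 1 ≤ T.card) (hv : ∀ r ∈ T, IsApprox β x y (v r)) :
    IsApprox β x y (medianUpTo h (2 * h + 1) pen v (2 * h + 1)) := by
  constructor
  · refine le_medianUpTo hpen fun i hi => ?_
    -- Two sets of at least `h + 1` among `2 * h + 1` indices meet, so a value of sufficient rank is
    -- at least some good value.
    obtain ⟨j, hj, hj'⟩ : ∃ j ∈ T, v j ≤ v i := by
      by_contra! hcon
      have hdisj : Disjoint T ((Finset.range (2 * h + 1)).filter fun j => v j ≤ v i) := by
        rw [Finset.disjoint_left]
        intro j hj hj'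
        exact absurd (Finset.mem_filter.1 hj').2 (not_le.2 (hcon j hj))
      have := Finset.card_le_card (Finset.union_subset hT
        (Finset.filter_subset (fun j => v j ≤ v i) (Finset.range (2 * h + 1))))
      rw [Finset.card_union_of_disjoint hdisj, Finset.card_range] at this
      omega
    exact (hv j hj).1.trans hj'
  -- The largest good value has all good values below it, hence sufficient rank, and it bounds the
  -- median from above.
  · obtain ⟨i, hi, hmax⟩ := T.exists_max_image v (Finset.card_pos.1 (by omega))
    refine le_trans ?_ (hv i hi).2
    exact_mod_cast medianUpTo_le (Finset.mem_range.1 (hT hi)) (hc.trans (Finset.card_le_card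
      fun j hj => Finset.mem_filter.2 ⟨hT hj, hmax j hj⟩))


/-! ### The program -/

/-- The numbers that the program computes in the beginning and keeps in registers. -/
structure Params where
  (n b m lA lB d g L lam k N M1 Z inf bB bQ bM bD bF lam1 Wd w KA KB KM KQ KF : ℕ)

/-- The contents of the registers. -/
def Params.par (P : Params) : ℕ → ℕ
  | 0 => P.n
  | 3 => P.b
  | 4 => P.m
  | 5 => P.lA
  | 6 => P.lB
  | 7 => P.d
  | 8 => P.g
  | 9 => P.L
  | 10 => P.lam
  | 11 => P.k
  | 12 => P.N
  | 13 => P.M1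
  | 14 => P.Z
  | 15 => P.inf
  | 16 => P.bB
  | 17 => P.bQ
  | 18 => P.bM
  | 19 => P.bD
  | 20 => P.bF
  | 21 => P.lam1
  | 22 => P.Wd
  | 23 => P.w
  | 24 => P.KA
  | 25 => P.KB
  | 26 => P.KM
  | 27 => P.KQ
  | 28 => P.KF
  | _ => 0

/-- The equations between the parameters. -/
structure Params.Valid (P : Params) (v R C c : ℕ) : Prop where
  d : P.d = P.b ^ (v + 2)
  g : P.g = P.b ^ v
  L : P.L = P.b ^ (v + 4)
  lam : P.lam = P.b ^ 4
  k : P.k = 2 * P.n / P.b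
  N : P.N = P.lA / P.d + 1
  M1 : P.M1 = (P.lB + P.g - 1) / P.g + 1
  Z : P.Z = (C + 1) * (P.L + P.m + 1) ^ (c + 1) + 2
  inf : P.inf = 2 * P.n + 1
  lam1 : P.lam1 = P.lam + 1
  Wd : P.Wd = P.M1 * P.lam1
  w : P.w = 2 * P.k + 2
  KA : P.KA = P.N * R
  KB : P.KB = P.Wd * R
  KM : P.KM = P.N * P.Wd
  KQ : P.KQ = P.KM * R
  KF : P.KF = P.lA * P.w
  bB : P.bB = P.KA * P.Z
  bQ : P.bQ = P.bB + P.KB * P.Z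
  bM : P.bM = P.bQ + P.KQ * P.Z
  bD : P.bD = P.bM + P.KM
  bF : P.bF = P.bD + P.Wd + P.KM

open RExpr in
/-- The assignments that compute the parameters from `n`, `b` and `m`. -/
def paramList (v R C c : ℕ) : List (ℕ × RExpr) :=
  [(5, .inp 0 0), (6, .inp 1 0), (7, epow (.var 3) (v + 2)), (8, epow (.var 3) v),
    (9, epow (.var 3) (v + 4)), (10, epow (.var 3) 4), (11, 2 * .var 0 / .var 3),
    (12, .var 5 / .var 7 + 1), (13, (.var 6 + .var 8 - 1) / .var 8 + 1),
    (14, const (C + 1) * epow (.var 9 + .var 4 + 1) (c + 1) + 2), (15, 2 * .var 0 + 1),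
    (21, .var 10 + 1), (22, .var 13 * .var 21), (23, 2 * .var 11 + 2), (24, .var 12 * const R),
    (25, .var 22 * const R), (26, .var 12 * .var 22), (27, .var 26 * const R),
    (28, .var 5 * .var 23), (16, .var 24 * .var 14), (17, .var 16 + .var 25 * .var 14),
    (18, .var 17 + .var 27 * .var 14), (19, .var 18 + .var 26), (20, .var 19 + .var 22 + .var 26)]

/-- Several assignments. -/
def assigns : List (ℕ × RExpr) → Prog
  | [] => .skip
  | (x, e) :: l => .seq (assign x e) (assigns l)

/-- The state after the assignment of the values `par x`. -/
def MState.setRegs (par : ℕ → ℕ) : List (ℕ × RExpr) → MState → MState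
  | [], s => s
  | (x, _) :: l, s => MState.setRegs par l (s.setReg x (par x))

/-- The assignments compute the values `par x`. -/
def Computes (I : ℕ → ℕ → ℕ) (par : ℕ → ℕ) : List (ℕ × RExpr) → MState → Prop
  | [], _ => True
  | (x, e) :: l, s => e.eval I s = par x ∧ Computes I par l (s.setReg x (par x))

theorem MState.setRegs_mem (par : ℕ → ℕ) (l : List (ℕ × RExpr)) (s : MState) :
    (s.setRegs par l).mem = s.mem := by
  induction l generalizing s with
  | nil => rfl
  | cons a l ih => exact ih _

theorem MState.setRegs_reg (par : ℕ → ℕ) (l : List (ℕ × RExpr)) (s : MState) (y : ℕ) :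
    (s.setRegs par l).reg y = if y ∈ l.map Prod.fst then par y else s.reg y := by
  induction l generalizing s with
  | nil => simp [MState.setRegs]
  | cons a l ih =>
    rw [MState.setRegs, ih, MState.setReg_reg]
    by_cases h1 : y ∈ l.map Prod.fst
    · simp [h1]
    · by_cases h2 : y = a.1
      · subst h2; simp
      · simp only [h1, h2, if_false, List.map_cons, List.mem_cons, or_self]

section
variable {W Q D : ℕ} {I : ℕ → ℕ → ℕ} {ρ : ℕ → Bool}

theorem runs_assigns (h : WordOK W Q D I) {par : ℕ → ℕ} (hpar : ∀ x, par x ≤ Q)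
    (l : List (ℕ × RExpr)) (hl : ∀ a ∈ l, a.2.deg ≤ D) (s : MState) (hs : s.Bdd Q)
    (hc : Computes I par l s) :
    Runs W I ρ (assigns l) s (s.setRegs par l) ((l.map fun a => a.2.cost + 1).sum + 1) := by
  induction l generalizing s with
  | nil => exact fun S hS => ⟨S, 1, hS, by simp, .skip S⟩
  | cons a l ih =>
    obtain ⟨x, e⟩ := a
    have h1 := runs_assign (ρ := ρ) h hs (x := x) (e := e) (hl (x, e) (by simp))
    rw [hc.1] at h1
    refine (h1.seq (ih (fun a ha => hl a (by simp [ha])) _ (hs.setReg (hpar x) x) hc.2)).mono ?_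
    simp only [List.map_cons, List.sum_cons]
    omega

/-- The list is ordered so that each expression refers only to registers that are already set; each
entry is then one of the equations in `Params.Valid`. -/
theorem Params.Valid.computes {P : Params} {v R C c : ℕ} (hP : P.Valid v R C c) {s : MState}
    (h0 : s.reg 0 = P.n) (h3 : s.reg 3 = P.b) (h4 : s.reg 4 = P.m) (hA : I 0 0 = P.lA)
    (hB : I 1 0 = P.lB) : Computes I P.par (paramList v R C c) s := by
  simp [Computes, paramList, Params.par, h0, h3, h4, hA, hB, hP.d, hP.g, hP.L, hP.lam, hP.k, hP.N,
    hP.M1, hP.Z, hP.inf, hP.lam1, hP.Wd, hP.w, hP.KA, hP.KB, hP.KM, hP.KQ, hP.KF, hP.bB, hP.bQ,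
    hP.bM, hP.bD, hP.bF]

/-- The state has the parameters in its registers. -/
structure Ready (P : Params) (Q : ℕ) (s : MState) : Prop where
  reg : ∀ x < 100, x ≠ 1 → x ≠ 2 → s.reg x = P.par x
  bdd : s.Bdd Q

/-- The parameter registers below `98` are as they should be. -/
def Params.Regs (P : Params) (S : MState) : Prop := ∀ x < 98, x ≠ 1 → x ≠ 2 → S.reg x = P.par x

theorem Ready.counters {P : Params} {s : MState} (hs : Ready P Q s) {m : ℕ → ℕ}
    (hm : ∀ a, m a ≤ Q) {x y : ℕ} (hx : x ≤ Q) (hy : y ≤ Q) :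
    Ready P Q ((s.withMem m).counters x y) :=
  ⟨fun z hz h1 h2 => by simp [h1, h2, hs.reg z hz h1 h2], (hs.bdd.withMem hm).counters hx hy⟩

/-- The table is the solution of its own recursion (`exists_memFill`), so no closed form is needed
in advance. Only the recursion equations are passed on, each evaluated in some state with the right
parameters, counter and memory. -/
theorem runs_fill_ready (h : WordOK W Q D I) {P : Params} {s : MState} (hs : Ready P Q s)
    {x K b : ℕ} {base e : RExpr} (hx : x < 98) (hx1 : x ≠ 1) (hx2 : x ≠ 2) (hK : P.par x = K)
    (hD : 4 ≤ D) (hbD : base.deg + 2 ≤ D) (heD : e.deg ≤ D)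
    (hbase : ∀ S, P.Regs S → base.eval I S = b)
    (he : ∀ k < K, ∀ S, P.Regs S → S.reg 1 = k → e.eval I S ≤ Q) :
    ∃ G s', Runs W I ρ (fill (.var x) base e) s s' (7 + K * (base.cost + e.cost + 12)) ∧
      Ready P Q s' ∧ s'.mem = memFill s.mem b G K ∧
      ∀ k < K, ∃ S, P.Regs S ∧ S.reg 1 = k ∧ S.mem = memFill s.mem b G k ∧ e.eval I S = G k := by
  have hKQ : K ≤ Q := by rw [← hK, ← hs.reg x (by omega) hx1 hx2]; exact hs.bdd.reg x (by omega)
  have hregs : ∀ m y z, P.Regs ((s.withMem m).counters y z) := fun m y z i hi h1 h2 => by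
    simp [h1, h2, hs.reg i (by omega) h1 h2]
  obtain ⟨G, hG⟩ := exists_memFill s.mem b fun k m => e.eval I ((s.withMem m).counters k (K - k))
  have hGQ : ∀ k < K, G k ≤ Q := fun k hk => by
    rw [← hG k]; exact he k hk _ (hregs _ _ _) (by simp)
  refine ⟨G, _, runs_fill (lim := .var x) h G hs.bdd hKQ (show 1 + 3 ≤ D from hD) hbD heD (fun m y z => ?_)
    (fun m y z => hbase _ (hregs _ _ _)) (fun k _ => hG k) hGQ |>.mono ?_,
    hs.counters (memFill_le hs.bdd.mem hGQ) hKQ (Nat.zero_le _), by simp,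
    fun k _ => ⟨_, hregs _ _ _, by simp, by simp, hG k⟩⟩
  · rw [RExpr.eval_var, if_pos (by omega), hregs _ _ _ x hx hx1 hx2, hK]
  · change 1 + 6 + K * (base.cost + e.cost + 1 + 11) ≤ _
    rw [add_assoc (base.cost + e.cost)]

theorem runs_callLoop_ready {P : Params} {s : MState} {W₀ V B κ T n K b x : ℕ}
    {base cbE : RExpr} {inE : ℕ → RExpr} {p : Prog} {sf : ℕ → MState} {inp : ℕ → ℕ → ℕ → ℕ}
    {cb : ℕ → ℕ}
    (h : WordOK W Q D I) (hs : Ready P Q s) (hW₀ : W₀ ≤ V) (hn : n ≤ V) (hVQ : V ≤ Q)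
    (hB : 0 < B) (hp : p.RegsBelow B)
    (hfresh : ∀ a, b ≤ a → s.mem a = 0) (hcb : ∀ k < K, cb k + V ≤ Q)
    (hx : x < 98) (hx1 : x ≠ 1) (hx2 : x ≠ 2) (hK : P.par x = K) (hZ : P.Z = V + 2)
    (hnL : P.L = n) (hbase : ∀ S, P.Regs S → base.eval I S = b)
    (hcbE : ∀ k < K, ∀ S, P.Regs S → S.reg 1 = k → cbE.eval I S = cb k)
    (hinE : ∀ k < K, ∀ S : MState, P.Regs S → S.reg 1 = k → (∀ a < b, S.mem a = s.mem a) →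
      S.reg 98 ≤ V → ∀ i, (inE i).eval I S = inp k i (S.reg 98))
    (hbD : base.deg + 12 ≤ D) (hcD : cbE.deg + 5 ≤ D) (hiD : ∀ i, (inE i).deg ≤ D)
    (hbκ : base.cost + 4 ≤ κ) (hcκ : cbE.cost ≤ κ) (hiκ : ∀ i, (inE i).cost ≤ κ)
    (hrun : ∀ k < K, ∃ t ≤ T, Exec W₀ (inp k) (fun y => ρ (cb k + y)) p (MState.init n) (sf k) t) :
    ∃ s', Runs W I ρ (callLoop p B (.var x) base cbE (.var 14) (.var 9) inE) s s'
        (κ + 6 + K * ((κ + 10) * T + B + 4 * κ + 28)) ∧ Ready P Q s' ∧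
      s'.mem = memFill s.mem b (fun x => (sf (x / (V + 2))).record V (x % (V + 2)))
        (K * (V + 2)) := by
  have hKQ : K ≤ Q := by rw [← hK, ← hs.reg x (by omega) hx1 hx2]; exact hs.bdd.reg x (by omega)
  have hregs : ∀ S : MState, (∀ x < 98, x ≠ 1 → x ≠ 2 → S.reg x = s.reg x) → P.Regs S :=
    fun S hS y hy h1 h2 => by rw [hS y hy h1 h2, hs.reg y (by omega) h1 h2]
  have hvar : ∀ y < 98, y ≠ 1 → y ≠ 2 → ∀ S : MState, P.Regs S →
      (RExpr.var y).eval I S = P.par y := fun y hy h1 h2 S hS => by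
    rw [RExpr.eval_var, if_pos (by omega), hS y hy h1 h2]
  have hmem : ∀ a, memFill s.mem b (fun x => (sf (x / (V + 2))).record V (x % (V + 2)))
      (K * (V + 2)) a ≤ Q := by
    refine memFill_le hs.bdd.mem fun i hi => ?_
    obtain ⟨t, _, he⟩ := hrun (i / (V + 2)) (Nat.div_lt_of_lt_mul (by rwa [mul_comm] at hi))
    have := he.within hW₀ (.init hn)
    simp only [MState.record]
    split
    · exact (this.mem _).trans hVQ
    · exact (this.reg _).trans hVQ
  refine ⟨_, runs_callLoop h hs.bdd hW₀ hn hVQ hB hp (hs.reg 98 (by norm_num) (by norm_num)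
    (by norm_num)) (hs.reg 99 (by norm_num) (by norm_num) (by norm_num)) hfresh hKQ hcb
    (fun S hS => (hvar x hx hx1 hx2 S (hregs S hS)).trans hK) (fun S hS => hbase S (hregs S hS))
    (fun S hS => (hvar 14 (by norm_num) (by norm_num) (by norm_num) S (hregs S hS)).trans hZ)
    (fun S hS => (hvar 9 (by norm_num) (by norm_num) (by norm_num) S (hregs S hS)).trans hnL)
    (fun k hk S hS h1 => hcbE k hk S (hregs S hS) h1)
    (fun k hk S hS h1 hm h98 => hinE k hk S (hregs S hS) h1 hm h98)
    (show 1 + 3 ≤ D by omega) (show base.deg + 2 * 1 + 10 ≤ D by omega) hcD hiD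
    (show 1 ≤ D by omega) (show base.cost + 1 + 3 ≤ κ by omega) hcκ hiκ (show 1 ≤ κ by omega)
    (show 1 ≤ κ by omega) hrun, hs.counters hmem hKQ (Nat.zero_le _), by simp⟩

open RExpr in
/-- The loop that computes the largest `b` with `b ^ r ≤ n` and the sum of the symbols. -/
def initLoop (r : ℕ) : Prog := forLoop (.var 0) (.seq
  (assign 3 (.var 3 + (.var 1 + 1 - .var 3) * (1 - (epow (.var 1 + 1) r - .var 0))))
  (assign 4 (.var 4 + .inp 0 (.var 1 + 1) + .inp 1 (.var 1 + 1))))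

/-- The degree and the cost of the expressions in `initLoop`. -/
def initBound (r : ℕ) : ℕ := (RExpr.epow (.var 1 + 1) r).deg + (RExpr.epow (.var 1 + 1) r).cost + 30

/-- The bound on the symbols is not part of the program's input. The sum of all symbols replaces it:
it bounds every symbol and is polynomial in the size and the true bound. The cells after the end of
a string read as `0` and do not matter. -/
theorem runs_initLoop (h : WordOK W Q D I) {r n : ℕ} (hn : n ≤ Q)
    (hm : ∑ i ∈ Finset.range n, (I 0 (i + 1) + I 1 (i + 1)) ≤ Q) (hD : initBound r ≤ D) :
    Runs W I ρ (initLoop r) (MState.init n)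
      (((((MState.init n).setReg 3 (Nat.findGreatest (fun x => x ^ r ≤ n) n)).setReg 4
        (∑ i ∈ Finset.range n, (I 0 (i + 1) + I 1 (i + 1))))).counters n 0)
      (7 + n * (initBound r + 30)) := by
  set f : ℕ → MState := fun k => ((MState.init n).setReg 3
    (Nat.findGreatest (fun x => x ^ r ≤ n) k)).setReg 4
      (∑ i ∈ Finset.range k, (I 0 (i + 1) + I 1 (i + 1))) with hf
  have hsum : ∀ k ≤ n, ∑ i ∈ Finset.range k, (I 0 (i + 1) + I 1 (i + 1)) ≤ Q := fun k hk =>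
    (Finset.sum_le_sum_of_subset (Finset.range_subset_range.2 hk)).trans hm
  have hb : ∀ k ≤ n, (f k).Bdd Q := by
    intro k hk
    refine MState.Bdd.setReg (MState.Bdd.setReg ⟨fun x _ => ?_, fun a => Nat.zero_le _⟩
      ((Nat.findGreatest_le k).trans (hk.trans hn)) 3) (hsum k hk) 4
    exact (MState.Within.init hn).reg x
  have hf0 : f 0 = MState.init n := by
    simp only [hf, Nat.findGreatest_zero, Finset.range_zero, Finset.sum_empty, MState.setReg,
      MState.init]
    congr 1
    funext x
    simp only [Function.update_apply]
    split_ifs <;> first | rfl | omega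
  have := runs_forLoop (ρ := ρ) (lim := .var 0) (body := .seq
    (assign 3 (.var 3 + (.var 1 + 1 - .var 3) * (1 - (RExpr.epow (.var 1 + 1) r - .var 0))))
    (assign 4 (.var 4 + .inp 0 (.var 1 + 1) + .inp 1 (.var 1 + 1)))) h f (K := n)
    (T := initBound r + 20) hn hb (by change 1 + 3 ≤ D; rw [initBound] at hD; omega)
    (fun k _ x y => by simp [hf, MState.init]) ?_
  · rw [hf0] at this
    refine Runs.mono this ?_
    change 1 + 6 + n * (initBound r + 20 + 1 + 8) ≤ _
    have : n * (initBound r + 20 + 1 + 8) ≤ n * (initBound r + 30) := Nat.mul_le_mul le_rfl (by omega)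
    omega
  · intro k hk
    have hbk := (hb k hk.le).counters (k := k) (c := n - k) (by omega) (by omega)
    have e1 : (RExpr.var 3 + (.var 1 + 1 - .var 3) *
        (1 - (RExpr.epow (.var 1 + 1) r - .var 0))).eval I ((f k).counters k (n - k)) =
        Nat.findGreatest (fun x => x ^ r ≤ n) (k + 1) := by
      have hle := Nat.findGreatest_le (P := fun x => x ^ r ≤ n) k
      simp only [hf, RExpr.eval_add, RExpr.eval_mul, RExpr.eval_sub, RExpr.eval_var,
        RExpr.eval_epow, RExpr.eval_ofNat, MState.counters_reg, MState.setReg_reg, MState.init]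
      norm_num
      -- The factor `1 - ((k + 1) ^ r - n)` is the indicator of `(k + 1) ^ r ≤ n`, in which case the
      -- register is raised to `k + 1`.
      rw [Nat.findGreatest_succ]
      split
      · rename_i hk'
        rw [Nat.sub_eq_zero_of_le hk']; omega
      · rename_i hk'
        rw [show 1 - ((k + 1) ^ r - n) = 0 by omega]; omega
    have r1 := runs_assign (ρ := ρ) h hbk (x := 3) (e := RExpr.var 3 + (.var 1 + 1 - .var 3) *
        (1 - (RExpr.epow (.var 1 + 1) r - .var 0))) (by
      change 1 + (1 + 1 + 1 + 1 + 1 + (1 + ((RExpr.epow (.var 1 + 1) r).deg + 1 + 1) + 1) + 1) + 1 ≤ D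
      rw [initBound] at hD; omega)
    rw [e1] at r1
    have hbk' := hbk.setReg (v := Nat.findGreatest (fun x => x ^ r ≤ n) (k + 1))
      ((Nat.findGreatest_le _).trans (by omega)) 3
    have r2 := runs_assign (ρ := ρ) h hbk' (x := 4)
      (e := RExpr.var 4 + .inp 0 (.var 1 + 1) + .inp 1 (.var 1 + 1)) (by
      change 1 + (1 + 1 + 1 + 1) + 1 + (1 + 1 + 1 + 1) + 1 ≤ D
      rw [initBound] at hD; omega)
    have e2 : (RExpr.var 4 + .inp 0 (.var 1 + 1) + .inp 1 (.var 1 + 1)).eval I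
        (((f k).counters k (n - k)).setReg 3 (Nat.findGreatest (fun x => x ^ r ≤ n) (k + 1))) =
        ∑ i ∈ Finset.range (k + 1), (I 0 (i + 1) + I 1 (i + 1)) := by
      simp only [hf, RExpr.eval_add, RExpr.eval_inp, RExpr.eval_var,
        RExpr.eval_ofNat, MState.counters_reg, MState.setReg_reg, MState.init]
      norm_num
      rw [Finset.sum_range_succ]
      omega
    rw [e2] at r2
    have hst : (((f k).counters k (n - k)).setReg 3
        (Nat.findGreatest (fun x => x ^ r ≤ n) (k + 1))).setReg 4
          (∑ i ∈ Finset.range (k + 1), (I 0 (i + 1) + I 1 (i + 1))) =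
        (f (k + 1)).counters k (n - k) := by
      simp only [hf, MState.counters, MState.setReg, MState.mk.injEq, and_true]
      funext x
      simp only [Function.update_apply]
      split_ifs <;> first | rfl | omega
    rw [hst] at r2
    refine (r1.seq r2).mono ?_
    change 1 + (1 + 1 + 1 + 1 + 1 + (1 + ((RExpr.epow (.var 1 + 1) r).cost + 1 + 1) + 1) + 1) + 1 + 1 +
      (1 + (1 + 1 + 1 + 1) + 1 + (1 + 1 + 1 + 1) + 1 + 1) ≤ _
    rw [initBound]; omega

end


/-! ### The stages of the program -/

section
variable {W Q D : ℕ} {I : ℕ → ℕ → ℕ} {ρ : ℕ → Bool} {P : Params}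

namespace RExpr

/-- The array of the substring with given start and length of the `i`-th input string, whose length
is `tot`, at the address in register `98`. -/
def windowInput (i : ℕ) (st ln tot : RExpr) : RExpr :=
  (1 - .var 98) * emin ln (tot - st) +
    emin 1 (.var 98) * ((1 - (.var 98 - ln)) * .inp i (st + .var 98))

/-- The factors `1 - x` and `min 1 x` separate cell `0`, the length, from the symbols, and a third
factor blanks the cells after the window. Positions after the end of the whole string agree because
both arrays default to `0` there. -/
theorem eval_windowInput {S : MState} {i a l : ℕ} {st ln tot : RExpr} {X : List ℕ}
    (hX : I i = strArray X) (hst : st.eval I S = a) (hln : ln.eval I S = l)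
    (htot : tot.eval I S = X.length) :
    (windowInput i st ln tot).eval I S = strArray ((X.drop a).take l) (S.reg 98) := by
  simp only [windowInput, eval_add, eval_mul, eval_sub, eval_emin, eval_var, eval_ofNat, eval_inp,
    hX, hst, hln, htot]
  norm_num
  generalize S.reg 98 = y
  cases y with
  | zero => simp [strArray]
  | succ y =>
    simp only [strArray]
    rw [Nat.sub_eq_zero_of_le (by omega : 1 ≤ y + 1), zero_mul, zero_add,
      Nat.min_eq_left (by omega), one_mul]
    by_cases hy : y < l
    · rw [Nat.sub_eq_zero_of_le (by omega : y + 1 ≤ l)]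
      simp [List.getD_eq_getElem?_getD, hy]
    · rw [show 1 - (y + 1 - l) = 0 by omega]
      simp [List.getD_eq_getElem?_getD, hy]

def sumRange (e : ℕ → RExpr) : ℕ → RExpr
  | 0 => 0
  | k + 1 => sumRange e k + e k

theorem eval_sumRange (e : ℕ → RExpr) (k : ℕ) (S : MState) :
    (sumRange e k).eval I S = ∑ j ∈ Finset.range k, (e j).eval I S := by
  induction k with
  | zero => simp [sumRange]
  | succ k ih => simp [sumRange, ih, Finset.sum_range_succ]

def medianUpTo (h R : ℕ) (pen : RExpr) (e : ℕ → RExpr) : ℕ → RExpr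
  | 0 => pen
  | k + 1 => emin (e k + pen * (const (h + 1) - sumRange (fun j => 1 - (e j - e k)) R))
      (medianUpTo h R pen e k)

theorem eval_medianUpTo (h R : ℕ) (pen : RExpr) (e : ℕ → RExpr) (k : ℕ) (S : MState) :
    (medianUpTo h R pen e k).eval I S =
      _root_.medianUpTo h R (pen.eval I S) (fun j => (e j).eval I S) k := by
  induction k with
  | zero => rfl
  | succ k ih => simp [medianUpTo, _root_.medianUpTo, ih, eval_sumRange]

/-- The position of the coins of the current repetition. -/
def coinBase (R : ℕ) : RExpr := emod (.var 1) (const R) * .var 14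

/-- The input arrays for the preprocessing of the blocks. -/
def blockInput (R : ℕ) : ℕ → RExpr
  | 0 => windowInput 0 (.var 1 / const R * .var 7) (.var 7) (.var 5)
  | _ + 1 => 0

/-- The input arrays for the preprocessing of the windows. -/
def gridInput (R : ℕ) : ℕ → RExpr
  | 0 => windowInput 1 (.var 1 / const R / .var 21 * .var 8)
      (emod (.var 1 / const R) (.var 21) * .var 8) (.var 6)
  | _ + 1 => 0

/-- The input arrays for the queries. -/
def queryInput (R : ℕ) : ℕ → RExpr
  | 0 => .rd ((.var 1 / const R / .var 22 * const R + emod (.var 1) (const R)) * .var 14 + .var 98)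
  | 1 => .rd (.var 16 + (emod (.var 1 / const R) (.var 22) * const R + emod (.var 1) (const R)) *
      .var 14 + .var 98)
  | _ + 2 => 0

/-- The median of the answers to the queries. -/
def medianExpr (h R : ℕ) : RExpr := medianUpTo h R (.var 14 - 2)
  (fun r => .rd (.var 17 + (.var 1 * const R + const r) * .var 14 + (.var 14 - 1))) R

/-- The recurrence of the dynamic program over blocks. -/
def blockExpr : RExpr :=
  emin (.var 15) (emin
    (.rd (.var 19 + .var 22 + .var 1 - 1) + .var 8 * (1 - emod (emod (.var 1) (.var 22)) (.var 21)) +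
      .var 15 * (1 - (emod (emod (.var 1) (.var 22)) (.var 21) + emod (.var 1) (.var 22) / .var 21)))
    (.rd (.var 19 + (.var 1 / .var 22 * .var 22 + (emod (.var 1) (.var 22) / .var 21 -
        emod (emod (.var 1) (.var 22)) (.var 21)) * .var 21 + .var 10)) +
      .rd (.var 18 + (.var 1 / .var 22 * .var 22 + (emod (.var 1) (.var 22) / .var 21 -
        emod (emod (.var 1) (.var 22)) (.var 21)) * .var 21 +
          emod (emod (.var 1) (.var 22)) (.var 21))) +
      .var 15 * (emod (emod (.var 1) (.var 22)) (.var 21) - emod (.var 1) (.var 22) / .var 21)))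

/-- The first row of the banded dynamic program. -/
def bandInit : RExpr :=
  emin (.var 15) ((.var 11 - .var 1) * .var 15 + (.var 1 - .var 11) +
    .var 15 * (.var 1 / (.var 23 - 1)))

def emax (a b : RExpr) : RExpr := a + (b - a)

theorem eval_emax (a b : RExpr) (S : MState) :
    (emax a b).eval I S = max (a.eval I S) (b.eval I S) := by
  simp only [emax, eval_add, eval_sub]; omega

/-- Whether two expressions differ. -/
def differ (a b : RExpr) : RExpr := emin 1 ((a - b) + (b - a))

theorem eval_differ (a b : RExpr) (S : MState) :
    (differ a b).eval I S = if a.eval I S = b.eval I S then 0 else 1 := by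
  simp only [differ, eval_emin, eval_add, eval_sub, eval_ofNat]
  split <;> omega

/-- The recurrence of the banded dynamic program. -/
def bandExpr : RExpr :=
  emin (.var 15) (emax (.var 15 * (emod (.var 1) (.var 23) / (.var 23 - 1)))
    (emin (.rd (.var 20 + .var 1) + differ (.inp 0 (.var 1 / .var 23 + 1))
        (.inp 1 (.var 1 / .var 23 + 1 + emod (.var 1) (.var 23) - .var 11)))
      (emin (.rd (.var 20 + .var 1 + 1) + 1) (.rd (.var 20 + .var 23 + .var 1 - 1) + 1))))

/-- The result of the banded dynamic program. -/
def bandResult : RExpr :=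
  .rd (.var 20 + (.var 5 * .var 23 + emin (.var 23 - 1) (.var 6 + .var 11 - .var 5))) +
    .var 15 * (.var 5 - (.var 6 + .var 11))

/-- The result of the dynamic program over blocks. -/
def blockResult : RExpr := .rd (.var 19 + (.var 22 + .var 26 - 1))

/-- The result. -/
def resultExpr : RExpr :=
  bandResult * (1 - (bandResult - .var 11)) + blockResult * emin 1 (bandResult - .var 11)

end RExpr

theorem Params.Regs.eval_var {S : MState} (hS : P.Regs S) {x : ℕ} (hx : x < 98) (h1 : x ≠ 1)
    (h2 : x ≠ 2) : (RExpr.var x).eval I S = P.par x := by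
  rw [RExpr.eval_var, if_pos (by omega), hS x hx h1 h2]

theorem eval_var_one {S : MState} : (RExpr.var 1).eval I S = S.reg 1 := rfl

/-- Two tables after each other are one table. -/
theorem memFill_append (m : ℕ → ℕ) (b k₀ k : ℕ) (G₀ G : ℕ → ℕ) :
    memFill (memFill m b G₀ k₀) (b + k₀) G k =
      memFill m b (fun x => if x < k₀ then G₀ x else G (x - k₀)) (k₀ + k) := by
  funext a
  simp only [memFill]
  by_cases h1 : b ≤ a ∧ a < b + k₀
  · rw [if_neg (by omega), if_pos h1, if_pos (by omega), if_pos (by omega)]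
  · by_cases h2 : b + k₀ ≤ a ∧ a < b + k₀ + k
    · rw [if_pos h2, if_pos (by omega), if_neg (by omega), Nat.sub_sub]
    · rw [if_neg h2, if_neg h1, if_neg (by omega)]

/-- The bands: after two fills the table of the banded dynamic program is in memory. -/
theorem runs_band (h : WordOK W Q D I) {v R C c : ℕ} (hP : P.Valid v R C c) {s : MState}
    (hs : Ready P Q s) {A B : List ℕ} (hIA : I 0 = strArray A) (hIB : I 1 = strArray B)
    (hlA : P.lA = A.length) (hD : RExpr.bandInit.deg + RExpr.bandExpr.deg + 10 ≤ D) :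
    ∃ G s', Runs W I ρ (.seq (fill (.var 23) (.var 20) RExpr.bandInit)
        (fill (.var 28) (.var 20 + .var 23) RExpr.bandExpr)) s s'
        (14 + (P.w + P.KF) * (RExpr.bandInit.cost + RExpr.bandExpr.cost + 20)) ∧ Ready P Q s' ∧
      s'.mem = memFill s.mem P.bF G (P.w + P.KF) ∧ BandTable A B P.k P.inf G := by
  have hinfQ : P.inf ≤ Q := by
    have := hs.bdd.reg 15 (by norm_num)
    rwa [hs.reg 15 (by norm_num) (by norm_num) (by norm_num)] at this
  obtain ⟨G₀, s₁, r₁, hs₁, m₁, e₁⟩ := runs_fill_ready (ρ := ρ) h hs (x := 23) (K := P.w) (b := P.bF)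
    (base := .var 20) (e := RExpr.bandInit) (by norm_num) (by norm_num) (by norm_num) rfl (by omega)
    (show 1 + 2 ≤ D by omega) (by omega)
    (fun S hS => hS.eval_var (by norm_num) (by norm_num) (by norm_num))
    (fun k _ S hS _ => by
      rw [RExpr.bandInit, RExpr.eval_emin]
      refine (min_le_left _ _).trans ?_
      rw [hS.eval_var (by norm_num) (by norm_num) (by norm_num)]
      exact hinfQ)
  obtain ⟨G₁, s₂, r₂, hs₂, m₂, e₂⟩ := runs_fill_ready (ρ := ρ) h hs₁ (x := 28) (K := P.KF)
    (b := P.bF + P.w)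
    (base := RExpr.var 20 + RExpr.var 23) (e := RExpr.bandExpr) (by norm_num) (by norm_num) (by norm_num) rfl
    (by omega) (show 1 + 1 + 1 + 2 ≤ D by omega) (by omega)
    (fun S hS => by
      rw [RExpr.eval_add, hS.eval_var (by norm_num) (by norm_num) (by norm_num),
        hS.eval_var (by norm_num) (by norm_num) (by norm_num)]; rfl)
    (fun k _ S hS _ => by
      rw [RExpr.bandExpr, RExpr.eval_emin]
      refine (min_le_left _ _).trans ?_
      rw [hS.eval_var (by norm_num) (by norm_num) (by norm_num)]
      exact hinfQ)
  -- The second fill continues the table of the first one, so row `0` and the later rows are a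
  -- single table.
  set G : ℕ → ℕ := fun x => if x < P.w then G₀ x else G₁ (x - P.w) with hGd
  refine ⟨G, s₂, (r₁.seq r₂).mono ?_, hs₂,
    by rw [m₂, m₁, memFill_append], ?_, ?_⟩
  · change 7 + P.w * (1 + _ + 12) + (7 + P.KF * (1 + 1 + 1 + _ + 12)) ≤ _
    rw [add_mul]
    have a1 : P.w * (1 + RExpr.bandInit.cost + 12) ≤
      P.w * (RExpr.bandInit.cost + RExpr.bandExpr.cost + 20) := Nat.mul_le_mul le_rfl (by omega)
    have a2 : P.KF * (1 + 1 + 1 + RExpr.bandExpr.cost + 12) ≤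
      P.KF * (RExpr.bandInit.cost + RExpr.bandExpr.cost + 20) := Nat.mul_le_mul le_rfl (by omega)
    omega
  · intro o ho
    rw [← hP.w] at ho
    obtain ⟨S, hS, h1, hm, he⟩ := e₁ o ho
    simp only [hGd, ho, if_true]
    rw [← he]
    simp only [RExpr.bandInit, RExpr.eval_emin, RExpr.eval_add, RExpr.eval_mul, RExpr.eval_sub,
      RExpr.eval_div, eval_var_one, h1, RExpr.eval_ofNat]
    rw [hS.eval_var (by norm_num) (by norm_num) (by norm_num),
      hS.eval_var (by norm_num) (by norm_num) (by norm_num),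
      hS.eval_var (by norm_num) (by norm_num) (by norm_num)]
    simp only [Params.par, hP.w]
    norm_num
  · intro i hi o ho
    have hw : P.w = 2 * P.k + 2 := hP.w
    rw [← hw] at ho ⊢
    have hlt : i * P.w + o < P.KF := by
      rw [hP.KF, hlA]
      calc i * P.w + o < (i + 1) * P.w := by rw [add_mul]; omega
        _ ≤ A.length * P.w := Nat.mul_le_mul hi le_rfl
    obtain ⟨S, hS, h1, hm, he⟩ := e₂ _ hlt
    have hdiv : (i * P.w + o) / P.w = i := by
      rw [Nat.add_comm, Nat.add_mul_div_right _ _ (by omega), Nat.div_eq_of_lt ho, zero_add]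
    have hmod : (i * P.w + o) % P.w = o := by
      rw [Nat.add_comm, Nat.add_mul_mod_self_right, Nat.mod_eq_of_lt ho]
    have hrd : ∀ x < P.w + (i * P.w + o), S.mem (P.bF + x) = G x := by
      intro x hx
      rw [hm, m₁, memFill_append, memFill_lt hx]
    have hG : G ((i + 1) * P.w + o) = G₁ (i * P.w + o) := by
      simp only [hGd, add_mul, one_mul]
      rw [if_neg (by omega)]
      congr 1; omega
    rw [hG, ← he]
    have v15 : (RExpr.var 15).eval I S = P.inf :=
      hS.eval_var (by norm_num) (by norm_num) (by norm_num)
    have v23 : (RExpr.var 23).eval I S = P.w :=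
      hS.eval_var (by norm_num) (by norm_num) (by norm_num)
    have v20 : (RExpr.var 20).eval I S = P.bF :=
      hS.eval_var (by norm_num) (by norm_num) (by norm_num)
    have v11 : (RExpr.var 11).eval I S = P.k :=
      hS.eval_var (by norm_num) (by norm_num) (by norm_num)
    simp only [RExpr.bandExpr, RExpr.eval_emin, RExpr.eval_add, RExpr.eval_mul, RExpr.eval_sub,
      RExpr.eval_div, RExpr.eval_emod, RExpr.eval_emax, RExpr.eval_differ, RExpr.eval_rd,
      RExpr.eval_inp, eval_var_one, h1, RExpr.eval_ofNat, hdiv, hmod, hIA, hIB, v15, v23, v20, v11]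
    rw [hrd _ (by omega), add_assoc P.bF (i * P.w + o) 1, hrd _ (by omega),
      show P.bF + P.w + (i * P.w + o) - 1 = P.bF + (P.w + (i * P.w + o) - 1) by omega,
      hrd _ (by omega), show (i + 1) * P.w + o - 1 = P.w + (i * P.w + o) - 1 by
        rw [add_mul, one_mul]; omega, show P.w - 1 = 2 * P.k + 1 by omega]

/-- The flattened table of the dynamic program over blocks. -/
theorem runs_block (h : WordOK W Q D I) {v R C c : ℕ} (hP : P.Valid v R C c) {s : MState}
    (hs : Ready P Q s) {med : ℕ → ℕ → ℕ → ℕ} (hmQ : P.M1 * P.g ≤ Q)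
    (hmed : ∀ i < P.N, ∀ j < P.M1, ∀ l ≤ P.lam,
      s.mem (P.bM + (i * P.Wd + j * P.lam1 + l)) = med i j l)
    (hD : RExpr.blockExpr.deg + 10 ≤ D) :
    ∃ G s', Runs W I ρ (.seq (fill (.var 22) (.var 19) (.var 1 / .var 21 * .var 8))
        (fill (.var 26) (.var 19 + .var 22) RExpr.blockExpr)) s s'
        (14 + (P.Wd + P.KM) * (RExpr.blockExpr.cost + 20)) ∧ Ready P Q s' ∧
      s'.mem = memFill s.mem P.bD G (P.Wd + P.KM) ∧
      BlockTable med P.g P.inf P.N (P.M1 - 1) P.lam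
        (fun i j l => G (i * P.Wd + j * P.lam1 + l)) := by
  have hinfQ : P.inf ≤ Q := by
    have := hs.bdd.reg 15 (by norm_num)
    rwa [hs.reg 15 (by norm_num) (by norm_num) (by norm_num)] at this
  have hL : P.lam1 = P.lam + 1 := hP.lam1
  have hWd : P.Wd = P.M1 * P.lam1 := hP.Wd
  have hM1 : 1 ≤ P.M1 := by rw [hP.M1]; exact Nat.le_add_left _ _
  have v21 : ∀ S, P.Regs S → (RExpr.var 21).eval I S = P.lam1 := fun S hS =>
    hS.eval_var (by norm_num) (by norm_num) (by norm_num)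
  have v8 : ∀ S, P.Regs S → (RExpr.var 8).eval I S = P.g := fun S hS =>
    hS.eval_var (by norm_num) (by norm_num) (by norm_num)
  obtain ⟨G₀, s₁, r₁, hs₁, m₁, e₁⟩ := runs_fill_ready (ρ := ρ) h hs (x := 22) (K := P.Wd) (b := P.bD)
    (base := .var 19) (e := RExpr.var 1 / RExpr.var 21 * RExpr.var 8) (by norm_num) (by norm_num) (by norm_num) rfl
    (by omega) (show 1 + 2 ≤ D by omega) (show 1 + 1 + 1 + 1 + 1 ≤ D by omega)
    (fun S hS => hS.eval_var (by norm_num) (by norm_num) (by norm_num))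
    (fun k hk S hS h1 => by
      rw [RExpr.eval_mul, RExpr.eval_div, v21 S hS, v8 S hS, eval_var_one, h1]
      refine le_trans (Nat.mul_le_mul (Nat.div_le_of_le_mul ?_) le_rfl) hmQ
      rw [hWd, mul_comm] at hk
      exact hk.le)
  obtain ⟨G₁, s₂, r₂, hs₂, m₂, e₂⟩ := runs_fill_ready (ρ := ρ) h hs₁ (x := 26) (K := P.KM)
    (b := P.bD + P.Wd)
    (base := RExpr.var 19 + RExpr.var 22) (e := RExpr.blockExpr) (by norm_num) (by norm_num) (by norm_num) rfl
    (by omega) (show 1 + 1 + 1 + 2 ≤ D by omega) (by omega)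
    (fun S hS => by
      rw [RExpr.eval_add, hS.eval_var (by norm_num) (by norm_num) (by norm_num),
        hS.eval_var (by norm_num) (by norm_num) (by norm_num)]; rfl)
    (fun k _ S hS _ => by
      rw [RExpr.blockExpr, RExpr.eval_emin]
      refine (min_le_left _ _).trans ?_
      rw [hS.eval_var (by norm_num) (by norm_num) (by norm_num)]
      exact hinfQ)
  set G : ℕ → ℕ := fun x => if x < P.Wd then G₀ x else G₁ (x - P.Wd) with hGd
  have cell : ∀ j < P.M1, ∀ l ≤ P.lam, j * P.lam1 + l < P.Wd := by
    intro j hj l hl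
    calc j * P.lam1 + l < (j + 1) * P.lam1 := by rw [add_mul]; omega
      _ ≤ P.Wd := by rw [hWd]; exact Nat.mul_le_mul hj le_rfl
  -- One formula covers all three recurrences. The cell before `(j, l)` in memory is `(j, l - 1)`,
  -- or `(j - 1, lam)` for `l = 0`, where the insertion of a grid cell costs `g`; for `j = l = 0` it
  -- belongs to the previous row and is excluded by the penalty.
  have key : ∀ i < P.N, ∀ j < P.M1, ∀ l ≤ P.lam, G ((i + 1) * P.Wd + j * P.lam1 + l) = min P.inf
      (min (G ((i + 1) * P.Wd + j * P.lam1 + l - 1) + P.g * (1 - l) + P.inf * (1 - (l + j)))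
        (G (i * P.Wd + (j - l) * P.lam1 + P.lam) + med i (j - l) l + P.inf * (l - j))) := by
    intro i hi j hj l hl
    have hc := cell j hj l hl
    have hc' := cell (j - l) (by omega) l hl
    have hc'' := cell (j - l) (by omega) P.lam le_rfl
    have hlt : i * P.Wd + (j * P.lam1 + l) < P.KM := by
      rw [hP.KM]
      calc i * P.Wd + (j * P.lam1 + l) < (i + 1) * P.Wd := by rw [add_mul]; omega
        _ ≤ P.N * P.Wd := Nat.mul_le_mul hi le_rfl
    obtain ⟨S, hS, h1, hm, he⟩ := e₂ _ hlt
    have d1 : (i * P.Wd + (j * P.lam1 + l)) / P.Wd = i := by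
      rw [Nat.add_comm, Nat.add_mul_div_right _ _ (by omega), Nat.div_eq_of_lt hc, zero_add]
    have d2 : (i * P.Wd + (j * P.lam1 + l)) % P.Wd = j * P.lam1 + l := by
      rw [Nat.add_comm, Nat.add_mul_mod_self_right, Nat.mod_eq_of_lt hc]
    have d3 : (j * P.lam1 + l) / P.lam1 = j := by
      rw [Nat.add_comm, Nat.add_mul_div_right _ _ (by omega), Nat.div_eq_of_lt (by omega), zero_add]
    have d4 : (j * P.lam1 + l) % P.lam1 = l := by
      rw [Nat.add_comm, Nat.add_mul_mod_self_right, Nat.mod_eq_of_lt (by omega)]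
    have hrd : ∀ x < P.Wd + (i * P.Wd + (j * P.lam1 + l)), S.mem (P.bD + x) = G x := by
      intro x hx
      rw [hm, m₁, memFill_append, memFill_lt hx]
    -- The medians lie below the table that is being filled and are still intact.
    have hrm : S.mem (P.bM + (i * P.Wd + (j - l) * P.lam1 + l)) = med i (j - l) l := by
      have hlt' : i * P.Wd + (j - l) * P.lam1 + l < P.KM := by
        rw [hP.KM]
        calc i * P.Wd + (j - l) * P.lam1 + l < (i + 1) * P.Wd := by rw [add_mul]; omega
          _ ≤ P.N * P.Wd := Nat.mul_le_mul hi le_rfl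
      have hbD := hP.bD
      rw [hm, m₁, memFill_append, memFill_of_lt (by omega), hmed i hi (j - l) (by omega) l hl]
    have hG : G ((i + 1) * P.Wd + j * P.lam1 + l) = G₁ (i * P.Wd + (j * P.lam1 + l)) := by
      simp only [hGd, add_mul, one_mul]
      rw [if_neg (by omega)]
      congr 1; omega
    rw [hG, ← he]
    have v15 : (RExpr.var 15).eval I S = P.inf :=
      hS.eval_var (by norm_num) (by norm_num) (by norm_num)
    have v22 : (RExpr.var 22).eval I S = P.Wd :=
      hS.eval_var (by norm_num) (by norm_num) (by norm_num)
    have v19 : (RExpr.var 19).eval I S = P.bD :=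
      hS.eval_var (by norm_num) (by norm_num) (by norm_num)
    have v18 : (RExpr.var 18).eval I S = P.bM :=
      hS.eval_var (by norm_num) (by norm_num) (by norm_num)
    have v10 : (RExpr.var 10).eval I S = P.lam :=
      hS.eval_var (by norm_num) (by norm_num) (by norm_num)
    simp only [RExpr.blockExpr, RExpr.eval_emin, RExpr.eval_add, RExpr.eval_mul, RExpr.eval_sub,
      RExpr.eval_div, RExpr.eval_emod, RExpr.eval_rd, eval_var_one, h1, RExpr.eval_ofNat, d1, d2,
      d3, d4, v15, v22, v21 S hS, v19, v18,
      v8 S hS, v10]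
    rw [hrm, hrd _ (by omega),
      show P.bD + P.Wd + (i * P.Wd + (j * P.lam1 + l)) - 1 =
        P.bD + (P.Wd + (i * P.Wd + (j * P.lam1 + l)) - 1) by omega,
      hrd _ (by omega), show (i + 1) * P.Wd + j * P.lam1 + l - 1 =
        P.Wd + (i * P.Wd + (j * P.lam1 + l)) - 1 by rw [add_mul, one_mul]; omega]
  refine ⟨G, s₂, (r₁.seq r₂).mono ?_, hs₂, by rw [m₂, m₁, memFill_append], ?_, ?_, ?_, ?_⟩
  · change 7 + P.Wd * (1 + (1 + 1 + 1 + 1 + 1) + 12) + (7 + P.KM * (1 + 1 + 1 + _ + 12)) ≤ _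
    rw [add_mul]
    have a1 : P.Wd * (1 + (1 + 1 + 1 + 1 + 1) + 12) ≤
      P.Wd * (RExpr.blockExpr.cost + 20) := Nat.mul_le_mul le_rfl (by omega)
    have a2 : P.KM * (1 + 1 + 1 + RExpr.blockExpr.cost + 12) ≤
      P.KM * (RExpr.blockExpr.cost + 20) := Nat.mul_le_mul le_rfl (by omega)
    omega
  · intro j hj l hl
    have hc := cell j (by omega) l hl
    obtain ⟨S, hS, h1, hm, he⟩ := e₁ _ hc
    simp only [hGd, zero_mul, zero_add, hc, if_true]
    rw [← he, RExpr.eval_mul, RExpr.eval_div, v21 S hS, v8 S hS, eval_var_one, h1]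
    rw [Nat.add_comm (j * P.lam1), Nat.add_mul_div_right _ _ (by omega),
      Nat.div_eq_of_lt (by omega), zero_add]
  · intro i hi j hj l hl
    rw [key i hi j (by omega) (l + 1) hl, show 1 - (l + 1) = 0 by omega,
      show 1 - (l + 1 + j) = 0 by omega]
    rfl
  · intro i hi j hj
    rw [key i hi (j + 1) (by omega) 0 (by omega), show 1 - (0 + (j + 1)) = 0 by omega,
      show (i + 1) * P.Wd + (j + 1) * P.lam1 + 0 - 1 = (i + 1) * P.Wd + j * P.lam1 + P.lam by
        rw [add_mul j]; omega]
    simp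
  · intro i hi
    rw [key i hi 0 (by omega) 0 (by omega)]
    simp only [zero_mul, add_zero, mul_one, Nat.sub_zero, mul_zero, Nat.sub_self]
    omega

end


/-! ### The whole program -/

theorem medianUpTo_congr {h R pen : ℕ} {v v' : ℕ → ℕ} (hv : ∀ j < R, v j = v' j) {k : ℕ}
    (hk : k ≤ R) : medianUpTo h R pen v k = medianUpTo h R pen v' k := by
  induction k with
  | zero => rfl
  | succ k ih =>
    rw [medianUpTo, medianUpTo, ih (by omega), hv k (by omega)]
    rw [Finset.sum_congr rfl fun j hj => by rw [hv j (Finset.mem_range.1 hj)]]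

/-- The coins of the `r`-th repetition. -/
def shiftCoins (Z r : ℕ) (ρ : ℕ → Bool) : ℕ → Bool := fun y => ρ (r * Z + y)

/-- A bound for the degrees of the expressions in the program. -/
def degBound (r v h C c : ℕ) : ℕ :=
  initBound r + ((paramList v (2 * h + 1) C c).map fun a => a.2.deg).sum +
    (RExpr.coinBase (2 * h + 1)).deg + (RExpr.blockInput (2 * h + 1) 0).deg +
    (RExpr.gridInput (2 * h + 1) 0).deg + (RExpr.queryInput (2 * h + 1) 0).deg +
    (RExpr.queryInput (2 * h + 1) 1).deg + (RExpr.medianExpr h (2 * h + 1)).deg +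
    RExpr.blockExpr.deg + RExpr.bandInit.deg + RExpr.bandExpr.deg + RExpr.resultExpr.deg + 50

/-- A bound for the costs of the expressions in the relocated programs. -/
def callCost (h : ℕ) : ℕ :=
  (RExpr.coinBase (2 * h + 1)).cost + (RExpr.blockInput (2 * h + 1) 0).cost +
    (RExpr.gridInput (2 * h + 1) 0).cost + (RExpr.queryInput (2 * h + 1) 0).cost +
    (RExpr.queryInput (2 * h + 1) 1).cost + 50

/-- The running time is at most this constant times the number of steps of the loops. -/
def costBound (r v h C c B : ℕ) : ℕ :=
  initBound r + ((paramList v (2 * h + 1) C c).map fun a => a.2.cost + 1).sum +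
    20 * (callCost h + B) + (RExpr.medianExpr h (2 * h + 1)).cost +
    RExpr.blockExpr.cost + RExpr.bandInit.cost + RExpr.bandExpr.cost + RExpr.resultExpr.cost + 500

/-- The program without preprocessing. -/
def mainProg (r v h C c B : ℕ) (pA pB q : Prog) : Prog :=
  .seq (initLoop r) (.seq (assigns (paramList v (2 * h + 1) C c))
    (.seq (callLoop pA B (.var 24) 0 (RExpr.coinBase (2 * h + 1)) (.var 14) (.var 9)
      (RExpr.blockInput (2 * h + 1)))
    (.seq (callLoop pB B (.var 25) (.var 16) (RExpr.coinBase (2 * h + 1)) (.var 14) (.var 9)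
      (RExpr.gridInput (2 * h + 1)))
    (.seq (callLoop q B (.var 27) (.var 17) (RExpr.coinBase (2 * h + 1)) (.var 14) (.var 9)
      (RExpr.queryInput (2 * h + 1)))
    (.seq (fill (.var 26) (.var 18) (RExpr.medianExpr h (2 * h + 1)))
    (.seq (.seq (fill (.var 22) (.var 19) (.var 1 / .var 21 * .var 8))
        (fill (.var 26) (.var 19 + .var 22) RExpr.blockExpr))
    (.seq (.seq (fill (.var 23) (.var 20) RExpr.bandInit)
        (fill (.var 28) (.var 20 + .var 23) RExpr.bandExpr))
      (assign 0 RExpr.resultExpr))))))))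

section
variable {W Q D : ℕ} {I : ℕ → ℕ → ℕ} {ρ : ℕ → Bool} {P : Params} {v R C c : ℕ}

theorem eval_coinBase {S : MState} (hS : P.Regs S) (R : ℕ) :
    (RExpr.coinBase R).eval I S = S.reg 1 % R * P.Z := by
  rw [RExpr.coinBase, RExpr.eval_mul, RExpr.eval_emod, RExpr.eval_const, eval_var_one,
    hS.eval_var (by norm_num) (by norm_num) (by norm_num)]
  rfl

theorem mul_add_div {a b n : ℕ} (h : b < n) : (a * n + b) / n = a := by
  rw [Nat.add_comm, Nat.add_mul_div_right _ _ (by omega), Nat.div_eq_of_lt h, zero_add]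

theorem mul_add_mod_eq {a b n : ℕ} (h : b < n) : (a * n + b) % n = b := by
  rw [Nat.add_comm, Nat.add_mul_mod_self_right, Nat.mod_eq_of_lt h]

theorem mul_add_lt_mul {a b n k : ℕ} (ha : a < k) (hb : b < n) : a * n + b < k * n :=
  calc a * n + b < (a + 1) * n := by rw [add_mul]; omega
    _ ≤ k * n := Nat.mul_le_mul ha le_rfl

theorem eval_blockInput {S : MState} (hS : P.Regs S) {A : List ℕ} (hI : I 0 = strArray A)
    (hlA : P.lA = A.length) (R i : ℕ) : (RExpr.blockInput R i).eval I S =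
      inputs (strArray (block A P.d (S.reg 1 / R))) 0 i (S.reg 98) := by
  cases i with
  | zero =>
    have v7 : (RExpr.var 7).eval I S = P.d :=
      hS.eval_var (by norm_num) (by norm_num) (by norm_num)
    refine RExpr.eval_windowInput hI ?_ v7 ?_
    · rw [RExpr.eval_mul, RExpr.eval_div, eval_var_one, RExpr.eval_const, v7]
    · rw [hS.eval_var (by norm_num) (by norm_num) (by norm_num)]; exact hlA
  | succ i => rcases i with _ | i <;> rfl

theorem eval_gridInput {S : MState} (hS : P.Regs S) {B : List ℕ} (hI : I 1 = strArray B)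
    (hlB : P.lB = B.length) (R i : ℕ) : (RExpr.gridInput R i).eval I S =
      inputs (strArray (window B P.g (S.reg 1 / R / P.lam1) (S.reg 1 / R % P.lam1))) 0 i
        (S.reg 98) := by
  cases i with
  | zero =>
    have v8 : (RExpr.var 8).eval I S = P.g :=
      hS.eval_var (by norm_num) (by norm_num) (by norm_num)
    have v21 : (RExpr.var 21).eval I S = P.lam1 :=
      hS.eval_var (by norm_num) (by norm_num) (by norm_num)
    refine RExpr.eval_windowInput hI ?_ ?_ ?_
    · rw [RExpr.eval_mul, RExpr.eval_div, RExpr.eval_div, eval_var_one, RExpr.eval_const, v8, v21]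
    · rw [RExpr.eval_mul, RExpr.eval_emod, RExpr.eval_div, eval_var_one, RExpr.eval_const, v8, v21]
    · rw [hS.eval_var (by norm_num) (by norm_num) (by norm_num)]; exact hlB
  | succ i => rcases i with _ | i <;> rfl

theorem memFill_record {m : ℕ → ℕ} {b V K k y : ℕ} {sf : ℕ → MState} (hk : k < K) (hy : y ≤ V + 1) :
    memFill m b (fun x => (sf (x / (V + 2))).record V (x % (V + 2))) (K * (V + 2))
      (b + (k * (V + 2) + y)) = (sf k).record V y := by
  rw [memFill_lt (mul_add_lt_mul hk (by omega)), mul_add_div (by omega), mul_add_mod_eq (by omega)]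

theorem callLoop_time {κ B K T X : ℕ} (hX : 20 * (κ + B) + 100 ≤ X) :
    κ + 6 + K * ((κ + 10) * T + B + 4 * κ + 28) ≤ X * (1 + K * (T + 1)) := by
  have h1 : (κ + 10) * T + B + 4 * κ + 28 ≤ X * (T + 1) := by
    calc (κ + 10) * T + B + 4 * κ + 28 ≤ X * T + X := by
          have := Nat.mul_le_mul (show κ + 10 ≤ X by omega) (le_refl T)
          omega
      _ = X * (T + 1) := by ring
  calc κ + 6 + K * ((κ + 10) * T + B + 4 * κ + 28) ≤ X + K * (X * (T + 1)) := by
        have := Nat.mul_le_mul (le_refl K) h1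
        omega
    _ = X * (1 + K * (T + 1)) := by ring

/-- Call number `k` of a loop belongs to the object `k / R` and the repetition `k % R`, with the
coins from `k % R * Z` on. All three loops use this rule, so a query finds the results of
preprocessing with the very same coins. The final formula takes the band value if it is at most
`P.k` and the value of the block table otherwise. -/
theorem runs_mainProg {r n h Breg W₀ V TA TQ : ℕ} {pA pB q : Prog} {A B : List ℕ}
    {sA sB : List ℕ → (ℕ → Bool) → MState} {sQ : List ℕ → List ℕ → (ℕ → Bool) → MState}
    (hw : WordOK W Q D I) (hD : degBound r v h C c ≤ D) (hP : P.Valid v (2 * h + 1) C c)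
    (hPn : P.n = n) (hPb : P.b = Nat.findGreatest (fun x => x ^ r ≤ n) n)
    (hPm : P.m = ∑ i ∈ Finset.range n, (I 0 (i + 1) + I 1 (i + 1)))
    (hlA : P.lA = A.length) (hlB : P.lB = B.length) (hIA : I 0 = strArray A) (hIB : I 1 = strArray B)
    (hQ : ∀ x, P.par x ≤ Q) (hRZ : (2 * h + 1) * P.Z ≤ Q) (hMg : P.M1 * P.g ≤ Q)
    (hZ : P.Z = V + 2) (hWV : W₀ ≤ V) (hLV : P.L ≤ V) (hB0 : 0 < Breg) (hpA : pA.RegsBelow Breg)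
    (hpB : pB.RegsBelow Breg) (hq : q.RegsBelow Breg)
    (hA : ∀ i < P.N, ∀ ρ', ∃ t ≤ TA, Exec W₀ (inputs (strArray (block A P.d i)) 0) ρ' pA
      (MState.init P.L) (sA (block A P.d i) ρ') t)
    (hB : ∀ j < P.M1, ∀ l ≤ P.lam, ∀ ρ', ∃ t ≤ TA, Exec W₀ (inputs (strArray (window B P.g j l)) 0) ρ'
      pB (MState.init P.L) (sB (window B P.g j l) ρ') t)
    (hQq : ∀ i < P.N, ∀ j < P.M1, ∀ l ≤ P.lam, ∀ ρ', ∃ t ≤ TQ, Exec W₀ (inputs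
      (sA (block A P.d i) ρ').mem (sB (window B P.g j l) ρ').mem) ρ' q (MState.init P.L)
      (sQ (block A P.d i) (window B P.g j l) ρ') t) :
    ∃ G D' s', Runs W I ρ (mainProg r v h C c Breg pA pB q) (MState.init n) s'
        (costBound r v h C c Breg * (n + P.KA * (TA + 1) + P.KB * (TA + 1) + P.KQ * (TQ + 1) +
          2 * P.KM + P.Wd + P.w + P.KF + 12)) ∧
      BandTable A B P.k P.inf G ∧
      BlockTable (fun i j l => medianUpTo h (2 * h + 1) V (fun r => (sQ (block A P.d i)
        (window B P.g j l) (shiftCoins P.Z r ρ)).reg 0) (2 * h + 1))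
        P.g P.inf P.N (P.M1 - 1) P.lam D' ∧
      s'.reg 0 = bandValue A B P.k P.inf G * (1 - (bandValue A B P.k P.inf G - P.k)) +
        D' P.N (P.M1 - 1) P.lam * min 1 (bandValue A B P.k P.inf G - P.k) := by
  set R := 2 * h + 1 with hR
  set κ := callCost h with hκ
  set X := costBound r v h C c Breg with hX
  have hdeg := hD
  rw [degBound, ← hR] at hdeg
  have hκ' := hκ
  rw [callCost, ← hR] at hκ'
  have hX' := hX
  rw [costBound, ← hR, ← hκ] at hX'
  have hVQ : V ≤ Q := by have := hQ 14; simp only [Params.par] at this; omega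
  -- All the coins lie in the first `R` blocks of length `Z`.
  have hcb : ∀ k, k % R * P.Z + V ≤ Q := fun k => by
    have h1 : k % R * P.Z + V < R * P.Z := mul_add_lt_mul (Nat.mod_lt _ (by omega)) (by omega)
    omega
  have hinit := runs_initLoop (ρ := ρ) (n := n) hw (r := r)
    (by have := hQ 0; simp only [Params.par, hPn] at this; exact this)
    (by rw [← hPm]; exact hQ 4) (by omega)
  rw [← hPb, ← hPm] at hinit
  set s₀ := (((MState.init n).setReg 3 P.b).setReg 4 P.m).counters n 0 with hs₀
  have hb₀ : s₀.Bdd Q := by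
    have hn : n ≤ Q := by have := hQ 0; simp only [Params.par, hPn] at this; exact this
    refine MState.Bdd.counters (MState.Bdd.setReg (MState.Bdd.setReg ⟨fun x _ => ?_,
      fun a => Nat.zero_le _⟩ (hQ 3) 3) (hQ 4) 4) hn (Nat.zero_le _)
    exact (MState.Within.init hn).reg x
  have hpar := runs_assigns (ρ := ρ) hw hQ (paramList v R C c) (fun a ha => by
      have := List.single_le_sum (l := (paramList v R C c).map fun a => a.2.deg)
        (fun _ _ => Nat.zero_le _) _ (List.mem_map_of_mem (f := fun a => a.2.deg) ha)
      omega) s₀ hb₀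
    (hP.computes (by simp [hs₀, MState.init, hPn]) (by simp [hs₀]) (by simp [hs₀])
      (by rw [hIA, hlA]; rfl) (by rw [hIB, hlB]; rfl))
  set s₁ := s₀.setRegs P.par (paramList v R C c) with hs₁
  have hm₁ : s₁.mem = fun _ => 0 := by rw [hs₁, MState.setRegs_mem]; rfl
  have ready₁ : Ready P Q s₁ := by
    have hreg : ∀ x, x ≠ 1 → x ≠ 2 → s₁.reg x = P.par x := by
      intro x h1 h2
      rw [hs₁, MState.setRegs_reg]
      split
      · rfl
      · rename_i hx
        simp only [hs₀, MState.counters_reg, MState.setReg_reg, h1, h2, if_false, MState.init,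
          Function.update_apply]
        rcases lt_or_ge x 29 with hlt | hge
        · interval_cases x <;> simp [paramList] at hx ⊢ <;> simp [Params.par, hPn] at *
        · obtain ⟨y, rfl⟩ : ∃ y, x = y + 29 := ⟨x - 29, by omega⟩
          rw [if_neg (by omega), if_neg (by omega), if_neg (by omega)]
          rfl
    refine ⟨fun x _ h1 h2 => hreg x h1 h2, fun x _ => ?_, fun a => by rw [hm₁]; exact Nat.zero_le _⟩
    by_cases h12 : x = 1 ∨ x = 2
    · rw [hs₁, MState.setRegs_reg]
      split
      · exact hQ x
      · exact hb₀.reg x (by omega)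
    · rw [hreg x (by omega) (by omega)]; exact hQ x
  have hL1 : P.lam1 = P.lam + 1 := hP.lam1
  have hR0 : 0 < R := by omega
  -- preprocessing of the blocks
  obtain ⟨s₂, r₂, ready₂, hm₂⟩ := runs_callLoop_ready (ρ := ρ) (p := pA) (B := Breg) (κ := κ)
    (T := TA) (x := 24) (K := P.KA) (b := 0) (base := 0) (cbE := RExpr.coinBase R)
    (inE := RExpr.blockInput R) (V := V) (W₀ := W₀) (n := P.L)
    (sf := fun k => sA (block A P.d (k / R)) (shiftCoins P.Z (k % R) ρ))
    (inp := fun k => inputs (strArray (block A P.d (k / R))) 0) (cb := fun k => k % R * P.Z)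
    hw ready₁ hWV hLV hVQ hB0 hpA (fun a _ => by rw [hm₁]) (fun k _ => hcb k) (by norm_num)
    (by norm_num) (by norm_num) rfl hZ rfl (fun S _ => rfl)
    (fun k _ S hS h1 => by rw [eval_coinBase hS, h1])
    (fun k _ S hS h1 _ _ i => by rw [eval_blockInput hS hIA hlA, h1])
    (show 0 + 12 ≤ D by omega) (by omega)
    (fun i => by
      cases i with
      | zero => omega
      | succ i => exact Nat.zero_le _) (show 1 + 4 ≤ κ by omega) (by omega)
    (fun i => by
      cases i with
      | zero => omega
      | succ i => show 1 ≤ κ; omega)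
    (fun k hk => hA (k / R) (Nat.div_lt_of_lt_mul (by rwa [hP.KA, mul_comm] at hk)) _)
  -- preprocessing of the windows
  have hbB : P.bB = P.KA * (V + 2) := by rw [hP.bB, hZ]
  have hKB : ∀ k < P.KB, k / R / P.lam1 < P.M1 ∧ k / R % P.lam1 ≤ P.lam := by
    intro k hk
    refine ⟨Nat.div_lt_of_lt_mul (Nat.div_lt_of_lt_mul ?_), ?_⟩
    · rwa [hP.KB, hP.Wd, mul_comm, mul_comm P.M1] at hk
    · have := Nat.mod_lt (k / R) (show P.lam1 > 0 by omega)
      omega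
  obtain ⟨s₃, r₃, ready₃, hm₃⟩ := runs_callLoop_ready (ρ := ρ) (p := pB) (B := Breg) (κ := κ)
    (T := TA) (x := 25) (K := P.KB) (b := P.bB) (base := .var 16) (cbE := RExpr.coinBase R)
    (inE := RExpr.gridInput R) (V := V) (W₀ := W₀) (n := P.L)
    (sf := fun k => sB (window B P.g (k / R / P.lam1) (k / R % P.lam1)) (shiftCoins P.Z (k % R) ρ))
    (inp := fun k => inputs (strArray (window B P.g (k / R / P.lam1) (k / R % P.lam1))) 0)
    (cb := fun k => k % R * P.Z)
    hw ready₂ hWV hLV hVQ hB0 hpB (fun a ha => by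
      rw [hm₂, memFill_of_ge (by omega), hm₁]) (fun k _ => hcb k) (by norm_num)
    (by norm_num) (by norm_num) rfl hZ rfl
    (fun S hS => hS.eval_var (by norm_num) (by norm_num) (by norm_num))
    (fun k _ S hS h1 => by rw [eval_coinBase hS, h1])
    (fun k _ S hS h1 _ _ i => by rw [eval_gridInput hS hIB hlB, h1])
    (show 1 + 12 ≤ D by omega) (by omega)
    (fun i => by
      cases i with
      | zero => omega
      | succ i => exact Nat.zero_le _) (show 1 + 4 ≤ κ by omega) (by omega)
    (fun i => by
      cases i with
      | zero => omega
      | succ i => show 1 ≤ κ; omega)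
    (fun k hk => hB _ (hKB k hk).1 _ (hKB k hk).2 _)
  -- queries
  have hbQ : P.bQ = P.bB + P.KB * (V + 2) := by rw [hP.bQ, hZ]
  have hKQ : ∀ k < P.KQ, k / R / P.Wd < P.N ∧ k / R % P.Wd / P.lam1 < P.M1 ∧
      k / R % P.Wd % P.lam1 ≤ P.lam := by
    intro k hk
    rw [hP.KQ, hP.KM] at hk
    have h1 : k / R < P.Wd * P.N := by
      rw [mul_comm P.Wd]; exact Nat.div_lt_of_lt_mul (by rwa [mul_comm] at hk)
    have hWd0 : 0 < P.Wd := Nat.pos_of_ne_zero fun h0 => by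
      rw [h0, zero_mul] at h1; exact absurd h1 (Nat.not_lt_zero _)
    have h2 := Nat.mod_lt (k / R) hWd0
    refine ⟨Nat.div_lt_of_lt_mul h1, Nat.div_lt_of_lt_mul ?_, ?_⟩
    · rw [mul_comm, ← hP.Wd]; exact h2
    · have := Nat.mod_lt (k / R % P.Wd) (show P.lam1 > 0 by omega)
      omega
  obtain ⟨s₄, r₄, ready₄, hm₄⟩ := runs_callLoop_ready (ρ := ρ) (p := q) (B := Breg) (κ := κ)
    (T := TQ) (x := 27) (K := P.KQ) (b := P.bQ) (base := .var 17) (cbE := RExpr.coinBase R)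
    (inE := RExpr.queryInput R) (V := V) (W₀ := W₀) (n := P.L)
    (sf := fun k => sQ (block A P.d (k / R / P.Wd)) (window B P.g (k / R % P.Wd / P.lam1)
      (k / R % P.Wd % P.lam1)) (shiftCoins P.Z (k % R) ρ))
    (inp := fun k => inputs (sA (block A P.d (k / R / P.Wd)) (shiftCoins P.Z (k % R) ρ)).mem
      (sB (window B P.g (k / R % P.Wd / P.lam1) (k / R % P.Wd % P.lam1))
        (shiftCoins P.Z (k % R) ρ)).mem)
    (cb := fun k => k % R * P.Z)
    hw ready₃ hWV hLV hVQ hB0 hq (fun a ha => by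
      rw [hm₃, memFill_of_ge (by omega), hm₂, memFill_of_ge (by omega), hm₁])
    (fun k _ => hcb k) (by norm_num)
    (by norm_num) (by norm_num) rfl hZ rfl
    (fun S hS => hS.eval_var (by norm_num) (by norm_num) (by norm_num))
    (fun k _ S hS h1 => by rw [eval_coinBase hS, h1])
    (fun k hk S hS h1 hmem h98 i => by
      have hk' := hKQ k hk
      have hr := Nat.mod_lt k hR0
      have v14 : (RExpr.var 14).eval I S = V + 2 :=
        (hS.eval_var (by norm_num) (by norm_num) (by norm_num)).trans hZ
      have v22 : (RExpr.var 22).eval I S = P.Wd :=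
        hS.eval_var (by norm_num) (by norm_num) (by norm_num)
      have v16 : (RExpr.var 16).eval I S = P.bB :=
        hS.eval_var (by norm_num) (by norm_num) (by norm_num)
      have v98 : (RExpr.var 98).eval I S = S.reg 98 := rfl
      rcases i with _ | _ | i
      -- The memory for block `i` in repetition `r` is record number `i * R + r` of the first loop;
      -- the second loop wrote only above it.
      · simp only [RExpr.queryInput, RExpr.eval_rd, RExpr.eval_add, RExpr.eval_mul, RExpr.eval_div,
          RExpr.eval_emod, RExpr.eval_const, eval_var_one, v14, v22, v98, h1]
        have hlt : k / R / P.Wd * R + k % R < P.KA := by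
          rw [hP.KA]; exact mul_add_lt_mul hk'.1 hr
        have hlt' : (k / R / P.Wd * R + k % R) * (V + 2) + S.reg 98 < P.KA * (V + 2) :=
          mul_add_lt_mul hlt (by omega)
        rw [hmem _ (by omega), hm₃, memFill_of_lt (by omega), hm₂]
        have := memFill_record (m := s₁.mem) (b := 0) (V := V) (K := P.KA) (y := S.reg 98)
          (sf := fun k => sA (block A P.d (k / R)) (shiftCoins P.Z (k % R) ρ)) hlt (by omega)
        rw [zero_add] at this
        rw [this, mul_add_div hr, mul_add_mod_eq hr, MState.record, if_pos h98]
        rfl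
      · simp only [RExpr.queryInput, RExpr.eval_rd, RExpr.eval_add, RExpr.eval_mul, RExpr.eval_div,
          RExpr.eval_emod, RExpr.eval_const, eval_var_one, v14, v22, v16, v98, h1]
        have hWd0 : 0 < P.Wd := by
          rw [hP.Wd]; exact Nat.mul_pos ((Nat.zero_le _).trans_lt hk'.2.1) (by omega)
        have hlt : k / R % P.Wd * R + k % R < P.KB := by
          rw [hP.KB]; exact mul_add_lt_mul (Nat.mod_lt _ hWd0) hr
        have hlt' : (k / R % P.Wd * R + k % R) * (V + 2) + S.reg 98 < P.KB * (V + 2) :=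
          mul_add_lt_mul hlt (by omega)
        have := memFill_record (m := s₂.mem) (b := P.bB) (V := V) (K := P.KB) (y := S.reg 98)
          (sf := fun k => sB (window B P.g (k / R / P.lam1) (k / R % P.lam1))
            (shiftCoins P.Z (k % R) ρ)) hlt (by omega)
        rw [hmem _ (by omega), hm₃, add_assoc, this, mul_add_div hr,
          mul_add_mod_eq hr, MState.record, if_pos h98]
        rfl
      · rfl)
    (show 1 + 12 ≤ D by omega) (by omega)
    (fun i => by
      rcases i with _ | _ | i
      · omega
      · show (RExpr.queryInput R 1).deg ≤ D
        omega
      · exact Nat.zero_le _) (show 1 + 4 ≤ κ by omega) (by omega)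
    (fun i => by
      rcases i with _ | _ | i
      · omega
      · show (RExpr.queryInput R 1).cost ≤ κ
        omega
      · show 1 ≤ κ; omega)
    (fun k hk => hQq _ (hKQ k hk).1 _ (hKQ k hk).2.1 _ (hKQ k hk).2.2 _)
  -- medians
  have hbM : P.bM = P.bQ + P.KQ * (V + 2) := by rw [hP.bM, hZ]
  obtain ⟨Gm, s₅, r₅, ready₅, hm₅, hGm⟩ := runs_fill_ready (ρ := ρ) hw ready₄ (x := 26) (K := P.KM)
    (b := P.bM) (base := .var 18) (e := RExpr.medianExpr h R) (by norm_num) (by norm_num)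
    (by norm_num) rfl (by omega) (show 1 + 2 ≤ D by omega) (by omega)
    (fun S hS => hS.eval_var (by norm_num) (by norm_num) (by norm_num))
    (fun k _ S hS _ => by
      rw [RExpr.medianExpr, RExpr.eval_medianUpTo]
      refine (medianUpTo_le_pen _ _ _ _ _).trans ?_
      rw [RExpr.eval_sub, hS.eval_var (by norm_num) (by norm_num) (by norm_num)]
      exact (Nat.sub_le _ _).trans (hQ 14))
  have hmed : ∀ i < P.N, ∀ j < P.M1, ∀ l ≤ P.lam,
      s₅.mem (P.bM + (i * P.Wd + j * P.lam1 + l)) = medianUpTo h R V (fun r => (sQ (block A P.d i)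
        (window B P.g j l) (shiftCoins P.Z r ρ)).reg 0) R := by
    intro i hi j hj l hl
    have hc : j * P.lam1 + l < P.Wd := by rw [hP.Wd]; exact mul_add_lt_mul hj (by omega)
    have hlt : i * P.Wd + (j * P.lam1 + l) < P.KM := by rw [hP.KM]; exact mul_add_lt_mul hi hc
    obtain ⟨S, hS, h1, hmS, he⟩ := hGm _ hlt
    have v14 : (RExpr.var 14).eval I S = V + 2 :=
      (hS.eval_var (by norm_num) (by norm_num) (by norm_num)).trans hZ
    have v17 : (RExpr.var 17).eval I S = P.bQ :=
      hS.eval_var (by norm_num) (by norm_num) (by norm_num)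
    rw [hm₅, add_assoc (i * P.Wd), memFill_lt hlt, ← he, RExpr.medianExpr, RExpr.eval_medianUpTo,
      RExpr.eval_sub, v14, RExpr.eval_ofNat, Nat.add_sub_cancel]
    refine medianUpTo_congr (fun r hr => ?_) le_rfl
    simp only [RExpr.eval_rd, RExpr.eval_add, RExpr.eval_mul, RExpr.eval_const, RExpr.eval_sub,
      RExpr.eval_ofNat, eval_var_one, h1, v14, v17]
    have hlt2 : (i * P.Wd + (j * P.lam1 + l)) * R + r < P.KQ := by
      rw [hP.KQ]; exact mul_add_lt_mul hlt hr
    have hlt3 : ((i * P.Wd + (j * P.lam1 + l)) * R + r) * (V + 2) + (V + 1) < P.KQ * (V + 2) :=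
      mul_add_lt_mul hlt2 (by omega)
    -- Cell `V + 1` of a record is the answer of the query, not a cell of its memory.
    have := memFill_record (m := s₃.mem) (b := P.bQ) (V := V) (K := P.KQ) (y := V + 1)
      (sf := fun k => sQ (block A P.d (k / R / P.Wd)) (window B P.g (k / R % P.Wd / P.lam1)
        (k / R % P.Wd % P.lam1)) (shiftCoins P.Z (k % R) ρ)) hlt2 le_rfl
    rw [show V + 2 - 1 = V + 1 by omega, add_assoc P.bQ, hmS, memFill_of_lt (by omega), hm₄,
      this, mul_add_div hr, mul_add_mod_eq hr, mul_add_div hc,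
      mul_add_mod_eq hc, mul_add_div (by omega), mul_add_mod_eq (by omega), MState.record,
      if_neg (by omega)]
  -- dynamic programs
  obtain ⟨Gb, s₆, r₆, ready₆, hm₆, hGb⟩ := runs_block (ρ := ρ) hw hP ready₅ hMg hmed (by omega)
  obtain ⟨Gf, s₇, r₇, ready₇, hm₇, hGf⟩ := runs_band (ρ := ρ) hw hP ready₆ hIA hIB hlA (by omega)
  have hfin := runs_assign (ρ := ρ) hw ready₇.bdd (x := 0) (e := RExpr.resultExpr) (by omega)
  refine ⟨Gf, fun i j l => Gb (i * P.Wd + j * P.lam1 + l), _, (hinit.seq (hpar.seq (r₂.seq (r₃.seq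
    (r₄.seq (r₅.seq (r₆.seq (r₇.seq hfin)))))))).mono ?_, hGf, hGb, ?_⟩
  · have t1 : n * (initBound r + 30) ≤ X * n := by
      rw [mul_comm]; exact Nat.mul_le_mul (by omega) le_rfl
    have t2 := callLoop_time (κ := κ) (B := Breg) (K := P.KA) (T := TA) (X := X) (by omega)
    have t3 := callLoop_time (κ := κ) (B := Breg) (K := P.KB) (T := TA) (X := X) (by omega)
    have t4 := callLoop_time (κ := κ) (B := Breg) (K := P.KQ) (T := TQ) (X := X) (by omega)
    have t5 : P.KM * (1 + (RExpr.medianExpr h R).cost + 12) ≤ X * P.KM := by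
      rw [mul_comm]; exact Nat.mul_le_mul (by omega) le_rfl
    have t6 : (P.Wd + P.KM) * (RExpr.blockExpr.cost + 20) ≤ X * (P.Wd + P.KM) := by
      rw [mul_comm]; exact Nat.mul_le_mul (by omega) le_rfl
    have t7 : (P.w + P.KF) * (RExpr.bandInit.cost + RExpr.bandExpr.cost + 20) ≤
        X * (P.w + P.KF) := by
      rw [mul_comm]; exact Nat.mul_le_mul (by omega) le_rfl
    have t8 : X * (n + P.KA * (TA + 1) + P.KB * (TA + 1) + P.KQ * (TQ + 1) +
          2 * P.KM + P.Wd + P.w + P.KF + 12) = X * n + X * (1 + P.KA * (TA + 1)) +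
          X * (1 + P.KB * (TA + 1)) + X * (1 + P.KQ * (TQ + 1)) + X * P.KM + X * (P.Wd + P.KM) +
          X * (P.w + P.KF) + 9 * X := by ring
    rw [t8]
    change _ + (_ + (_ + (_ + (_ + (7 + P.KM * (1 + (RExpr.medianExpr h R).cost + 12) + _))))) ≤ _
    omega
  · have hreg : ∀ S, P.Regs S → ∀ x < 98, x ≠ 1 → x ≠ 2 → (RExpr.var x).eval I S = P.par x :=
      fun S hS x hx h1 h2 => hS.eval_var hx h1 h2
    have hS : P.Regs s₇ := fun x hx h1 h2 => ready₇.reg x (by omega) h1 h2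
    have v5 : (RExpr.var 5).eval I s₇ = A.length := (hreg _ hS 5 (by norm_num) (by norm_num)
      (by norm_num)).trans hlA
    have v6 : (RExpr.var 6).eval I s₇ = B.length := (hreg _ hS 6 (by norm_num) (by norm_num)
      (by norm_num)).trans hlB
    have v11 : (RExpr.var 11).eval I s₇ = P.k := hreg _ hS 11 (by norm_num) (by norm_num) (by norm_num)
    have v15 : (RExpr.var 15).eval I s₇ = P.inf :=
      hreg _ hS 15 (by norm_num) (by norm_num) (by norm_num)
    have v19 : (RExpr.var 19).eval I s₇ = P.bD :=
      hreg _ hS 19 (by norm_num) (by norm_num) (by norm_num)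
    have v20 : (RExpr.var 20).eval I s₇ = P.bF :=
      hreg _ hS 20 (by norm_num) (by norm_num) (by norm_num)
    have v22 : (RExpr.var 22).eval I s₇ = P.Wd :=
      hreg _ hS 22 (by norm_num) (by norm_num) (by norm_num)
    have v23 : (RExpr.var 23).eval I s₇ = P.w :=
      hreg _ hS 23 (by norm_num) (by norm_num) (by norm_num)
    have v26 : (RExpr.var 26).eval I s₇ = P.KM :=
      hreg _ hS 26 (by norm_num) (by norm_num) (by norm_num)
    have hwk : P.w = 2 * P.k + 2 := hP.w
    have hM1 : 1 ≤ P.M1 := by rw [hP.M1]; exact Nat.le_add_left _ _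
    have hband : RExpr.bandResult.eval I s₇ = bandValue A B P.k P.inf Gf := by
      simp only [RExpr.bandResult, RExpr.eval_add, RExpr.eval_rd, RExpr.eval_mul, RExpr.eval_emin,
        RExpr.eval_sub, RExpr.eval_ofNat, v5, v6, v11, v15, v20, v23]
      have hKF : P.KF = A.length * P.w := by rw [hP.KF, hlA]
      rw [hm₇, memFill_lt (by omega), bandValue, hwk, show 2 * P.k + 2 - 1 = 2 * P.k + 1 by omega]
    have hblock : RExpr.blockResult.eval I s₇ =
        Gb (P.N * P.Wd + (P.M1 - 1) * P.lam1 + P.lam) := by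
      have hbF := hP.bF
      have hWd : P.Wd = (P.M1 - 1) * P.lam1 + P.lam + 1 := by
        obtain ⟨M, hM⟩ : ∃ M, P.M1 = M + 1 := ⟨P.M1 - 1, by omega⟩
        rw [hP.Wd, hM, Nat.add_sub_cancel, add_mul]; omega
      have hKM := hP.KM
      simp only [RExpr.blockResult, RExpr.eval_rd, RExpr.eval_add, RExpr.eval_sub,
        RExpr.eval_ofNat, v19, v22, v26]
      rw [hm₇, memFill_of_lt (by omega), hm₆, memFill_lt (by omega)]
      congr 1
      omega
    rw [MState.setReg_reg, if_pos rfl, RExpr.resultExpr]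
    simp only [RExpr.eval_add, RExpr.eval_mul, RExpr.eval_sub, RExpr.eval_emin, RExpr.eval_ofNat,
      hband, hblock, v11]

end


/-! ### Deterministic programs -/

theorem RExpr.comp_coinFree (e : RExpr) (t : ℕ) : (e.comp t).CoinFree := by
  induction e generalizing t with
  | const c => exact trivial
  | var x => simp only [RExpr.comp]; split <;> exact trivial
  | add a b iha ihb | sub a b iha ihb | mul a b iha ihb | div a b iha ihb =>
    exact ⟨iha _, ihb _, trivial⟩
  | rd a ih | inp i a ih => exact ⟨ih _, trivial⟩

theorem assign_coinFree (x : ℕ) (e : RExpr) : (assign x e).CoinFree := ⟨e.comp_coinFree 0, trivial⟩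

theorem write_coinFree (a e : RExpr) : (write a e).CoinFree :=
  ⟨a.comp_coinFree 0, e.comp_coinFree 1, trivial⟩

theorem forLoop_coinFree (lim : RExpr) {p : Prog} (hp : p.CoinFree) : (forLoop lim p).CoinFree :=
  ⟨assign_coinFree _ _, assign_coinFree _ _, hp, assign_coinFree _ _, assign_coinFree _ _⟩

theorem fill_coinFree (lim base e : RExpr) : (fill lim base e).CoinFree :=
  forLoop_coinFree _ (write_coinFree _ _)

theorem assigns_coinFree (l : List (ℕ × RExpr)) : (assigns l).CoinFree := by
  induction l with
  | nil => exact trivial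
  | cons a l ih => exact ⟨assign_coinFree _ _, ih⟩

theorem clearRegs_coinFree (B : ℕ) : (clearRegs B).CoinFree := by
  induction B with
  | zero => exact trivial
  | succ B ih => exact ⟨ih, trivial⟩

theorem Prog.CoinFree.reloc {p : Prog} (hp : p.CoinFree) (mb cb : RExpr) (inE : ℕ → RExpr) :
    (p.reloc mb cb inE).CoinFree := by
  induction p with
  | skip | const | op => exact trivial
  | load | input => exact ⟨trivial, assign_coinFree _ _⟩
  | store => exact ⟨trivial, trivial, write_coinFree _ _⟩
  | coin => exact hp.elim
  | seq p q ihp ihq | cond x p q ihp ihq => exact ⟨ihp hp.1, ihq hp.2⟩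
  | loop x p ih => exact ih hp

theorem Prog.CoinFree.callLoop {p : Prog} (hp : p.CoinFree) (B : ℕ) (lim base cb Z size : RExpr)
    (inE : ℕ → RExpr) : (callLoop p B lim base cb Z size inE).CoinFree :=
  forLoop_coinFree _ ⟨clearRegs_coinFree B, assign_coinFree _ _, hp.reloc _ _ _, trivial,
    write_coinFree _ _, assign_coinFree _ _, assign_coinFree _ _⟩

theorem mainProg_coinFree (r v h C c B : ℕ) {pA pB q : Prog} (hA : pA.CoinFree) (hB : pB.CoinFree)
    (hq : q.CoinFree) : (mainProg r v h C c B pA pB q).CoinFree :=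
  ⟨forLoop_coinFree _ ⟨assign_coinFree _ _, assign_coinFree _ _⟩, assigns_coinFree _,
    hA.callLoop _ _ _ _ _ _ _, hB.callLoop _ _ _ _ _ _ _, hq.callLoop _ _ _ _ _ _ _,
    fill_coinFree _ _ _, ⟨fill_coinFree _ _ _, fill_coinFree _ _ _⟩,
    ⟨fill_coinFree _ _ _, fill_coinFree _ _ _⟩, assign_coinFree _ _⟩

theorem AlgKind.Allows.mainProg {k : AlgKind} (r v h C c B : ℕ) {pA pB q : Prog}
    (hA : k.Allows pA) (hB : k.Allows pB) (hq : k.Allows q) :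
    k.Allows (mainProg r v h C c B pA pB q) := by
  cases k with
  | deterministic => exact mainProg_coinFree r v h C c B hA hB hq
  | randomized => exact trivial

/-! ### The results of the given programs -/

instance : Nonempty MState := ⟨MState.init 0⟩

/-- The state in which the program halts. -/
noncomputable def finalState (W : ℕ) (inp : ℕ → ℕ → ℕ) (p : Prog) (n : ℕ) (ρ : ℕ → Bool) : MState :=
  Classical.epsilon fun s => ∃ t, Exec W inp ρ p (MState.init n) s t

theorem Exec.finalState_eq {W : ℕ} {inp : ℕ → ℕ → ℕ} {ρ : ℕ → Bool} {p : Prog} {n t : ℕ}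
    {s : MState} (h : Exec W inp ρ p (MState.init n) s t) : finalState W inp p n ρ = s := by
  obtain ⟨t', ht'⟩ := Classical.epsilon_spec (p := fun s => ∃ t, Exec W inp ρ p (MState.init n) s t)
    ⟨s, t, h⟩
  exact (ht'.det h).1

theorem Exec.finalState_congr {W V : ℕ} {inp : ℕ → ℕ → ℕ} {ρ ρ' : ℕ → Bool} {p : Prog} {n t : ℕ}
    {s : MState} (h : Exec W inp ρ p (MState.init n) s t) (hWV : W ≤ V) (hn : n ≤ V)
    (hρ : ∀ y ≤ V, ρ y = ρ' y) : finalState W inp p n ρ' = finalState W inp p n ρ := by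
  rw [h.finalState_eq, (h.congr_coins hWV hρ (MState.Within.init hn)).finalState_eq]

/-- The answer of the query program for the strings `x` and `y`. -/
noncomputable def queryState (W n : ℕ) (pA pB q : Prog) (x y : List ℕ) (ρ : ℕ → Bool) : MState :=
  finalState W (inputs (finalState W (inputs (strArray x) 0) pA n ρ).mem
    (finalState W (inputs (strArray y) 0) pB n ρ).mem) q n ρ

/-- What `HasPreprocessedApprox` says about the strings `x` and `y`. -/
structure QueryOK (k : AlgKind) (α : ℝ) (W n TA TQ : ℕ) (pA pB q : Prog) (x y : List ℕ) :
    Prop where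
  left : ∀ ρ, ∃ t ≤ TA, Exec W (inputs (strArray x) 0) ρ pA (MState.init n)
    (finalState W (inputs (strArray x) 0) pA n ρ) t
  right : ∀ ρ, ∃ t ≤ TA, Exec W (inputs (strArray y) 0) ρ pB (MState.init n)
    (finalState W (inputs (strArray y) 0) pB n ρ) t
  query : ∀ ρ, ∃ t ≤ TQ, Exec W (inputs (finalState W (inputs (strArray x) 0) pA n ρ).mem
    (finalState W (inputs (strArray y) 0) pB n ρ).mem) ρ q (MState.init n)
    (queryState W n pA pB q x y ρ) t
  reliable : k.Reliable n {ρ | IsApprox α x y ((queryState W n pA pB q x y ρ).reg 0)}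

/-- By determinism the existentially quantified final states are the canonical ones, so they depend
on one string and the coins alone. This matters because a block meets many windows but is
preprocessed once. -/
theorem QueryOK.of_halts {k : AlgKind} {α : ℝ} {W n : ℕ} {TA TQ : ℝ} {pA pB q : Prog}
    {x y : List ℕ} (h : ∃ e : (ℕ → Bool) → ℕ, (∀ ρ : ℕ → Bool, ∃ sA sB s : MState,
      Halts W (inputs (strArray x) 0) ρ pA n TA sA ∧ Halts W (inputs (strArray y) 0) ρ pB n TA sB ∧
      Halts W (inputs sA.mem sB.mem) ρ q n TQ s ∧ s.reg 0 = e ρ) ∧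
      k.Reliable n {ρ | IsApprox α x y (e ρ)}) :
    QueryOK k α W n ⌊TA⌋₊ ⌊TQ⌋₊ pA pB q x y := by
  obtain ⟨e, he, hrel⟩ := h
  have key : ∀ ρ, (∃ t ≤ ⌊TA⌋₊, Exec W (inputs (strArray x) 0) ρ pA (MState.init n)
      (finalState W (inputs (strArray x) 0) pA n ρ) t) ∧
      (∃ t ≤ ⌊TA⌋₊, Exec W (inputs (strArray y) 0) ρ pB (MState.init n)
      (finalState W (inputs (strArray y) 0) pB n ρ) t) ∧
      (∃ t ≤ ⌊TQ⌋₊, Exec W (inputs (finalState W (inputs (strArray x) 0) pA n ρ).mem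
        (finalState W (inputs (strArray y) 0) pB n ρ).mem) ρ q (MState.init n)
        (queryState W n pA pB q x y ρ) t) ∧ (queryState W n pA pB q x y ρ).reg 0 = e ρ := by
    intro ρ
    obtain ⟨sA, sB, s, ⟨tA, hA, eA⟩, ⟨tB, hB, eB⟩, ⟨t, ht, es⟩, hs⟩ := he ρ
    rw [queryState, eA.finalState_eq, eB.finalState_eq, es.finalState_eq]
    exact ⟨⟨tA, Nat.le_floor hA, eA⟩, ⟨tB, Nat.le_floor hB, eB⟩, ⟨t, Nat.le_floor ht, es⟩, hs⟩
  refine ⟨fun ρ => (key ρ).1, fun ρ => (key ρ).2.1, fun ρ => (key ρ).2.2.1, ?_⟩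
  simpa only [fun ρ => (key ρ).2.2.2] using hrel

/-- Locality passes through the composition: coins up to `V` determine both preprocessed memories,
hence the inputs of the query, and then its run. -/
theorem QueryOK.congr_coins {k : AlgKind} {α : ℝ} {W V n TA TQ : ℕ} {pA pB q : Prog}
    {x y : List ℕ} (h : QueryOK k α W n TA TQ pA pB q x y) (hWV : W ≤ V) (hn : n ≤ V)
    {ρ ρ' : ℕ → Bool} (hρ : ∀ y ≤ V, ρ y = ρ' y) :
    queryState W n pA pB q x y ρ' = queryState W n pA pB q x y ρ := by
  obtain ⟨_, _, eA⟩ := h.left ρ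
  obtain ⟨_, _, eB⟩ := h.right ρ
  obtain ⟨_, _, eq⟩ := h.query ρ
  rw [queryState, eA.finalState_congr hWV hn hρ, eB.finalState_congr hWV hn hρ,
    eq.finalState_congr hWV hn hρ, queryState]

theorem AlgKind.reliable_of_forall (k : AlgKind) (n : ℕ) {S : Set (ℕ → Bool)} (h : ∀ ρ, ρ ∈ S) :
    k.Reliable n S := by
  have hS : S = Set.univ := Set.eq_univ_of_forall h
  cases k with
  | deterministic => exact hS
  | randomized =>
    rw [AlgKind.Reliable, hS, MeasureTheory.probReal_univ]
    have : (0 : ℝ) ≤ 1 / n := by positivity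
    linarith

/-- Majorities of `2 * h + 1` independent runs for every element of `J`. -/
theorem AlgKind.reliable_of_majority {ι : Type*} {k : AlgKind} {L n Z h : ℕ} (J : Finset ι)
    {S : ι → Set (ℕ → Bool)} {G : Set (ℕ → Bool)} (hL : 0 < L) (hn : 0 < n) (hZ : 0 < Z)
    (hS : ∀ j ∈ J, k.Reliable L (S j))
    (hloc : ∀ j ∈ J, ∀ ρ ρ' : ℕ → Bool, (∀ y < Z, ρ y = ρ' y) → ρ ∈ S j → ρ' ∈ S j)
    (hbig : n * J.card * 2 ^ (2 * h + 1) ≤ L ^ (h + 1))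
    (hG : ∀ ρ, (∀ j ∈ J, ∃ T ⊆ Finset.range (2 * h + 1), h + 1 ≤ T.card ∧
      ∀ r ∈ T, shiftCoins Z r ρ ∈ S j) → ρ ∈ G) : k.Reliable n G := by
  cases k with
  | deterministic =>
    -- In the deterministic case every repetition is correct.
    refine Set.eq_univ_of_forall fun ρ => hG ρ fun j hj => ⟨Finset.range (2 * h + 1), subset_rfl,
      by rw [Finset.card_range]; omega, fun r _ => ?_⟩
    rw [show S j = Set.univ from hS j hj]
    trivial
  | randomized =>
    refine le_trans ?_ (coinMeasure_majority J S hZ hloc (fun j hj => hS j hj) h G hG)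
    have hL' : (0 : ℝ) < L := by exact_mod_cast hL
    have hn' : (0 : ℝ) < n := by exact_mod_cast hn
    have hb : (n : ℝ) * J.card * 2 ^ (2 * h + 1) ≤ (L : ℝ) ^ (h + 1) := by exact_mod_cast hbig
    -- The failure probability per repetition is `1 / L`; `hbig` says that the union bound is at
    -- most `1 / n`.
    refine sub_le_sub_left ?_ 1
    rw [div_pow, one_pow, le_div_iff₀ hn', ← mul_assoc, mul_one_div, div_mul_eq_mul_div,
      div_le_one (by positivity)]
    linarith


/-! ### Bounds for the parameters -/

/-- The parameters for given inputs. -/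
def Params.of (v R C c n b m lA lB : ℕ) : Params :=
  let d := b ^ (v + 2)
  let g := b ^ v
  let L := b ^ (v + 4)
  let lam := b ^ 4
  let k := 2 * n / b
  let N := lA / d + 1
  let M1 := (lB + g - 1) / g + 1
  let Z := (C + 1) * (L + m + 1) ^ (c + 1) + 2
  let lam1 := lam + 1
  let Wd := M1 * lam1
  let w := 2 * k + 2
  let KA := N * R
  let KB := Wd * R
  let KM := N * Wd
  let KQ := KM * R
  let bB := KA * Z
  let bQ := bB + KB * Z
  let bM := bQ + KQ * Z
  let bD := bM + KM
  { n, b, m, lA, lB, d, g, L, lam, k, N, M1, Z, inf := 2 * n + 1, bB, bQ, bM, bD,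
    bF := bD + Wd + KM, lam1, Wd, w, KA, KB, KM, KQ, KF := lA * w }

theorem Params.of_valid (v R C c n b m lA lB : ℕ) :
    (Params.of v R C c n b m lA lB).Valid v R C c := by
  constructor <;> rfl

/-- The inputs are as they should be. -/
structure Params.Fits (P : Params) (r : ℕ) : Prop where
  n_pos : 1 ≤ P.n
  b_pos : 1 ≤ P.b
  pow_le : P.b ^ r ≤ P.n
  lA_le : P.lA ≤ P.n
  lB_le : P.lB ≤ P.n

section
variable {P : Params} {v R C c r : ℕ}

theorem Params.Fits.pow_le_of_le (hF : P.Fits r) {e : ℕ} (he : e ≤ r) : P.b ^ e ≤ P.n :=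
  (Nat.pow_le_pow_right hF.b_pos he).trans hF.pow_le

theorem Params.Fits.b_le (hF : P.Fits r) (hr : 1 ≤ r) : P.b ≤ P.n := by
  simpa using hF.pow_le_of_le hr

theorem Params.Valid.N_mul_d_le (hP : P.Valid v R C c) (hF : P.Fits r) (hr : v + 4 ≤ r) : P.N * P.d ≤ 2 * P.n := by
  have h1 := Nat.div_mul_le_self P.lA P.d
  have h2 : P.d ≤ P.n := hP.d ▸ hF.pow_le_of_le (by omega)
  have h3 := hF.lA_le
  rw [hP.N, add_mul]
  omega

theorem Params.Valid.M1_mul_g_le (hP : P.Valid v R C c) (hF : P.Fits r) (hr : v + 4 ≤ r) : P.M1 * P.g ≤ 3 * P.n := by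
  have h1 := Nat.div_mul_le_self (P.lB + P.g - 1) P.g
  have h2 : P.g ≤ P.n := hP.g ▸ hF.pow_le_of_le (by omega)
  have h3 := hF.lB_le
  rw [hP.M1, add_mul]
  omega

theorem Params.Valid.N_le (hP : P.Valid v R C c) (hF : P.Fits r) : P.N ≤ 2 * P.n := by
  have h1 := Nat.div_le_self P.lA P.d
  have h3 := hF.lA_le
  have h4 := hF.n_pos
  rw [hP.N]
  omega

theorem Params.Valid.g_pos (hP : P.Valid v R C c) (hF : P.Fits r) : 0 < P.g := hP.g ▸ Nat.pow_pos hF.b_pos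

theorem Params.Valid.M1_le (hP : P.Valid v R C c) (hF : P.Fits r) : P.M1 ≤ 2 * P.n := by
  have h1 : (P.lB + P.g - 1) / P.g ≤ P.lB := by
    have hg := hP.g_pos hF
    rw [Nat.div_le_iff_le_mul hg]
    have := Nat.mul_le_mul (le_refl P.lB) hg
    omega
  have h3 := hF.lB_le
  have h4 := hF.n_pos
  rw [hP.M1]
  omega

theorem Params.Valid.lam1_le (hP : P.Valid v R C c) (hF : P.Fits r) : P.lam1 ≤ 2 * P.b ^ 4 := by
  have := Nat.pow_pos (n := 4) hF.b_pos
  rw [hP.lam1, hP.lam]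
  omega

theorem Params.Valid.lam1_le' (hP : P.Valid v R C c) (hF : P.Fits r) (hr : v + 4 ≤ r) : P.lam1 ≤ 2 * P.n :=
  (hP.lam1_le hF).trans (Nat.mul_le_mul le_rfl (hF.pow_le_of_le (by omega)))

theorem Params.Valid.k_mul_le (hP : P.Valid v R C c) : P.b * P.k ≤ 2 * P.n := hP.k ▸ Nat.mul_div_le _ _

/-- The running time. -/
theorem Params.Valid.time_le (hP : P.Valid v R C c) (hF : P.Fits r) (hr : v + 4 ≤ r)
    (hv : 2 ≤ v) {t K TA TQ : ℕ} (hrt : (v + 4) * t + 5 ≤ r) (hR : 1 ≤ R)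
    (hK : 1 ≤ K) (hTA : TA ≤ K * P.L ^ t) (hTQ : TQ ≤ K * P.b ^ (2 * v - 3)) :
    P.b * (P.n + P.KA * (TA + 1) + P.KB * (TA + 1) + P.KQ * (TQ + 1) + 2 * P.KM + P.Wd + P.w +
      P.KF + 12) ≤ 125 * (R * K) * P.n ^ 2 := by
  have hn := hF.n_pos
  have hb := hF.b_pos
  have hbn : P.b ≤ P.n := hF.b_le (by omega)
  have hN := hP.N_le hF
  have hM := hP.M1_mul_g_le hF hr
  have hNd := hP.N_mul_d_le hF hr
  have hl := hP.lam1_le hF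
  have hk := hP.k_mul_le
  have hg := hP.g_pos hF
  have hpos : ∀ e, 1 ≤ P.b ^ e := fun e => Nat.pow_pos hb
  have hTA' : TA + 1 ≤ 2 * K * P.b ^ ((v + 4) * t) := by
    rw [hP.L, ← pow_mul] at hTA
    have := Nat.mul_le_mul hK (hpos ((v + 4) * t))
    rw [mul_assoc]
    omega
  have hTQ' : TQ + 1 ≤ 2 * K * P.b ^ (2 * v - 3) := by
    have := Nat.mul_le_mul hK (hpos (2 * v - 3))
    rw [mul_assoc]
    omega
  have hRK : 1 ≤ R * K := Nat.mul_pos hR hK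
  have hn2 : P.n ≤ P.n ^ 2 := by nlinarith
  set n2 := R * K * P.n ^ 2 with hn2'
  have base : P.n ^ 2 ≤ n2 := by
    have := Nat.mul_le_mul hRK (le_refl (P.n ^ 2))
    rw [one_mul] at this; exact this
  -- Preprocessing of blocks: the crude bound of `2 * n` blocks is enough, as `r` exceeds the
  -- exponent of `b`.
  have tA : P.b * (P.KA * (TA + 1)) ≤ 4 * n2 := by
    calc P.b * (P.KA * (TA + 1)) ≤ P.b * ((2 * P.n * R) * (2 * K * P.b ^ ((v + 4) * t))) := by
          rw [hP.KA]; gcongr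
      _ = 4 * (R * K) * P.n * P.b ^ ((v + 4) * t + 1) := by ring
      _ ≤ 4 * (R * K) * P.n * P.n := by gcongr; exact hF.pow_le_of_le (by omega)
      _ = 4 * n2 := by rw [hn2']; ring
  -- Preprocessing of windows: the lengths contribute another b^4, so the exponent `(v + 4) * t + 5`
  -- is needed.
  have tB : P.b * (P.KB * (TA + 1)) ≤ 12 * n2 := by
    calc P.b * (P.KB * (TA + 1)) ≤
          P.b * ((P.M1 * P.g * (2 * P.b ^ 4) * R) * (2 * K * P.b ^ ((v + 4) * t))) := by
          rw [hP.KB, hP.Wd]; gcongr; exact Nat.le_mul_of_pos_right _ hg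
      _ = 4 * (R * K) * (P.M1 * P.g) * P.b ^ ((v + 4) * t + 5) := by ring
      _ ≤ 4 * (R * K) * (3 * P.n) * P.n := by gcongr; exact hF.pow_le_of_le (by omega)
      _ = 12 * n2 := by rw [hn2']; ring
  -- The decisive balance: b · b^4 · b^(2v-3) = b^(2v+2) = d · g, while N · d and M1 · g are linear
  -- in `n`.
  have tQ : P.b * (P.KQ * (TQ + 1)) ≤ 24 * n2 := by
    calc P.b * (P.KQ * (TQ + 1)) ≤
          P.b * ((P.N * (P.M1 * (2 * P.b ^ 4)) * R) * (2 * K * P.b ^ (2 * v - 3))) := by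
          rw [hP.KQ, hP.KM, hP.Wd]; gcongr
      _ = 4 * (R * K) * ((P.N * P.d) * (P.M1 * P.g)) := by
          obtain ⟨u, rfl⟩ : ∃ u, v = u + 2 := ⟨v - 2, by omega⟩
          rw [hP.d, hP.g, show 2 * (u + 2) - 3 = 2 * u + 1 by omega]
          ring
      _ ≤ 4 * (R * K) * ((2 * P.n) * (3 * P.n)) := by gcongr
      _ = 24 * n2 := by rw [hn2']; ring
  have tM : P.b * (2 * P.KM) ≤ 48 * n2 := by
    have : P.KM ≤ P.KQ * (TQ + 1) := by
      rw [hP.KQ, mul_assoc]; exact Nat.le_mul_of_pos_right _ (by positivity)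
    calc P.b * (2 * P.KM) ≤ 2 * (P.b * (P.KQ * (TQ + 1))) := by
          rw [mul_left_comm]; gcongr
      _ ≤ 48 * n2 := by omega
  have tW : P.b * P.Wd ≤ 12 * n2 := by
    refine le_trans (Nat.mul_le_mul le_rfl ?_) tB
    rw [hP.KB, mul_assoc]; exact Nat.le_mul_of_pos_right _ (by positivity)
  have tw : P.b * P.w ≤ 6 * P.n := by
    rw [hP.w, mul_add]
    have : P.b * (2 * P.k) = 2 * (P.b * P.k) := by ring
    omega
  have tF : P.b * P.KF ≤ 6 * P.n ^ 2 := by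
    calc P.b * P.KF = P.lA * (P.b * P.w) := by rw [hP.KF]; ring
      _ ≤ P.n * (6 * P.n) := Nat.mul_le_mul hF.lA_le tw
      _ = 6 * P.n ^ 2 := by ring
  have tn : P.b * P.n ≤ P.n ^ 2 := by rw [sq]; gcongr
  calc _ = P.b * P.n + P.b * (P.KA * (TA + 1)) + P.b * (P.KB * (TA + 1)) +
        P.b * (P.KQ * (TQ + 1)) + P.b * (2 * P.KM) + P.b * P.Wd + P.b * P.w + P.b * P.KF +
        P.b * 12 := by ring
    -- 125 = 1 + 4 + 12 + 24 + 48 + 12 + 6 + 6 + 12.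
    _ ≤ 125 * n2 := by omega
    _ = _ := by rw [hn2']; ring

/-- All numbers that occur are polynomially bounded. -/
theorem Params.Valid.par_le (hP : P.Valid v R C c) (hF : P.Fits r) (hr : v + 4 ≤ r) {X : ℕ}
    (hR : 1 ≤ R) (hnX : P.n + 1 ≤ X) (hmX : P.m ≤ 2 * X ^ 2) :
    (∀ x, P.par x ≤ 500 * (R * (C + 3)) * X ^ (4 * c + 10)) ∧
      R * P.Z ≤ 500 * (R * (C + 3)) * X ^ (4 * c + 10) ∧
      P.M1 * P.g ≤ 500 * (R * (C + 3)) * X ^ (4 * c + 10) ∧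
      P.Z ≤ (C + 3) * X ^ (4 * c + 4) := by
  have hn := hF.n_pos
  have hX : 2 ≤ X := by omega
  have hN := hP.N_le hF
  have hM1 := hP.M1_le hF
  have hM := hP.M1_mul_g_le hF hr
  have hl := hP.lam1_le' hF hr
  have hk := hP.k_mul_le
  have hpow : ∀ e ≤ r, P.b ^ e ≤ P.n := fun e he => hF.pow_le_of_le he
  have hZ : P.Z ≤ (C + 3) * X ^ (4 * c + 4) := by
    -- The sum of symbols is quadratic in `X`, which costs the factor 4 in the exponent of `Z`.
    have h1 : P.L + P.m + 1 ≤ X ^ 4 := by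
      have hL : P.L ≤ P.n := hP.L ▸ hpow _ (by omega)
      have h2 : X ^ 2 = X * X := sq X
      have h3 := Nat.mul_le_mul hX (le_refl X)
      have h4 : X ^ 4 = X ^ 2 * X ^ 2 := by ring
      have h5 : 4 * X ^ 2 ≤ X ^ 2 * X ^ 2 := Nat.mul_le_mul (by omega) le_rfl
      omega
    have h2 : (P.L + P.m + 1) ^ (c + 1) ≤ X ^ (4 * c + 4) := by
      calc (P.L + P.m + 1) ^ (c + 1) ≤ (X ^ 4) ^ (c + 1) := Nat.pow_le_pow_left h1 _
        _ = X ^ (4 * c + 4) := by rw [← pow_mul]; ring_nf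
    have h3 : 1 ≤ X ^ (4 * c + 4) := Nat.pow_pos (by omega)
    rw [hP.Z]
    nlinarith
  have hZ1 : 1 ≤ P.Z := by rw [hP.Z]; omega
  have hN1 : 1 ≤ P.N := by rw [hP.N]; exact Nat.le_add_left _ _
  have hM11 : 1 ≤ P.M1 := by rw [hP.M1]; exact Nat.le_add_left _ _
  have hl1 : 1 ≤ P.lam1 := by rw [hP.lam1]; omega
  have hWd1 : 1 ≤ P.Wd := by rw [hP.Wd]; exact Nat.mul_pos hM11 hl1
  set Y := X ^ (4 * c + 4) with hY
  have hXX : X ^ (4 * c + 10) = X ^ 6 * Y := by rw [hY]; ring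
  have hY1 : 1 ≤ Y := Nat.pow_pos (by omega)
  have hRC : 1 ≤ R * (C + 3) := Nat.mul_pos hR (by omega)
  set Q := 500 * (R * (C + 3)) * X ^ (4 * c + 10) with hQ
  have hWd : P.Wd ≤ 4 * X ^ 2 := by
    calc P.Wd = P.M1 * P.lam1 := hP.Wd
      _ ≤ (2 * X) * (2 * X) := Nat.mul_le_mul (by omega) (by omega)
      _ = 4 * X ^ 2 := by ring
  have hKM : P.KM ≤ 8 * X ^ 3 := by
    calc P.KM = P.N * P.Wd := hP.KM
      _ ≤ (2 * X) * (4 * X ^ 2) := Nat.mul_le_mul (by omega) hWd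
      _ = 8 * X ^ 3 := by ring
  have hp : ∀ e ≤ 6, X ^ e ≤ X ^ 6 := fun e he => Nat.pow_le_pow_right (by omega) he
  have hZR : R * P.Z ≤ R * (C + 3) * Y := by
    rw [mul_assoc]; exact Nat.mul_le_mul le_rfl hZ
  have hbig : X ^ 6 ≤ R * (C + 3) * (X ^ 6 * Y) := by
    calc X ^ 6 = 1 * (X ^ 6 * 1) := by ring
      _ ≤ R * (C + 3) * (X ^ 6 * Y) := by gcongr
  have hQ6 : 500 * X ^ 6 ≤ Q := by rw [hQ, hXX, mul_assoc]; exact Nat.mul_le_mul le_rfl hbig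
  have hcall : ∀ K ≤ 8 * X ^ 3, K * R * P.Z ≤ 8 * (R * (C + 3) * (X ^ 6 * Y)) := fun K hK => by
    calc K * R * P.Z = K * (R * P.Z) := by ring
      _ ≤ (8 * X ^ 3) * (R * (C + 3) * Y) := Nat.mul_le_mul hK hZR
      _ ≤ (8 * X ^ 6) * (R * (C + 3) * Y) := by gcongr <;> omega
      _ = _ := by ring
  have hX3 : ∀ e ≤ 3, X ^ e ≤ X ^ 3 := fun e he => Nat.pow_le_pow_right (by omega) he
  have hX1 := hX3 1 (by omega)
  rw [pow_one] at hX1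
  have cA := hcall P.N (by omega)
  have cB := hcall P.Wd (by have := hX3 2 (by omega); omega)
  have cQ := hcall P.KM hKM
  rw [← hP.KA] at cA
  rw [← hP.KB] at cB
  rw [← hP.KQ] at cQ
  have h3 := hp 3 (by omega)
  have h2 := hp 2 (by omega)
  have h1 := hp 1 (by omega)
  rw [pow_one] at h1
  -- The memory areas follow one another, so the last base address dominates the others and, through
  -- the following inequalities, the numbers of calls.
  have hbF : P.bF ≤ Q := by
    rw [hP.bF, hP.bD, hP.bM, hP.bQ, hP.bB, hQ, hXX, mul_assoc 500]
    omega
  have e1 : P.KA ≤ P.KA * P.Z := Nat.le_mul_of_pos_right _ hZ1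
  have e2 : P.KB ≤ P.KB * P.Z := Nat.le_mul_of_pos_right _ hZ1
  have e3 : P.KQ ≤ P.KQ * P.Z := Nat.le_mul_of_pos_right _ hZ1
  have e4 : P.Z ≤ R * P.Z := Nat.le_mul_of_pos_left _ hR
  have e5 : R * P.Z ≤ P.KA * P.Z :=
    Nat.mul_le_mul (hP.KA ▸ Nat.le_mul_of_pos_left _ hN1) le_rfl
  have e6 : P.lam1 ≤ P.Wd := hP.Wd ▸ Nat.le_mul_of_pos_left _ hM11
  have hbF' := hP.bF
  have hbD' := hP.bD
  have hbM' := hP.bM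
  have hbQ' := hP.bQ
  have hbB' := hP.bB
  have hk' : P.k ≤ 2 * P.n := hP.k ▸ Nat.div_le_self _ _
  have hw := hP.w
  have hKF : P.KF ≤ 6 * X ^ 2 := by
    calc P.KF = P.lA * P.w := hP.KF
      _ ≤ X * (6 * X) := Nat.mul_le_mul (hF.lA_le.trans (by omega)) (by omega)
      _ = 6 * X ^ 2 := by ring
  have hb1 := hF.b_le (by omega)
  have hlA := hF.lA_le
  have hlB := hF.lB_le
  have hd : P.d ≤ P.n := hP.d ▸ hpow _ (by omega)
  have hg : P.g ≤ P.n := hP.g ▸ hpow _ (by omega)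
  have hL : P.L ≤ P.n := hP.L ▸ hpow _ (by omega)
  have hlam : P.lam ≤ P.n := hP.lam ▸ hpow _ (by omega)
  have hinf := hP.inf
  refine ⟨fun x => ?_, by omega, by omega, hZ⟩
  rcases lt_or_ge x 29 with hlt | hge
  · interval_cases x <;> simp only [Params.par] <;> omega
  · obtain ⟨y, rfl⟩ : ∃ y, x = y + 29 := ⟨x - 29, by omega⟩
    exact Nat.zero_le _

end


/-! ### Correctness -/

/-- A band value up to `P.k` is exact. Otherwise the distance exceeds 2n/b - 1 and is an integer
above `P.k`, so that 2n ≤ b · ED, and the additive error of the block table, of order n/b², is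
absorbed into a relative error. -/
theorem Params.Valid.isApprox {P : Params} {v R C c r : ℕ} {A B : List ℕ} {α : ℝ}
    {G : ℕ → ℕ} {med D : ℕ → ℕ → ℕ → ℕ} (hP : P.Valid v R C c) (hF : P.Fits r) (hr : v + 4 ≤ r)
    (hα : 1 ≤ α) (hlA : P.lA = A.length) (hlB : P.lB = B.length)
    (hG : BandTable A B P.k P.inf G) (hD : BlockTable med P.g P.inf P.N (P.M1 - 1) P.lam D)
    (hmed : P.b ≠ 1 → ∀ i < P.N, ∀ j < P.M1, ∀ l ≤ P.lam,
      IsApprox α (block A P.d i) (window B P.g j l) (med i j l)) :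
    IsApprox (α + (4 * α + 1) / P.b) A B (bandValue A B P.k P.inf G *
      (1 - (bandValue A B P.k P.inf G - P.k)) +
      D P.N (P.M1 - 1) P.lam * min 1 (bandValue A B P.k P.inf G - P.k)) := by
  have hn := hF.n_pos
  have hb0 : (0 : ℝ) < P.b := by exact_mod_cast hF.b_pos
  have hinf : P.k < P.inf := by
    have : P.k ≤ 2 * P.n := hP.k ▸ Nat.div_le_self _ _
    rw [hP.inf]; omega
  have hη : 0 ≤ (4 * α + 1) / P.b := by positivity
  have hlen : A.length + B.length ≤ 2 * P.n := by
    have := hF.lA_le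
    have := hF.lB_le
    omega
  obtain ⟨exact_of_le, lt_of_lt⟩ := hG.bandValue_spec hinf
  set F := bandValue A B P.k P.inf G
  rcases le_or_gt F P.k with hFk | hFk
  · rw [show F - P.k = 0 by omega, show F * (1 - 0) + D P.N (P.M1 - 1) P.lam * min 1 0 = F by simp,
      exact_of_le hFk]
    refine ⟨le_rfl, le_mul_of_one_le_left (Nat.cast_nonneg _) (by linarith)⟩
  · rw [show 1 - (F - P.k) = 0 by omega, show min 1 (F - P.k) = 1 by omega, mul_zero, zero_add,
      mul_one]
    have hED := lt_of_lt hFk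
    -- For `b = 1` the threshold is `2 * n`, which no distance exceeds, so this case never relies on
    -- the queries.
    have hb1 : P.b ≠ 1 := by
      intro hb
      have h1 : P.k = 2 * P.n := by rw [hP.k, hb, Nat.div_one]
      have h2 := editDist_le_length_add A B
      omega
    have hM11 : 1 ≤ P.M1 := by rw [hP.M1]; exact Nat.le_add_left _ _
    have hg := hP.g_pos hF
    obtain ⟨hlow, hupp⟩ := hD.final (A := A) (B := B) (d := P.d) hα hg
      (hP.lam ▸ Nat.pow_pos hF.b_pos)
      (by rw [hP.M1, hlB, Nat.add_sub_cancel])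
      (by rw [hP.N, hlA]; exact (Nat.lt_div_mul_add (hP.d ▸ Nat.pow_pos hF.b_pos)).le.trans
            (by rw [add_mul, one_mul]))
      (by rw [hP.inf]; omega) (fun i hi j hj l hl => hmed hb1 i hi j (by omega) l hl)
    refine ⟨hlow, hupp.trans ?_⟩
    have hpow : ∀ e ≤ r, P.b ^ e ≤ P.n := fun e he => hF.pow_le_of_le he
    have hED' : (2 : ℝ) * P.n ≤ P.b * editDist A B := by
      have h1 : 2 * P.n < P.b * (P.k + 1) := hP.k ▸ Nat.lt_mul_div_succ _ hF.b_pos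
      have h2 : 2 * P.n ≤ P.b * editDist A B := h1.le.trans (Nat.mul_le_mul le_rfl hED)
      exact_mod_cast h2
    -- As d = b² g, the left side is `P.N * P.d + P.d`.
    have e1 : P.b ^ 2 * ((P.N + 1) * P.g) ≤ 3 * P.n := by
      have h1 := hP.N_mul_d_le hF hr
      have h2 : P.d ≤ P.n := hP.d ▸ hpow _ (by omega)
      have h3 : P.b ^ 2 * ((P.N + 1) * P.g) = P.N * P.d + P.d := by rw [hP.d, hP.g]; ring
      omega
    have e2 : P.b ^ v * (P.M1 - 1) ≤ 2 * P.n := by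
      have h1 := Nat.div_mul_le_self (P.lB + P.g - 1) P.g
      have h2 : P.g ≤ P.n := hP.g ▸ hpow _ (by omega)
      have h3 := hF.lB_le
      rw [hP.M1, Nat.add_sub_cancel, ← hP.g, mul_comm]
      omega
    have e1' : ((P.N : ℝ) + 1) * P.g ≤ 3 * P.n / P.b ^ 2 := by
      rw [le_div_iff₀ (by positivity), mul_comm]
      exact_mod_cast e1
    have e2' : (P.d : ℝ) / P.lam * (P.M1 - 1 : ℕ) ≤ 2 * P.n / P.b ^ 2 := by
      rw [hP.d, hP.lam, le_div_iff₀ (by positivity)]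
      have : ((P.b ^ (v + 2) : ℕ) : ℝ) / (P.b ^ 4 : ℕ) * (P.M1 - 1 : ℕ) * P.b ^ 2 =
          P.b ^ v * (P.M1 - 1 : ℕ) := by
        push_cast
        field_simp
        ring
      rw [this]
      exact_mod_cast e2
    have e3 : (P.n : ℝ) / P.b ^ 2 ≤ editDist A B / (2 * P.b) := by
      rw [div_le_div_iff₀ (by positivity) (by positivity)]
      nlinarith
    have e4 : ((P.N : ℝ) + 1) * P.g ≤ 3 * (editDist A B / (2 * P.b)) := by
      rw [mul_div_assoc] at e1'; linarith
    have e5 : (P.d : ℝ) / P.lam * (P.M1 - 1 : ℕ) ≤ 2 * (editDist A B / (2 * P.b)) := by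
      rw [mul_div_assoc] at e2'; linarith
    calc α * editDist A B + ((P.N : ℝ) + 1) * (2 * α * P.g) +
          (1 + α) * (P.d / P.lam) * (P.M1 - 1 : ℕ)
        = α * editDist A B + 2 * α * (((P.N : ℝ) + 1) * P.g) +
          (1 + α) * (P.d / P.lam * (P.M1 - 1 : ℕ)) := by ring
      _ ≤ α * editDist A B + 2 * α * (3 * (editDist A B / (2 * P.b))) +
          (1 + α) * (2 * (editDist A B / (2 * P.b))) := by gcongr
      -- The rounding contributes 3α/b and the long partners (1+α)/b.
      _ = (α + (4 * α + 1) / P.b) * editDist A B := by field_simp; ring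

/-! ### The root of `n` -/

/-- The integer `r`-th root. -/
def natRoot (r n : ℕ) : ℕ := Nat.findGreatest (fun x => x ^ r ≤ n) n

theorem natRoot_pow_le {r n : ℕ} (hr : r ≠ 0) : natRoot r n ^ r ≤ n :=
  Nat.findGreatest_spec (P := fun x => x ^ r ≤ n) (Nat.zero_le n) (by simp [hr])

theorem le_natRoot {r n x : ℕ} (hr : r ≠ 0) (h : x ^ r ≤ n) : x ≤ natRoot r n :=
  Nat.le_findGreatest ((Nat.le_self_pow hr x).trans h) h

theorem lt_natRoot_succ_pow {r n : ℕ} (hr : r ≠ 0) : n < (natRoot r n + 1) ^ r := by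
  by_contra! h
  exact absurd (le_natRoot hr h) (by omega)

theorem tendsto_natRoot {r : ℕ} (hr : r ≠ 0) : Filter.Tendsto (natRoot r) Filter.atTop Filter.atTop :=
  Filter.tendsto_atTop.2 fun x => Filter.eventually_atTop.2 ⟨x ^ r, fun _ hn => le_natRoot hr hn⟩

/-- Rounding down loses at most a factor of two: n < (b+1)^r ≤ (2b)^r, so b is at least half of
n^(1/r). -/
theorem div_natRoot_le {r n : ℕ} (hr : r ≠ 0) (hn : 1 ≤ n) :
    (n : ℝ) ^ 2 / natRoot r n ≤ 2 * (n : ℝ) ^ (2 - 1 / (r : ℝ)) := by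
  have hb : 1 ≤ natRoot r n := le_natRoot hr (by simpa using hn)
  have hb' : (1 : ℝ) ≤ natRoot r n := by exact_mod_cast hb
  have hn' : (0 : ℝ) < n := by exact_mod_cast hn
  have h1 : (n : ℝ) ≤ (2 * natRoot r n) ^ r := by
    have h2 := (lt_natRoot_succ_pow (r := r) (n := n) hr).le
    have h3 : (natRoot r n + 1) ^ r ≤ (2 * natRoot r n) ^ r := Nat.pow_le_pow_left (by omega) _
    exact_mod_cast h2.trans h3
  have h2 : (n : ℝ) ^ (1 / (r : ℝ)) ≤ 2 * natRoot r n := by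
    calc (n : ℝ) ^ (1 / (r : ℝ)) ≤ ((2 * natRoot r n : ℝ) ^ r) ^ (1 / (r : ℝ)) :=
          Real.rpow_le_rpow hn'.le h1 (by positivity)
      _ = 2 * natRoot r n := by
          rw [one_div]; exact Real.pow_rpow_inv_natCast (by positivity) hr
  rw [Real.rpow_sub hn', Real.rpow_two, div_le_iff₀ (by linarith), mul_div_assoc', div_mul_eq_mul_div,
    le_div_iff₀ (Real.rpow_pos_of_pos hn' _)]
  nlinarith [sq_nonneg (n : ℝ)]

/-! ### The inputs -/

theorem IsInput.strArray_succ_le {Alph : Set ℕ} {n m : ℕ} {u : List ℕ} (h : IsInput Alph n m u)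
    (i : ℕ) : strArray u (i + 1) ≤ m := by
  rw [strArray]
  rcases lt_or_ge i u.length with hi | hi
  · rw [List.getD_eq_getElem _ _ hi]; exact (h.2 _ (List.getElem_mem hi)).2
  · rw [List.getD_eq_default _ _ hi]; exact Nat.zero_le _

theorem IsInput.strArray_le {Alph : Set ℕ} {n m : ℕ} {u : List ℕ} (h : IsInput Alph n m u)
    (i : ℕ) : strArray u i ≤ n + m := by
  cases i with
  | zero => exact h.1.trans (Nat.le_add_right _ _)
  | succ i => exact (h.strArray_succ_le i).trans (Nat.le_add_left _ _)

/-- This makes the computed sum of symbols a legitimate symbol bound for all blocks and windows. -/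
theorem IsInput.le_sum {Alph : Set ℕ} {n m a : ℕ} {u : List ℕ} (h : IsInput Alph n m u)
    (ha : a ∈ u) : a ≤ ∑ i ∈ Finset.range n, strArray u (i + 1) := by
  obtain ⟨i, hi, rfl⟩ := List.getElem_of_mem ha
  have := Finset.single_le_sum (f := fun i => strArray u (i + 1)) (s := Finset.range n)
    (fun _ _ => Nat.zero_le _) (Finset.mem_range.2 (hi.trans_le h.1))
  rwa [strArray, List.getD_eq_getElem _ _ hi] at this

theorem mem_of_mem_block {A : List ℕ} {d i a : ℕ} (h : a ∈ block A d i) : a ∈ A :=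
  List.mem_of_mem_drop (List.mem_of_mem_take h)

theorem mem_of_mem_window {B : List ℕ} {g j l a : ℕ} (h : a ∈ window B g j l) : a ∈ B :=
  List.mem_of_mem_drop (List.mem_of_mem_take h)


/-! ### The theorem -/

/-- The time bound for the queries. -/
theorem floor_query_le {K b v : ℕ} {ε : ℝ} (hb : 1 ≤ b) (hv : 2 ≤ v) (hε : 11 ≤ (v + 4) * ε) :
    ⌊(K : ℝ) * ((b ^ (v + 4) : ℕ) : ℝ) ^ (2 - ε)⌋₊ ≤ K * b ^ (2 * v - 3) := by
  have hb' : (1 : ℝ) ≤ b := by exact_mod_cast hb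
  refine Nat.floor_le_of_le ?_
  push_cast
  refine mul_le_mul_of_nonneg_left ?_ (Nat.cast_nonneg _)
  rw [← Real.rpow_natCast (b : ℝ) (v + 4), ← Real.rpow_mul (by linarith),
    ← Real.rpow_natCast (b : ℝ) (2 * v - 3)]
  -- The exponent is (v+4)(2-ε) = 2v + 8 - (v+4)ε ≤ 2v - 3.
  refine Real.rpow_le_rpow_of_exponent_le hb' ?_
  rw [Nat.cast_sub (by omega)]
  push_cast
  linarith

/-- The number of repetitions suffices. -/
theorem Params.Valid.majority_le {P : Params} {v R C c r : ℕ} (hP : P.Valid v R C c)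
    (hF : P.Fits r) (hr : v + 4 ≤ r) (hv : 2 ≤ v) (hb : 2 ≤ P.b) (hn : P.n < (P.b + 1) ^ r) :
    P.n * (P.N * P.M1 * P.lam1) * 2 ^ (2 * (2 * r) + 1) ≤ P.L ^ (2 * r + 1) := by
  -- For b ≥ 2 one has b + 1 ≤ b², so `n` is at most a fixed power of `b`, and thereby of `L`.
  have h1 : P.n ≤ P.b ^ (2 * r) := by
    calc P.n ≤ (P.b + 1) ^ r := hn.le
      _ ≤ (P.b ^ 2) ^ r := Nat.pow_le_pow_left (by nlinarith) _
      _ = P.b ^ (2 * r) := by rw [pow_mul]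
  have h2 : 2 * P.n ≤ P.b ^ (2 * r + 1) := by
    rw [pow_succ, mul_comm]; exact Nat.mul_le_mul h1 hb
  calc P.n * (P.N * P.M1 * P.lam1) * 2 ^ (2 * (2 * r) + 1)
      ≤ P.b ^ (2 * r) * (P.b ^ (2 * r + 1) * P.b ^ (2 * r + 1) * P.b ^ (2 * r + 1)) *
        P.b ^ (2 * (2 * r) + 1) := by
        gcongr
        · exact (hP.N_le hF).trans h2
        · exact (hP.M1_le hF).trans h2
        · exact (hP.lam1_le' hF hr).trans h2
    _ = P.b ^ (12 * r + 4) := by ring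
    _ ≤ P.b ^ ((v + 4) * (2 * r + 1)) := by
        refine Nat.pow_le_pow_right hF.b_pos ?_
        calc 12 * r + 4 ≤ 6 * (2 * r + 1) := by omega
          _ ≤ (v + 4) * (2 * r + 1) := Nat.mul_le_mul (by omega) le_rfl
    _ = P.L ^ (2 * r + 1) := by rw [hP.L, pow_mul]

theorem theorem7 (k : AlgKind) (Alph : Set ℕ) (α : ℝ) (hα : 1 ≤ α)
    (h : HasPreprocessedApprox k Alph α) :
    ∃ η : ℕ → ℝ, Filter.Tendsto η Filter.atTop (nhds 0) ∧
      HasSubquadraticApprox k Alph (fun n => α + η n) := by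
  obtain ⟨pA, pB, q, C, c, t, ε, hε, kA, kB, kq, hyp⟩ := h
  have hempty : ∀ n m, IsInput Alph n m [] := fun n m => ⟨Nat.zero_le _, by simp⟩
  -- Every run takes at least one step, which a time bound with `C = 0` would forbid.
  have hC : 1 ≤ C := by
    by_contra hC
    obtain rfl : C = 0 := by omega
    obtain ⟨_, he, -⟩ := hyp 1 0 le_rfl [] [] (hempty _ _) (hempty _ _)
    obtain ⟨_, _, _, ⟨t', ht', e'⟩, -⟩ := he fun _ => false
    have := e'.pos
    have h2 : (t' : ℝ) ≤ 0 := by simpa using ht'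
    have h3 : (0 : ℝ) < t' := by exact_mod_cast this
    linarith
  -- Blocks so large that the saving L^ε = b^((v+4)ε) of a query outweighs the overhead b^8 and
  -- leaves b^3.
  obtain ⟨v, hv, hvε⟩ : ∃ v : ℕ, 2 ≤ v ∧ 11 ≤ ((v : ℝ) + 4) * ε := by
    obtain ⟨x, hx⟩ := exists_nat_ge (11 / ε)
    refine ⟨x + 2, by omega, ?_⟩
    rw [div_le_iff₀ hε] at hx
    push_cast
    nlinarith
  -- Large enough for `L ≤ n` and for polynomial preprocessing of pieces of size `L` to fit into the
  -- time bound.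
  set r := (v + 4) * (t + 1) + 10 with hr
  have hr0 : r ≠ 0 := by omega
  have hexp : (v + 4) * (t + 1) = (v + 4) * t + (v + 4) := by ring
  have hvr : v + 4 ≤ r := by omega
  obtain ⟨B₁, hB₁⟩ := pA.exists_regsBelow
  obtain ⟨B₂, hB₂⟩ := pB.exists_regsBelow
  obtain ⟨B₃, hB₃⟩ := q.exists_regsBelow
  set Breg := B₁ + B₂ + B₃ + 1 with hBreg
  set R := 2 * (2 * r) + 1 with hR
  set D := degBound r v (2 * r) C c with hD
  set X₀ := costBound r v (2 * r) C c Breg with hX₀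
  -- One constant serves two purposes: its first summand is for the word size, where `Q ^ D` must
  -- fit, and its second one for the running time.
  refine ⟨fun n => (4 * α + 1) / natRoot r n, ?_, mainProg r v (2 * r) C c Breg pA pB q,
    (500 * (R * (C + 3))) ^ D + 2 * (X₀ * (125 * (R * C))), (4 * c + 10) * D, 1 / r, by positivity,
    kA.mainProg _ _ _ _ _ _ kB kq, fun n m hn A B hA hB => ?_⟩
  · exact (tendsto_natCast_atTop_atTop.comp (tendsto_natRoot hr0)).const_div_atTop _
  set W := wordBound ((500 * (R * (C + 3))) ^ D + 2 * (X₀ * (125 * (R * C)))) ((4 * c + 10) * D) n m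
    with hW
  set m' := ∑ i ∈ Finset.range n, (strArray A (i + 1) + strArray B (i + 1)) with hm'
  set P := Params.of v R C c n (natRoot r n) m' A.length B.length with hPdef
  have hP : P.Valid v R C c := Params.of_valid _ _ _ _ _ _ _ _ _
  have hb1 : 1 ≤ P.b := le_natRoot hr0 (by simpa using hn)
  have hF : P.Fits r := ⟨hn, hb1, natRoot_pow_le hr0, hA.1, hB.1⟩
  have hL1 : 1 ≤ P.L := hP.L ▸ Nat.pow_pos hb1
  have hm'le : P.m ≤ 2 * (n + m + 1) ^ 2 := by
    calc P.m = m' := rfl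
      _ ≤ ∑ i ∈ Finset.range n, (m + m) :=
          Finset.sum_le_sum fun i _ => add_le_add (hA.strArray_succ_le i) (hB.strArray_succ_le i)
      _ = 2 * (n * m) := by rw [Finset.sum_const, Finset.card_range, smul_eq_mul]; ring
      _ ≤ 2 * (n + m + 1) ^ 2 := by
          rw [sq]; exact Nat.mul_le_mul le_rfl (Nat.mul_le_mul (by omega) (by omega))
  obtain ⟨hpar, hRZ, hMg, -⟩ := hP.par_le hF hvr (X := n + m + 1) (by omega)
    (show P.n + 1 ≤ n + m + 1 by change n + 1 ≤ _; omega) hm'le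
  set Q := 500 * (R * (C + 3)) * (n + m + 1) ^ (4 * c + 10) with hQ
  have hRC : 1 ≤ R * (C + 3) := Nat.mul_pos (by omega) (by omega)
  have hXQ : n + m + 1 ≤ Q := by
    calc n + m + 1 ≤ (n + m + 1) ^ (4 * c + 10) := Nat.le_self_pow (by omega) _
      _ ≤ Q := Nat.le_mul_of_pos_left _ (by omega)
  have hw : WordOK W Q D (inputs (strArray A) (strArray B)) := by
    refine ⟨by omega, ?_, fun i y => ?_⟩
    · rw [hW, wordBound, hQ, mul_pow, ← pow_mul]
      exact Nat.mul_le_mul (Nat.le_add_right _ _) le_rfl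
    · rcases i with _ | _ | i
      · exact (hA.strArray_le y).trans (by omega)
      · exact (hB.strArray_le y).trans (by omega)
      · exact Nat.zero_le _
  -- Increasing both constants makes `V` exceed the word bound of the given programs and also `2 *
  -- L`, even if `c = 0`.
  set V := (C + 1) * (P.L + P.m + 1) ^ (c + 1) with hV
  have hZ : P.Z = V + 2 := hP.Z
  have hWV : wordBound C c P.L P.m ≤ V := by
    rw [wordBound, hV]
    exact Nat.mul_le_mul (Nat.le_succ C) (Nat.pow_le_pow_right (by omega) (Nat.le_succ c))
  -- The penalty `V` of the median has to be at least the distance of a block and a window, which is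
  -- at most `2 * L`.
  have hLV : 2 * P.L ≤ V := by
    calc 2 * P.L ≤ (C + 1) * (P.L + P.m + 1) := Nat.mul_le_mul (by omega) (by omega)
      _ ≤ V := Nat.mul_le_mul le_rfl (Nat.le_self_pow (by omega) _)
  have hblock : ∀ i, IsInput Alph P.L P.m (block A P.d i) := fun i => by
    refine ⟨(List.length_take_le _ _).trans ?_, fun a ha => ⟨(hA.2 a (mem_of_mem_block ha)).1, ?_⟩⟩
    · rw [hP.d, hP.L]; exact Nat.pow_le_pow_right hb1 (by omega)
    · exact (hA.le_sum (mem_of_mem_block ha)).trans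
        (Finset.sum_le_sum fun i _ => Nat.le_add_right _ _)
  have hwindow : ∀ j, ∀ l ≤ P.lam, IsInput Alph P.L P.m (window B P.g j l) := fun j l hl => by
    refine ⟨(List.length_take_le _ _).trans ?_, fun a ha => ⟨(hB.2 a (mem_of_mem_window ha)).1, ?_⟩⟩
    · calc l * P.g ≤ P.lam * P.g := Nat.mul_le_mul hl le_rfl
        _ = P.L := by rw [hP.lam, hP.g, hP.L]; ring
    · exact (hB.le_sum (mem_of_mem_window ha)).trans
        (Finset.sum_le_sum fun i _ => Nat.le_add_left _ _)
  set W₀ := wordBound C c P.L P.m with hW₀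
  set TA := ⌊(C : ℝ) * (P.L : ℝ) ^ t⌋₊ with hTA
  set TQ := ⌊(C : ℝ) * (P.L : ℝ) ^ (2 - ε)⌋₊ with hTQ
  have hok : ∀ i j, ∀ l ≤ P.lam, QueryOK k α W₀ P.L TA TQ pA pB q (block A P.d i)
      (window B P.g j l) := fun i j l hl =>
    QueryOK.of_halts (hyp P.L P.m hL1 _ _ (hblock i) (hwindow j l hl))
  have hTA' : TA ≤ C * P.L ^ t := Nat.floor_le_of_le (by push_cast; exact le_rfl)
  have hTQ' : TQ ≤ C * P.b ^ (2 * v - 3) := by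
    rw [hTQ, hP.L]; exact floor_query_le hb1 hv hvε
  have hrun := fun ρ => runs_mainProg (ρ := ρ) (W₀ := W₀) (V := V) (TA := TA) (TQ := TQ) (pA := pA)
    (pB := pB) (q := q) (A := A) (B := B) (r := r) (Breg := Breg)
    (sA := fun x => finalState W₀ (inputs (strArray x) 0) pA P.L)
    (sB := fun y => finalState W₀ (inputs (strArray y) 0) pB P.L)
    (sQ := queryState W₀ P.L pA pB q) hw le_rfl hP (n := n) rfl rfl rfl rfl rfl rfl rfl hpar hRZ hMg
    hZ hWV (by omega) (by omega) (hB₁.mono (by omega)) (hB₂.mono (by omega)) (hB₃.mono (by omega))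
    (fun i _ ρ' => (hok i 0 0 (Nat.zero_le _)).left ρ') (fun j _ l hl ρ' => (hok 0 j l hl).right ρ')
    (fun i _ j _ l hl ρ' => (hok i j l hl).query ρ')
  choose G D' s' hruns hG hD' hs' using hrun
  refine ⟨fun ρ => (s' ρ).reg 0, fun ρ => ?_, ?_⟩
  · obtain ⟨S, T, hS, hT, hexec⟩ := hruns ρ (MState.init n) ⟨rfl, fun _ _ => rfl⟩
    refine ⟨S, ⟨T, ?_, hexec⟩, hS.reg 0 (by norm_num)⟩
    have htime := hP.time_le hF hvr hv (t := t) (by omega) (show 1 ≤ R by omega) hC hTA' hTQ'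
    set U := P.n + P.KA * (TA + 1) + P.KB * (TA + 1) + P.KQ * (TQ + 1) + 2 * P.KM + P.Wd + P.w +
      P.KF + 12
    have hb0 : (0 : ℝ) < natRoot r n := by exact_mod_cast hb1
    have h1 : (U : ℝ) ≤ 125 * (R * C) * ((n : ℝ) ^ 2 / natRoot r n) := by
      rw [mul_div_assoc', le_div_iff₀ hb0, mul_comm]
      exact_mod_cast htime
    have h2 := div_natRoot_le hr0 hn
    calc (T : ℝ) ≤ X₀ * U := by exact_mod_cast hT
      _ ≤ X₀ * (125 * (R * C) * (2 * (n : ℝ) ^ (2 - 1 / (r : ℝ)))) := by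
          refine mul_le_mul_of_nonneg_left (h1.trans ?_) (Nat.cast_nonneg _)
          gcongr
      _ = (2 * (X₀ * (125 * (R * C))) : ℕ) * (n : ℝ) ^ (2 - 1 / (r : ℝ)) := by push_cast; ring
      _ ≤ _ := by
          refine mul_le_mul_of_nonneg_right ?_ (by positivity)
          exact_mod_cast Nat.le_add_left _ _
  · have hgood : ∀ ρ, (P.b ≠ 1 → ∀ i < P.N, ∀ j < P.M1, ∀ l ≤ P.lam, ∃ T ⊆ Finset.range R,
        2 * r + 1 ≤ T.card ∧ ∀ r' ∈ T, IsApprox α (block A P.d i) (window B P.g j l)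
          ((queryState W₀ P.L pA pB q (block A P.d i) (window B P.g j l)
            (shiftCoins P.Z r' ρ)).reg 0)) →
        IsApprox (α + (4 * α + 1) / natRoot r n) A B ((s' ρ).reg 0) := fun ρ hρ => by
      rw [hs' ρ]
      refine hP.isApprox hF hvr hα rfl rfl (hG ρ) (hD' ρ) fun hb i hi j hj l hl => ?_
      obtain ⟨T, hT, hc, hT'⟩ := hρ hb i hi j hj l hl
      refine isApprox_median ?_ hT hc hT'
      have h1 := (hblock i).1
      have h2 := (hwindow j l hl).1
      have h3 := editDist_le_length_add (block A P.d i) (window B P.g j l)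
      omega
    -- Here `L = 1`, so reliability `1 - 1 / L` says nothing about randomized queries; the band
    -- alone gives the answer.
    by_cases hb : P.b = 1
    · exact k.reliable_of_forall n fun ρ => hgood ρ fun hb' => absurd hb hb'
    -- One event for every pair of a block and a window, each with `2 * (2 * r) + 1` repetitions.
    · refine AlgKind.reliable_of_majority (L := P.L) (Z := P.Z) (h := 2 * r)
        (Finset.range P.N ×ˢ Finset.range P.M1 ×ˢ Finset.range P.lam1)
        (S := fun x => {ρ | IsApprox α (block A P.d x.1) (window B P.g x.2.1 x.2.2)
          ((queryState W₀ P.L pA pB q (block A P.d x.1) (window B P.g x.2.1 x.2.2) ρ).reg 0)})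
        hL1 hn (by omega) ?_ ?_ ?_ fun ρ hρ => hgood ρ fun _ i hi j hj l hl => ?_
      · rintro ⟨i, j, l⟩ hx
        simp only [Finset.mem_product, Finset.mem_range] at hx
        have := hP.lam1
        exact (hok i j l (by omega)).reliable
      · rintro ⟨i, j, l⟩ hx ρ ρ' hρ hmem
        simp only [Finset.mem_product, Finset.mem_range] at hx
        have := hP.lam1
        simp only [Set.mem_ofPred_eq] at hmem ⊢
        rwa [(hok i j l (by omega)).congr_coins hWV (by omega) fun y hy => hρ y (by omega)]
      · simp only [Finset.card_product, Finset.card_range, ← mul_assoc]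
        have : n * (P.N * P.M1 * P.lam1) * 2 ^ (2 * (2 * r) + 1) ≤ P.L ^ (2 * r + 1) :=
          hP.majority_le hF hvr hv (by omega) (lt_natRoot_succ_pow hr0)
        simpa only [← mul_assoc] using this
      · have := hP.lam1
        exact hρ (i, j, l) (by simp only [Finset.mem_product, Finset.mem_range]; omega)
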